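/- **Setting.** Let $(X,T,S(0),S(1),Y(0),Y(1),R)$ have law $\mathbb P$, where $X\in\mathbb R^{d_x}$ are covariates, $T\in\{0,1\}$ is a treatment, $S(t)\in\mathbb R^{d_s}$ are potential surrogates, $Y(t)\in\mathbb R$ are potential outcomes and $R\in\{0,1\}$ indicates that the outcome is observed. Put $S=S(T)$, $Y=Y(T)$; the recorded data point is $W=(X,T,S,Y,R)$, with $Y$ missing if $R=0$. For each $N$ let $W_1,\dots,W_N$ be the records of the first $N$ of a sequence of i.i.d. units with law $\mathbb P$. The target is $\delta^*=\mathbb E[Y(1)]-\mathbb E[Y(0)]$. The nuisance parameters $\eta^*=(e^*,r^*,\mu^*,\tilde\mu^*)$ are $$e^*(x)=\mathbb P(T=1\mid X=x),\qquad r^*(t,x,s)=\mathbb P(R=1\mid T=t,X=x,S=s),$$ $$\mu^*(t,x)=\mathbb E[Y\mid T=t,X=x],\qquad \tilde\mu^*(t,x,s)=\mathbb E[Y\mid T=t,R=1,X=x,S=s].$$ For $\eta=(e,r,\mu,\tilde\mu)$ let $$\psi(W;\delta,\eta)=\mu(1,X)-\mu(0,X)+\frac{TR\,(Y-\tilde\mu(1,X,S))}{e(X)\,r(1,X,S)}-\frac{(1-T)R\,(Y-\tilde\mu(0,X,S))}{(1-e(X))\,r(0,X,S)}$$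 $$\qquad+\frac{T}{e(X)}\bigl(\tilde\mu(1,X,S)-\mu(1,X)\bigr)-\frac{1-T}{1-e(X)}\bigl(\tilde\mu(0,X,S)-\mu(0,X)\bigr)-\delta,$$ and $V^*=\mathbb E[\psi^2(W;\delta^*,\eta^*)]$. **Estimators.** Fix an integer $K\ge1$. Partition $\{1,\dots,N\}$ at random into folds $\mathcal I_1,\dots,\mathcal I_K$, the partition depending only on the labels $R_1,\dots,R_N$ and on a random seed independent of the units, such that for each fold and each $b\in\{0,1\}$ the number of units of the fold with $R_i=b$ is $\frac1K\#\{i\le N:R_i=b\}+O_p(\sqrt N)$ (for example an even split of the labelled and of the unlabelled units, or independent uniformly random folds). Let $\hat\eta_k=(\hat e_k,\hat r_k,\hat\mu_k,\hat{\tilde\mu}_k)$ be computed from the records outside the $k$-th fold, jointly measurably in these records and the evaluation point. With $\hat{\mathbb E}_k$ the empirical average over $\mathcal I_k$, put $$\hat\delta=\frac1K\sum_{k=1}^K\hat{\mathbb E}_k[\psi(W;0,\hat\eta_k)],\qquad \hat V=\frac1K\sum_{k=1}^K\hat{\mathbb E}_k[\psi^2(W;\hat\delta,\hat\eta_k)].$$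 **Assumptions.** There are constants $\epsilon\in(0,1/2)$, $C>0$, $q>2$ such that the following hold. 1. (Unconfoundedness) For $t=0,1$: $(Y(t),S(t))\perp T\mid X$ and $R\perp Y(t)\mid (X,T=t,S(t))$. 2. (Strict overlap) Almost surely $\epsilon\le e^*(X)\le1-\epsilon$ and $\epsilon\le r^*(t,X,S(t))\le1$ for $t=0,1$. 3. (Moments) Almost surely $\operatorname{Var}\{Y\mid X,S,T\}$, $\operatorname{Var}\{Y\mid X,T\}$ and $\operatorname{Var}\{\tilde\mu^*(T,X,S)\mid T,X\}$ are at most $C$, and $\|Y(1)\|_q\vee\|Y(0)\|_q\le C$. 4. (Nuisance convergence) There are a limit $\eta_0=(e_0,r_0,\mu_0,\tilde\mu_0)$ and positive sequences $\rho_{N,e},\rho_{N,r},\rho_{N,\mu},\rho_{N,\tilde\mu}$ such that, for every $k$, the $L_2(\mathbb P)$ errors satisfy $\|\hat e_k-e_0\|_2=O_p(\rho_{N,e})$, $\|\hat r_k-r_0\|_2=O_p(\rho_{N,r})$, $\|\hat\mu_k-\mu_0\|_2=O_p(\rho_{N,\mu})$, $\|\hat{\tilde\mu}_k-\tilde\mu_0\|_2=O_p(\rho_{N,\tilde\mu})$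 (the functions being evaluated at an independent copy of $(X,T,S)$); almost surely $\hat e_k,e_0\in[\epsilon,1-\epsilon]$ and $\hat r_k,r_0\in[\epsilon,1]$. 5. (Rates) All four sequences are $o(1)$, and $\rho_{N,r}\rho_{N,\tilde\mu}$, $\rho_{N,e}\rho_{N,\tilde\mu}$ and $\rho_{N,e}\rho_{N,\mu}$ are $o(N^{-1/2})$. 6. (Correct specification) $\eta_0=\eta^*$ almost surely, in each component. **Theorem.** Under these assumptions $\hat V\overset{p}{\to}V^*$ as $N\to\infty$. If moreover $V^*>0$, then for every $\alpha\in(0,1)$ the interval $$\mathrm{CI}=\Bigl(\hat\delta-\Phi^{-1}(1-\alpha/2)\,(\hat V/N)^{1/2},\ \hat\delta+\Phi^{-1}(1-\alpha/2)\,(\hat V/N)^{1/2}\Bigr),$$ with $\Phi$ the standard normal distribution function, satisfies $\mathbb P(\delta^*\in\mathrm{CI})\to1-\alpha$ as $N\to\infty$. -/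

import Mathlib

open MeasureTheory ProbabilityTheory Filter Topology Asymptotics
open scoped ENNReal

namespace SurrogateATE

noncomputable section

/- A complete unit `(X, T, (S(0), S(1)), (Y(0), Y(1)), R)`: covariates, treatment, potential
surrogates, potential outcomes, labelling indicator. `true` is `1` and `false` is `0`. -/
abbrev Full (dx ds : ℕ) : Type :=
  (Fin dx → ℝ) × Bool × (Bool → Fin ds → ℝ) × (Bool → ℝ) × Bool

/- A recorded data point `W = (X, T, S, Y, R)`. A missing outcome (`R = 0`) is recorded as `0`;
as `R` is part of the record this carries the same information as the symbol `NA`. -/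
abbrev Obs (dx ds : ℕ) : Type :=
  (Fin dx → ℝ) × Bool × (Fin ds → ℝ) × ℝ × Bool

section Coordinates

variable {dx ds : ℕ}

/-- Covariates. -/
def X (d : Full dx ds) : Fin dx → ℝ := d.1

/-- Treatment. -/
def T (d : Full dx ds) : Bool := d.2.1

/-- Potential surrogates. -/
def Spot (t : Bool) (d : Full dx ds) : Fin ds → ℝ := d.2.2.1 t

/-- Potential outcomes. -/
def Ypot (t : Bool) (d : Full dx ds) : ℝ := d.2.2.2.1 t

/-- Labelling indicator. -/
def R (d : Full dx ds) : Bool := d.2.2.2.2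

/-- Realized surrogates `S = S(T)`. -/
def S (d : Full dx ds) : Fin ds → ℝ := Spot (T d) d

/-- Realized outcome `Y = Y(T)`. -/
def Y (d : Full dx ds) : ℝ := Ypot (T d) d

/-- The recorded part of a unit. -/
def observe (d : Full dx ds) : Obs dx ds :=
  (X d, T d, S d, if R d = true then Y d else 0, R d)

theorem measurable_X : Measurable (X : Full dx ds → _) := measurable_fst

theorem measurable_T : Measurable (T : Full dx ds → _) := measurable_fst.comp measurable_snd

theorem measurable_R : Measurable (R : Full dx ds → _) :=
  measurable_snd.comp (measurable_snd.comp (measurable_snd.comp measurable_snd))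

theorem measurable_Spot (t : Bool) : Measurable (Spot t : Full dx ds → _) :=
  (measurable_pi_apply t).comp (measurable_fst.comp (measurable_snd.comp measurable_snd))

theorem measurable_Ypot (t : Bool) : Measurable (Ypot t : Full dx ds → _) :=
  (measurable_pi_apply t).comp
    (measurable_fst.comp (measurable_snd.comp (measurable_snd.comp measurable_snd)))

end Coordinates

/-- Values of the nuisance parameters `(e, r, μ, μ̃)`. -/
structure Nuisance (dx ds : ℕ) where
  /-- treatment propensity score `e(x)` -/
  e : (Fin dx → ℝ) → ℝ
  /-- labelling propensity score `r(t, x, s)` -/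
  r : Bool → (Fin dx → ℝ) → (Fin ds → ℝ) → ℝ
  /-- outcome regression `μ(t, x)` -/
  mu : Bool → (Fin dx → ℝ) → ℝ
  /-- outcome regression with surrogates `μ̃(t, x, s)` -/
  muS : Bool → (Fin dx → ℝ) → (Fin ds → ℝ) → ℝ

section Population

variable {dx ds : ℕ} (P : Measure (Full dx ds))

/-- The true nuisance parameters:
`e*(x) = P(T = 1 | X = x)`, `r*(t, x, s) = P(R = 1 | T = t, X = x, S = s)`,
`μ*(t, x) = E[Y | T = t, X = x]`, `μ̃*(t, x, s) = E[Y | T = t, R = 1, X = x, S = s]`. -/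
def etaStar [IsFiniteMeasure P] : Nuisance dx ds where
  e x := (condDistrib T X P x).real {true}
  r t x s := (condDistrib R (fun d => (X d, S d)) (P[|{d | T d = t}]) (x, s)).real {true}
  mu t x := ∫ y, y ∂(condDistrib Y X (P[|{d | T d = t}]) x)
  muS t x s :=
    ∫ y, y ∂(condDistrib Y (fun d => (X d, S d)) (P[|{d | T d = t ∧ R d = true}]) (x, s))

/-- The average treatment effect `δ* = E[Y(1)] - E[Y(0)]`. -/
def deltaStar : ℝ := ∫ d, Ypot true d ∂P - ∫ d, Ypot false d ∂P

/-- Unconfoundedness: for `t = 0, 1`, `(Y(t), S(t)) ⟂ T | X` and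
`R ⟂ Y(t) | (X, T = t, S(t))`. -/
structure Unconfounded [IsFiniteMeasure P] : Prop where
  treatment : ∀ t : Bool,
    CondIndepFun (MeasurableSpace.comap X inferInstance) measurable_X.comap_le
      (fun d => (Ypot t d, Spot t d)) T P
  labelling : ∀ t : Bool,
    CondIndepFun (MeasurableSpace.comap (fun d => (X d, Spot t d)) inferInstance)
      (measurable_X.prodMk (measurable_Spot t)).comap_le R (Ypot t) (P[|{d | T d = t}])

/-- Strict overlap with constant `ε`. -/
structure StrictOverlap [IsFiniteMeasure P] (ε : ℝ) : Prop where
  treatment : ∀ᵐ d ∂P, (etaStar P).e (X d) ∈ Set.Icc ε (1 - ε)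
  labelling : ∀ t : Bool, ∀ᵐ d ∂P, (etaStar P).r t (X d) (Spot t d) ∈ Set.Icc ε 1

/-- The moment condition with constants `C` and `q`. -/
structure MomentCondition [IsFiniteMeasure P] (C q : ℝ) : Prop where
  varYXST : ∀ᵐ d ∂P,
    |condVar (MeasurableSpace.comap (fun d => (X d, S d, T d)) inferInstance) Y P d| ≤ C
  varYXT : ∀ᵐ d ∂P,
    |condVar (MeasurableSpace.comap (fun d => (X d, T d)) inferInstance) Y P d| ≤ C
  varMuS : ∀ᵐ d ∂P,
    |condVar (MeasurableSpace.comap (fun d => (T d, X d)) inferInstance)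
      (fun d => (etaStar P).muS (T d) (X d) (S d)) P d| ≤ C
  normY : ∀ t : Bool, eLpNorm (Ypot t) (ENNReal.ofReal q) P ≤ ENNReal.ofReal C

end Population

/-- The `0`/`1` value of a binary variable. -/
def ind (b : Bool) : ℝ := if b = true then 1 else 0

section Score

variable {dx ds : ℕ}

/-- `ψ(W; δ, η) + δ`, which does not depend on `δ`. -/
def score (η : Nuisance dx ds) : Obs dx ds → ℝ
  | (x, t, s, y, r) =>
    η.mu true x - η.mu false x
      + ind t * ind r / (η.e x * η.r true x s) * (y - η.muS true x s)
      - (1 - ind t) * ind r / ((1 - η.e x) * η.r false x s) * (y - η.muS false x s)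
      + ind t / η.e x * (η.muS true x s - η.mu true x)
      - (1 - ind t) / (1 - η.e x) * (η.muS false x s - η.mu false x)

/-- The efficient influence function `ψ(W; δ, η)`. -/
def psi (δ : ℝ) (η : Nuisance dx ds) (w : Obs dx ds) : ℝ := score η w - δ

/-- The efficiency bound `V* = E[ψ²(W; δ*, η*)]`. -/
def VStar (P : Measure (Full dx ds)) [IsFiniteMeasure P] : ℝ :=
  ∫ d, psi (deltaStar P) (etaStar P) (observe d) ^ 2 ∂P

end Score

/-- `Z N = O_p(a N)`: for every `ε > 0` there is `M` with `μ(Z N > M * a N) ≤ ε` for all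
large `N`. -/
def IsBigOp {Ω : Type*} [MeasurableSpace Ω] (μ : Measure Ω) (Z : ℕ → Ω → ℝ≥0∞) (a : ℕ → ℝ) :
    Prop :=
  ∀ ε : ℝ, 0 < ε → ∃ M : ℝ, 0 < M ∧
    ∀ᶠ N in atTop, μ {ω | ENNReal.ofReal (M * a N) < Z N ω} ≤ ENNReal.ofReal ε

section CrossFitting

variable {dx ds K : ℕ}

/-- A learner: from the sample size `N`, a set `J` of indices and the records with index in `J`
it computes estimates of the nuisance parameters. -/
abbrev Learner (dx ds : ℕ) : Type :=
  (N : ℕ) → (J : Finset (Fin N)) → (J → Obs dx ds) → Nuisance dx ds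

/-- The estimates are jointly measurable in the training data and the evaluation point. -/
structure LearnerMeasurable (L : Learner dx ds) : Prop where
  e : ∀ (N : ℕ) (J : Finset (Fin N)),
    Measurable fun p : (J → Obs dx ds) × (Fin dx → ℝ) => (L N J p.1).e p.2
  r : ∀ (N : ℕ) (J : Finset (Fin N)) (t : Bool),
    Measurable fun p : (J → Obs dx ds) × (Fin dx → ℝ) × (Fin ds → ℝ) =>
    (L N J p.1).r t p.2.1 p.2.2
  mu : ∀ (N : ℕ) (J : Finset (Fin N)) (t : Bool),
    Measurable fun p : (J → Obs dx ds) × (Fin dx → ℝ) => (L N J p.1).mu t p.2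
  muS : ∀ (N : ℕ) (J : Finset (Fin N)) (t : Bool),
    Measurable fun p : (J → Obs dx ds) × (Fin dx → ℝ) × (Fin ds → ℝ) =>
    (L N J p.1).muS t p.2.1 p.2.2

/-- A rule for drawing `K` folds of `N` units: the fold of every unit, from the labelling
indicators of all units (folds may be stratified by them) and a random seed. -/
abbrev FoldRule (K : ℕ) (𝒰 : Type*) : Type _ := (N : ℕ) → (Fin N → Bool) → 𝒰 → Fin N → Fin K

/-- The data of one sample: `N` complete units and the fold of each of them. -/
structure Sample (dx ds K N : ℕ) where
  /-- the units -/
  unit : Fin N → Full dx ds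
  /-- the fold that a unit belongs to -/
  fold : Fin N → Fin K

/-- The first `N` of the units `D 0, D 1, …`, with folds drawn by `F` from the seed `u`. -/
def drawSample {𝒰 : Type*} (F : FoldRule K 𝒰) (D : ℕ → Full dx ds) (u : 𝒰) (N : ℕ) :
    Sample dx ds K N where
  unit i := D i
  fold := F N (fun i => R (D i)) u

namespace Sample

variable {N : ℕ} (s : Sample dx ds K N)

/-- The `k`-th fold. -/
def foldSet (k : Fin K) : Finset (Fin N) := Finset.univ.filter fun i => s.fold i = k

/-- The number of units with `R = b`. -/
def labelCount (b : Bool) : ℕ := (Finset.univ.filter fun i => R (s.unit i) = b).card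

/-- The number of units with `R = b` in the `k`-th fold. -/
def foldLabelCount (k : Fin K) (b : Bool) : ℕ :=
  ((s.foldSet k).filter fun i => R (s.unit i) = b).card

/-- The nuisance estimates `η̂_k`, trained on all records outside the `k`-th fold. -/
def etaHat (L : Learner dx ds) (k : Fin K) : Nuisance dx ds :=
  L N (s.foldSet k)ᶜ fun i => observe (s.unit i)

/-- The empirical average over the `k`-th fold. -/
def foldMean (k : Fin K) (g : Obs dx ds → ℝ) : ℝ :=
  (∑ i ∈ s.foldSet k, g (observe (s.unit i))) / (s.foldSet k).card

/-- The cross-fitted estimator `δ̂`. -/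
def deltaHat (L : Learner dx ds) : ℝ :=
  (∑ k : Fin K, s.foldMean k (score (s.etaHat L k))) / K

/-- The cross-fitted plug-in variance estimator `V̂`. -/
def VHat (L : Learner dx ds) : ℝ :=
  (∑ k : Fin K, s.foldMean k fun w => psi (s.deltaHat L) (s.etaHat L k) w ^ 2) / K

end Sample

/-- The `L²(P)` distance between `η.e` and `η'.e`, as functions of `W`. -/
def distE (P : Measure (Full dx ds)) (η η' : Nuisance dx ds) : ℝ≥0∞ :=
  eLpNorm (fun d => η.e (X d) - η'.e (X d)) 2 P

/-- The `L²(P)` distance between `η.r` and `η'.r`, as functions of `W`. -/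
def distR (P : Measure (Full dx ds)) (η η' : Nuisance dx ds) : ℝ≥0∞ :=
  eLpNorm (fun d => η.r (T d) (X d) (S d) - η'.r (T d) (X d) (S d)) 2 P

/-- The `L²(P)` distance between `η.mu` and `η'.mu`, as functions of `W`. -/
def distMu (P : Measure (Full dx ds)) (η η' : Nuisance dx ds) : ℝ≥0∞ :=
  eLpNorm (fun d => η.mu (T d) (X d) - η'.mu (T d) (X d)) 2 P

/-- The `L²(P)` distance between `η.muS` and `η'.muS`, as functions of `W`. -/
def distMuS (P : Measure (Full dx ds)) (η η' : Nuisance dx ds) : ℝ≥0∞ :=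
  eLpNorm (fun d => η.muS (T d) (X d) (S d) - η'.muS (T d) (X d) (S d)) 2 P

/-- Almost sure bounds for the propensity scores in `η`. -/
structure PropensityBounded (P : Measure (Full dx ds)) (ε : ℝ) (η : Nuisance dx ds) : Prop where
  e : ∀ᵐ d ∂P, η.e (X d) ∈ Set.Icc ε (1 - ε)
  r : ∀ᵐ d ∂P, η.r (T d) (X d) (S d) ∈ Set.Icc ε 1

/-- The components of `η` and `η'`, as functions of `W`, agree almost surely. -/
structure AgreeAE (P : Measure (Full dx ds)) (η η' : Nuisance dx ds) : Prop where
  e : ∀ᵐ d ∂P, η.e (X d) = η'.e (X d)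
  r : ∀ᵐ d ∂P, η.r (T d) (X d) (S d) = η'.r (T d) (X d) (S d)
  mu : ∀ᵐ d ∂P, η.mu (T d) (X d) = η'.mu (T d) (X d)
  muS : ∀ᵐ d ∂P, η.muS (T d) (X d) (S d) = η'.muS (T d) (X d) (S d)

/-- The sampling design: the units are i.i.d. with law `P`; the seed is independent of them; for
every fold and either label, the number of units with that label in the fold differs from an
even share by `O_p(√N)`. An even split stratified by the label (difference zero) and the
assignment of each unit to an independent uniformly random fold are both of this kind. -/
structure Design {Ω 𝒰 : Type*} [MeasurableSpace Ω] [MeasurableSpace 𝒰] (μ : Measure Ω)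
    (P : Measure (Full dx ds)) (D : ℕ → Ω → Full dx ds) (F : FoldRule K 𝒰) (U : ℕ → Ω → 𝒰) :
    Prop where
  measurable_unit : ∀ i, Measurable (D i)
  law : ∀ i, μ.map (D i) = P
  indep : iIndepFun D μ
  measurable_seed : ∀ N, Measurable (U N)
  measurable_rule : ∀ N b, Measurable (F N b)
  indep_seed : ∀ N, IndepFun (U N) (fun ω i => D i ω) μ
  even : ∀ (k : Fin K) (b : Bool),
    IsBigOp μ
      (fun N ω => ENNReal.ofReal
        |((drawSample F (fun i => D i ω) (U N ω) N).foldLabelCount k b : ℝ)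
          - ((drawSample F (fun i => D i ω) (U N ω) N).labelCount b : ℝ) / K|)
      (fun N => Real.sqrt N)

end CrossFitting

/-- The standard normal quantile function `Φ⁻¹`. -/
def stdNormalQuantile (p : ℝ) : ℝ := sInf {z : ℝ | p ≤ cdf (gaussianReal 0 1) z}

/-- The Wald confidence interval `δ̂ ± Φ⁻¹(1 - α / 2) (V̂ / N)^{1/2}`. -/
def waldInterval (N : ℕ) (δ V α : ℝ) : Set ℝ :=
  Set.Ioo (δ - stdNormalQuantile (1 - α / 2) * Real.sqrt (V / N))
    (δ + stdNormalQuantile (1 - α / 2) * Real.sqrt (V / N))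

end

end SurrogateATE

/-! Let `f = ψ(·; δ*, η*)`. It has mean zero and second moment `V*`. The heart of the matter is the
asymptotically linear expansion `√N (δ̂ - δ*) = N^{-1/2} ∑ f(D_i) + o_p(1)`. Given this and the
consistency of `V̂`, the central limit theorem and Slutsky's lemma yield the coverage
(`tendsto_measure_studentized_lt`).

The remainder in the expansion consists of sums over a fold of `g = score(η̂_k) - score(η*)`, a
function that depends on records outside the fold only. Two properties of `g` matter. Its `L²(P)`
norm vanishes (`exists_score_continuity`): errors of `μ` and `μ̃` enter through their own norms,
while errors of the propensities are bounded weights on squared residuals that are merely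
integrable, so that uniform integrability is used and no rate results. Its `P`-mean is
`o_p(N^{-1/2})`: identification through unconfoundedness turns the bias into an integral of `(μ -
μ*)(e - e*)` plus an integral of `(μ̃ - μ̃*)(r - r*)`, with bounded weights
(`integral_armScore_sub`), and Cauchy–Schwarz brings in the product rates
(`enorm_integral_score_sub_le`).

Folds may depend on the labels, so the units of a fold need not be i.i.d. with law `P` given the
fold. Given all labels and the seed, however, the units are independent with laws `labelLaw P R b`.
Sums over a fold are therefore centered at label-conditional means `m_b`; the centered part is
controlled by its conditional variance (`Design.lintegral_sq_foldSum_le`). What is left is `∑_b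
n_{k,b} m_b`, with `n_{k,b}` the label counts of the fold. It differs from `(N/K) ∫ g dP` by `∑_b
(n_{k,b} - N P(R=b)/K) m_b`, that is by `O_p(√N)` times `o_p(1)`, because the design keeps the
counts within `O_p(√N)` of an even share. This is `Design.isLittleOP_foldSum`.

For `V̂` the squares are expanded around `f²`: the law of large numbers handles `f²`, the mean
squares of `g` over a fold vanish, and Cauchy–Schwarz handles the cross terms
(`Design.isLittleOP_VHat`). -/

namespace SurrogateATE

noncomputable section

/-! ### Calculus of stochastic orders `o_p(1)` and `O_p(1)`. -/

section StochasticOrder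

variable {Ω : Type*} [MeasurableSpace Ω] {μ : Measure Ω}

/-- `Z N = o_p(1)`. -/
def IsLittleOP (μ : Measure Ω) (Z : ℕ → Ω → ℝ) : Prop :=
  ∀ t : ℝ, 0 < t → ∀ ε : ℝ≥0∞, 0 < ε → ∀ᶠ N in atTop, μ {ω | t ≤ |Z N ω|} ≤ ε

/-- `Z N = O_p(1)`. -/
def IsBoundedP (μ : Measure Ω) (Z : ℕ → Ω → ℝ) : Prop :=
  ∀ ε : ℝ≥0∞, 0 < ε → ∃ M : ℝ, 0 < M ∧ ∀ᶠ N in atTop, μ {ω | M ≤ |Z N ω|} ≤ ε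

variable {Z W : ℕ → Ω → ℝ}

theorem measure_le_of_subset_union {A B C : Set Ω} {ε : ℝ≥0∞} (h : A ⊆ B ∪ C)
    (hB : μ B ≤ ε / 2) (hC : μ C ≤ ε / 2) : μ A ≤ ε :=
  calc μ A ≤ μ B + μ C := (measure_mono h).trans (measure_union_le _ _)
    _ ≤ ε / 2 + ε / 2 := add_le_add hB hC
    _ = ε := ENNReal.add_halves ε

theorem IsLittleOP.tendstoInMeasure {c : ℝ} (h : IsLittleOP μ fun N ω => Z N ω - c) :
    TendstoInMeasure μ Z atTop fun _ => c := by
  rw [tendstoInMeasure_iff_norm]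
  intro t ht
  rw [ENNReal.tendsto_nhds_zero]
  intro ε hε
  simpa [Real.norm_eq_abs] using h t ht ε hε

theorem IsLittleOP.of_tendstoInMeasure {c : ℝ} (h : TendstoInMeasure μ Z atTop fun _ => c) :
    IsLittleOP μ fun N ω => Z N ω - c := by
  rw [tendstoInMeasure_iff_norm] at h
  intro t ht ε hε
  have := h t ht
  rw [ENNReal.tendsto_nhds_zero] at this
  simpa [Real.norm_eq_abs] using this ε hε

theorem IsLittleOP.isBoundedP (h : IsLittleOP μ Z) : IsBoundedP μ Z :=
  fun ε hε => ⟨1, one_pos, h 1 one_pos ε hε⟩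

theorem IsLittleOP.of_le (h : IsLittleOP μ W) (hle : ∀ᶠ N in atTop, ∀ᵐ ω ∂μ, |Z N ω| ≤ |W N ω|) :
    IsLittleOP μ Z := by
  intro t ht ε hε
  filter_upwards [h t ht ε hε, hle] with N hN hN'
  refine (measure_mono_ae ?_).trans hN
  filter_upwards [hN'] with ω hω h1
  exact le_trans h1 hω

theorem IsBoundedP.of_le (h : IsBoundedP μ W) (hle : ∀ᶠ N in atTop, ∀ᵐ ω ∂μ, |Z N ω| ≤ |W N ω|) :
    IsBoundedP μ Z := by
  intro ε hε
  obtain ⟨M, hM, h⟩ := h ε hε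
  refine ⟨M, hM, ?_⟩
  filter_upwards [h, hle] with N hN hN'
  refine (measure_mono_ae ?_).trans hN
  filter_upwards [hN'] with ω hω h1
  exact le_trans h1 hω

theorem IsLittleOP.congr (h : IsLittleOP μ W) (hle : ∀ N ω, Z N ω = W N ω) : IsLittleOP μ Z :=
  h.of_le (Eventually.of_forall fun N => ae_of_all _ fun ω => by rw [hle])

/-- A sequence that agrees with an `o_p(1)` sequence off a set of vanishing probability. -/
theorem IsLittleOP.of_eq_off (h : IsLittleOP μ W) {A : ℕ → Set Ω}
    (hA : ∀ ε : ℝ≥0∞, 0 < ε → ∀ᶠ N in atTop, μ (A N) ≤ ε)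
    (heq : ∀ᶠ N in atTop, ∀ ω ∉ A N, |Z N ω| ≤ |W N ω|) : IsLittleOP μ Z := by
  intro t ht ε hε
  filter_upwards [h t ht (ε / 2) (ENNReal.half_pos hε.ne'), hA (ε / 2) (ENNReal.half_pos hε.ne'),
    heq] with N h1 h2 h3
  refine measure_le_of_subset_union (fun ω hω => ?_) h1 h2
  by_cases hωA : ω ∈ A N
  · exact Or.inr hωA
  · exact Or.inl (le_trans hω (h3 ω hωA))

theorem IsLittleOP.add (hZ : IsLittleOP μ Z) (hW : IsLittleOP μ W) :
    IsLittleOP μ fun N ω => Z N ω + W N ω := by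
  intro t ht ε hε
  filter_upwards [hZ (t / 2) (half_pos ht) (ε / 2) (ENNReal.half_pos hε.ne'),
    hW (t / 2) (half_pos ht) (ε / 2) (ENNReal.half_pos hε.ne')] with N h1 h2
  refine measure_le_of_subset_union (fun ω hω => ?_) h1 h2
  by_contra hcon
  simp only [Set.mem_union, Set.mem_ofPred_eq, not_or, not_le] at hcon hω
  linarith [abs_add_le (Z N ω) (W N ω)]

theorem IsBoundedP.add (hZ : IsBoundedP μ Z) (hW : IsBoundedP μ W) :
    IsBoundedP μ fun N ω => Z N ω + W N ω := by
  intro ε hε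
  obtain ⟨M, hM, h⟩ := hZ (ε / 2) (ENNReal.half_pos hε.ne')
  obtain ⟨M', hM', h'⟩ := hW (ε / 2) (ENNReal.half_pos hε.ne')
  refine ⟨M + M', by positivity, ?_⟩
  filter_upwards [h, h'] with N h1 h2
  refine measure_le_of_subset_union (fun ω hω => ?_) h1 h2
  by_contra hcon
  simp only [Set.mem_union, Set.mem_ofPred_eq, not_or, not_le] at hcon hω
  linarith [abs_add_le (Z N ω) (W N ω)]

theorem IsLittleOP.neg (hZ : IsLittleOP μ Z) : IsLittleOP μ fun N ω => -Z N ω :=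
  hZ.of_le (Eventually.of_forall fun N => ae_of_all _ fun ω => by simp)

theorem IsLittleOP.sub (hZ : IsLittleOP μ Z) (hW : IsLittleOP μ W) :
    IsLittleOP μ fun N ω => Z N ω - W N ω := by
  simpa only [sub_eq_add_neg] using hZ.add hW.neg

theorem isLittleOP_zero : IsLittleOP μ fun _ _ => 0 := by
  intro t ht ε hε
  have : {ω : Ω | t ≤ |(0 : ℝ)|} = ∅ := by
    ext ω
    simp [ht]
  exact Eventually.of_forall fun N => by rw [this]; simp

theorem isLittleOP_of_tendsto {a : ℕ → ℝ} (h : Tendsto a atTop (𝓝 0)) :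
    IsLittleOP μ fun N _ => a N := by
  intro t ht ε hε
  have h' := h.abs
  rw [abs_zero] at h'
  filter_upwards [h'.eventually (gt_mem_nhds ht)] with N hN
  have : {ω : Ω | t ≤ |a N|} = ∅ := by
    ext ω
    simp [hN]
  simp [this]

theorem isBoundedP_const (c : ℝ) : IsBoundedP μ fun _ _ => c := by
  intro ε hε
  refine ⟨|c| + 1, by positivity, Eventually.of_forall fun N => ?_⟩
  have : {ω : Ω | |c| + 1 ≤ |c|} = ∅ := by
    ext ω
    simp
  rw [this]; simp

theorem IsLittleOP.sum {ι : Type*} (s : Finset ι) {Z : ι → ℕ → Ω → ℝ}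
    (h : ∀ i ∈ s, IsLittleOP μ (Z i)) : IsLittleOP μ fun N ω => ∑ i ∈ s, Z i N ω := by
  classical
  induction s using Finset.induction_on with
  | empty => simpa using isLittleOP_zero
  | insert i s hi ih =>
    simp only [Finset.sum_insert hi]
    exact (h i (by simp)).add (ih fun j hj => h j (by simp [hj]))

theorem IsBoundedP.sum {ι : Type*} (s : Finset ι) {Z : ι → ℕ → Ω → ℝ}
    (h : ∀ i ∈ s, IsBoundedP μ (Z i)) : IsBoundedP μ fun N ω => ∑ i ∈ s, Z i N ω := by
  classical
  induction s using Finset.induction_on with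
  | empty => simpa using isBoundedP_const 0
  | insert i s hi ih =>
    simp only [Finset.sum_insert hi]
    exact (h i (by simp)).add (ih fun j hj => h j (by simp [hj]))

theorem IsBoundedP.mul_isLittleOP (hZ : IsBoundedP μ Z) (hW : IsLittleOP μ W) :
    IsLittleOP μ fun N ω => Z N ω * W N ω := by
  intro t ht ε hε
  obtain ⟨M, hM, h⟩ := hZ (ε / 2) (ENNReal.half_pos hε.ne')
  -- A product of size `t` forces the first factor above `M` or the second above `t / M`.
  filter_upwards [h, hW (t / M) (div_pos ht hM) (ε / 2) (ENNReal.half_pos hε.ne')] with N h1 h2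
  refine measure_le_of_subset_union (fun ω hω => ?_) h1 h2
  by_contra hcon
  simp only [Set.mem_union, Set.mem_ofPred_eq, not_or, not_le, abs_mul] at hcon hω
  have h3 : |Z N ω| * |W N ω| ≤ M * |W N ω| :=
    mul_le_mul_of_nonneg_right hcon.1.le (abs_nonneg _)
  have h4 : M * |W N ω| < M * (t / M) := by gcongr; exact hcon.2
  rw [mul_div_cancel₀ _ hM.ne'] at h4
  linarith

theorem IsLittleOP.mul_isBoundedP (hZ : IsLittleOP μ Z) (hW : IsBoundedP μ W) :
    IsLittleOP μ fun N ω => Z N ω * W N ω := by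
  simpa only [mul_comm] using hW.mul_isLittleOP hZ

theorem IsBoundedP.mul (hZ : IsBoundedP μ Z) (hW : IsBoundedP μ W) :
    IsBoundedP μ fun N ω => Z N ω * W N ω := by
  intro ε hε
  obtain ⟨M, hM, h⟩ := hZ (ε / 2) (ENNReal.half_pos hε.ne')
  obtain ⟨M', hM', h'⟩ := hW (ε / 2) (ENNReal.half_pos hε.ne')
  refine ⟨M * M', by positivity, ?_⟩
  filter_upwards [h, h'] with N h1 h2
  refine measure_le_of_subset_union (fun ω hω => ?_) h1 h2
  by_contra hcon
  simp only [Set.mem_union, Set.mem_ofPred_eq, not_or, not_le, abs_mul] at hcon hω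
  have := mul_lt_mul'' hcon.1 hcon.2 (abs_nonneg _) (abs_nonneg _)
  linarith

theorem IsLittleOP.const_mul (c : ℝ) (hZ : IsLittleOP μ Z) : IsLittleOP μ fun N ω => c * Z N ω :=
  (isBoundedP_const c).mul_isLittleOP hZ

theorem IsLittleOP.sqrt (hZ : IsLittleOP μ Z) : IsLittleOP μ fun N ω => √(Z N ω) := by
  intro t ht ε hε
  filter_upwards [hZ (t ^ 2) (by positivity) ε hε] with N hN
  refine (measure_mono fun ω hω => ?_).trans hN
  simp only [Set.mem_ofPred_eq] at hω ⊢
  rw [abs_of_nonneg (Real.sqrt_nonneg _)] at hω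
  exact ((Real.le_sqrt' ht).1 hω).trans (le_abs_self _)

/-- Inverses stay bounded in probability away from zero. -/
theorem IsLittleOP.isBoundedP_inv {c : ℝ} (hc : 0 < c) (hZ : IsLittleOP μ fun N ω => Z N ω - c) :
    IsBoundedP μ fun N ω => (Z N ω)⁻¹ := by
  intro ε hε
  -- Within `c / 2` of `c` the inverse is below `2 / c`; the level `4 / c` leaves room.
  refine ⟨4 / c, by positivity, ?_⟩
  filter_upwards [hZ (c / 2) (half_pos hc) ε hε] with N hN
  refine (measure_mono fun ω hω => ?_).trans hN
  simp only [Set.mem_ofPred_eq] at hω ⊢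
  by_contra hcon
  rw [not_le, abs_lt] at hcon
  have hZ' : c / 2 < Z N ω := by linarith
  rw [abs_of_pos (inv_pos.2 (by linarith))] at hω
  have h1 : (Z N ω)⁻¹ < (c / 2)⁻¹ := (inv_lt_inv₀ (by linarith) (by positivity)).2 hZ'
  have h2 : (c / 2)⁻¹ = 2 / c := by field_simp
  have h3 : 2 / c ≤ 4 / c := by gcongr; norm_num
  linarith

/-- Chebyshev: bounded second moments. -/
theorem isBoundedP_of_lintegral_sq {B : ℝ≥0∞} (hB : B ≠ ∞) (hZ : ∀ N, AEMeasurable (Z N) μ)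
    (h : ∀ᶠ N in atTop, ∫⁻ ω, ENNReal.ofReal (Z N ω ^ 2) ∂μ ≤ B) : IsBoundedP μ Z := by
  intro ε hε
  have hlim : Tendsto (fun n : ℕ => B / ENNReal.ofReal (((n : ℝ) + 1) ^ 2)) atTop (𝓝 0) := by
    have : Tendsto (fun n : ℕ => ENNReal.ofReal (((n : ℝ) + 1) ^ 2)) atTop (𝓝 ∞) := by
      rw [ENNReal.tendsto_ofReal_nhds_top]
      exact (tendsto_pow_atTop two_ne_zero).comp
        (tendsto_atTop_add_const_right _ _ tendsto_natCast_atTop_atTop)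
    have h2 := ENNReal.Tendsto.const_div this (Or.inr hB)
    simpa using h2
  rw [ENNReal.tendsto_nhds_zero] at hlim
  obtain ⟨n, hn⟩ := (hlim ε hε).exists
  refine ⟨n + 1, by positivity, ?_⟩
  filter_upwards [h] with N hN
  have ht2 : ENNReal.ofReal (((n : ℝ) + 1) ^ 2) ≠ 0 := by simp; positivity
  refine le_trans ?_ hn
  calc μ {ω | (n : ℝ) + 1 ≤ |Z N ω|}
      ≤ μ {ω | ENNReal.ofReal (((n : ℝ) + 1) ^ 2) ≤ ENNReal.ofReal (Z N ω ^ 2)} := by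
        refine measure_mono fun ω hω => ENNReal.ofReal_le_ofReal ?_
        rw [← sq_abs (Z N ω)]
        exact pow_le_pow_left₀ (by positivity) hω 2
    _ ≤ (∫⁻ ω, ENNReal.ofReal (Z N ω ^ 2) ∂μ) / ENNReal.ofReal (((n : ℝ) + 1) ^ 2) :=
        meas_ge_le_lintegral_div ((hZ N).pow_const 2).ennreal_ofReal ht2 ENNReal.ofReal_ne_top
    _ ≤ B / ENNReal.ofReal (((n : ℝ) + 1) ^ 2) := by gcongr

end StochasticOrder

/-! ### Normal quantiles and coverage of studentized intervals. -/

section Coverage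

/-- A distribution function jumps only at atoms, the jump being the mass of the point, and a
nondegenerate Gaussian has none. -/
theorem cdf_stdNormal_continuous : Continuous (cdf (gaussianReal 0 1)) := by
  have : NullSingletonClass (gaussianReal 0 1) := nullSingletonClass_gaussianReal one_ne_zero
  rw [continuous_iff_continuousAt]
  intro x
  rw [(cdf (gaussianReal 0 1)).mono.continuousAt_iff_leftLim_eq_rightLim,
    (cdf (gaussianReal 0 1)).rightLim_eq]
  have h := (cdf (gaussianReal 0 1)).measure_singleton x
  rw [measure_cdf, measure_singleton] at h
  have h1 := (cdf (gaussianReal 0 1)).mono.leftLim_le (le_refl x)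
  have h2 := ENNReal.ofReal_eq_zero.1 h.symm
  linarith

theorem cdf_stdNormal_neg (x : ℝ) :
    cdf (gaussianReal 0 1) (-x) = 1 - cdf (gaussianReal 0 1) x := by
  have : NullSingletonClass (gaussianReal 0 1) := nullSingletonClass_gaussianReal one_ne_zero
  have hmap : (gaussianReal 0 1).map (fun x => -x) = gaussianReal 0 1 := by
    simpa using gaussianReal_map_neg (μ := 0) (v := 1)
  rw [cdf_eq_real, cdf_eq_real]
  have h1 : (gaussianReal 0 1).real (Set.Iic (-x)) = (gaussianReal 0 1).real (Set.Ici x) := by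
    conv_lhs => rw [← hmap]
    rw [map_measureReal_apply measurable_neg measurableSet_Iic]
    congr 1
    ext y
    simp
  rw [h1, ← Set.compl_Iio, probReal_compl_eq_one_sub measurableSet_Iio]
  congr 1
  exact measureReal_congr Iio_ae_eq_Iic

/-- By continuity the superlevel set `{p ≤ Φ}` is closed, so its infimum belongs to it. Were `Φ`
strictly above `p` there, a point slightly to the left would still be in the set. -/
theorem cdf_stdNormalQuantile {p : ℝ} (hp : p ∈ Set.Ioo (0 : ℝ) 1) :
    cdf (gaussianReal 0 1) (stdNormalQuantile p) = p := by
  set Φ := cdf (gaussianReal 0 1) with hΦ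
  have hcont : Continuous Φ := cdf_stdNormal_continuous
  obtain ⟨a, ha⟩ := ((tendsto_cdf_atBot (gaussianReal 0 1)).eventually (gt_mem_nhds hp.1)).exists
  obtain ⟨b, hb⟩ := ((tendsto_cdf_atTop (gaussianReal 0 1)).eventually (lt_mem_nhds hp.2)).exists
  have hne : {z : ℝ | p ≤ Φ z}.Nonempty := ⟨b, hb.le⟩
  have hbdd : BddBelow {z : ℝ | p ≤ Φ z} := by
    refine ⟨a, fun z hz => ?_⟩
    by_contra h
    exact absurd (hz.trans ((monotone_cdf _) (not_le.1 h).le)) (not_le.2 ha)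
  have hclosed : IsClosed {z : ℝ | p ≤ Φ z} := isClosed_le continuous_const hcont
  refine le_antisymm ?_ (hclosed.csInf_mem hne hbdd)
  by_contra hlt
  rw [not_le] at hlt
  have hev : ∀ᶠ z in 𝓝 (stdNormalQuantile p), p < Φ z := hcont.continuousAt.eventually
    (lt_mem_nhds hlt)
  obtain ⟨δ, hδ, hball⟩ := Metric.eventually_nhds_iff.1 hev
  have := hball (y := stdNormalQuantile p - δ / 2) (by
    rw [Real.dist_eq, sub_sub_cancel_left, abs_neg, abs_of_pos (half_pos hδ)]; linarith)
  have h2 : stdNormalQuantile p ≤ stdNormalQuantile p - δ / 2 := csInf_le hbdd this.le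
  linarith

theorem stdNormal_Ioo_quantile {α : ℝ} (hα : α ∈ Set.Ioo (0 : ℝ) 1) :
    0 < stdNormalQuantile (1 - α / 2) ∧
    (gaussianReal 0 1).real
      (Set.Ioo (-stdNormalQuantile (1 - α / 2)) (stdNormalQuantile (1 - α / 2))) = 1 - α := by
  have : NullSingletonClass (gaussianReal 0 1) := nullSingletonClass_gaussianReal one_ne_zero
  obtain ⟨h0, h1⟩ := hα
  set z := stdNormalQuantile (1 - α / 2) with hz
  have hcdf : cdf (gaussianReal 0 1) z = 1 - α / 2 :=
    cdf_stdNormalQuantile ⟨by linarith, by linarith⟩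
  have hneg := cdf_stdNormal_neg z
  -- If `z ≤ 0`, monotonicity gives `1 - α / 2 = Φ z ≤ Φ (-z) = α / 2`, against `α < 1`.
  have hzpos : 0 < z := by
    by_contra h
    have h2 := monotone_cdf (gaussianReal 0 1) (show z ≤ -z by linarith)
    linarith
  refine ⟨hzpos, ?_⟩
  have h3 : (gaussianReal 0 1).real (Set.Ioo (-z) z) = (gaussianReal 0 1).real (Set.Ioc (-z) z) :=
    measureReal_congr Ioo_ae_eq_Ioc
  rw [h3, ← Set.Iic_sdiff_Iic, measureReal_sdiff (Set.Iic_subset_Iic.2 (by linarith))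
    measurableSet_Iic, ← cdf_eq_real, ← cdf_eq_real, hneg, hcdf]
  ring

variable {Ω : Type*} [MeasurableSpace Ω] {μ : Measure Ω} [IsProbabilityMeasure μ]

/-- Studentized asymptotic normality gives the coverage probability of the Wald interval. -/
theorem tendsto_measure_studentized_lt {G E V : ℕ → Ω → ℝ} {v : ℝ} (hv : 0 < v)
    (hG : TendstoInDistribution G atTop id (fun _ => μ) (gaussianReal 0 v.toNNReal))
    (hE : IsLittleOP μ E) (hEm : ∀ N, AEMeasurable (E N) μ)
    (hV : TendstoInMeasure μ V atTop fun _ => v) (hVm : ∀ N, AEMeasurable (V N) μ)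
    {α : ℝ} (hα : α ∈ Set.Ioo (0 : ℝ) 1) :
    Tendsto (fun N => μ.real {ω | |G N ω + E N ω| < stdNormalQuantile (1 - α / 2) * √(V N ω)})
      atTop (𝓝 (1 - α)) := by
  obtain ⟨hz, hprob⟩ := stdNormal_Ioo_quantile hα
  set z := stdNormalQuantile (1 - α / 2) with hzdef
  have hE0 : TendstoInMeasure μ E atTop fun _ => (0 : ℝ) :=
    IsLittleOP.tendstoInMeasure (by simpa using hE)
  -- Slutsky twice: the error `E` is absorbed first, then the pair with `V` is mapped continuously
  -- to `|x| - z √v`, whose sign decides coverage.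
  have hsum := hG.add_of_tendstoInMeasure_const hE0 hEm
  have hcomp := hsum.continuous_comp_prodMk_of_tendstoInMeasure_const
    (g := fun p : ℝ × ℝ => |p.1| - z * √p.2) (by fun_prop) hV hVm
  have hsv : 0 < √v := Real.sqrt_pos.2 hv
  have hvn : v.toNNReal ≠ 0 := by simpa using hv
  have : NullSingletonClass (gaussianReal 0 v.toNNReal) := nullSingletonClass_gaussianReal hvn
  -- Portmanteau on the half-line `Iio 0`. The preimage of its boundary lies in `{z√v, -z√v}`, which
  -- is null because `v > 0` excludes a degenerate limit.
  have hport := ProbabilityMeasure.tendsto_measure_of_null_frontier_of_tendsto' hcomp.tendsto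
    (E := Set.Iio 0) (by
      rw [frontier_Iio]
      simp only [ProbabilityMeasure.coe_mk]
      rw [Measure.map_apply_of_aemeasurable hcomp.aemeasurable_limit (measurableSet_singleton 0)]
      refine measure_mono_null (t := {z * √v, -(z * √v)}) ?_ ?_
      · intro x hx
        simp only [id_eq, add_zero, Set.mem_preimage, Set.mem_singleton_iff, sub_eq_zero] at hx
        rcases abs_eq (by positivity) |>.1 hx with h | h <;> simp [h]
      · exact (Set.toFinite _).measure_zero _)
  simp only [ProbabilityMeasure.coe_mk] at hport
  rw [Measure.map_apply_of_aemeasurable hcomp.aemeasurable_limit measurableSet_Iio] at hport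
  have hlim : (gaussianReal 0 v.toNNReal)
      ((fun ω => |id ω + 0| - z * √v) ⁻¹' Set.Iio 0) = ENNReal.ofReal (1 - α) := by
    have hmap : gaussianReal 0 v.toNNReal = (gaussianReal 0 1).map (fun x => √v * x) := by
      rw [gaussianReal_map_const_mul]
      congr 1
      · simp
      · ext; simp [Real.sq_sqrt hv.le, hv.le]
    rw [hmap, Measure.map_apply (by fun_prop)
      ((measurable_id.add_const 0).abs.sub_const _ measurableSet_Iio), ← hprob,
      ofReal_measureReal]
    congr 1
    ext x
    simp only [Set.mem_preimage, id_eq, add_zero, Set.mem_Iio, sub_neg, Set.mem_Ioo, ← abs_lt,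
      abs_mul, abs_of_pos hsv]
    rw [mul_comm, mul_lt_mul_iff_left₀ hsv]
  rw [hlim] at hport
  have hreal := (ENNReal.tendsto_toReal ENNReal.ofReal_ne_top).comp hport
  rw [ENNReal.toReal_ofReal (by linarith [hα.2])] at hreal
  refine hreal.congr fun N => ?_
  simp only [Function.comp]
  rw [Measure.map_apply_of_aemeasurable (hcomp.forall_aemeasurable N) measurableSet_Iio]
  congr 2
  ext ω
  simp [sub_neg]

end Coverage

end

end SurrogateATE

namespace SurrogateATE

noncomputable section

/-! ### Separating training from evaluation coordinates under a product law. -/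

section ProductMeasure

variable {ι α : Type*} [Fintype ι] [DecidableEq ι] [MeasurableSpace α]

omit [Fintype ι] in
theorem measurable_piecewise (J : Finset ι) :
    Measurable fun p : (ι → α) × (ι → α) => J.piecewise p.2 p.1 := by
  refine measurable_pi_lambda _ fun i => ?_
  by_cases hi : i ∈ J
  · simpa [Finset.piecewise, hi, Function.comp_def] using
      (measurable_pi_apply (X := fun _ => α) i).comp (measurable_snd (α := ι → α))
  · simpa [Finset.piecewise, hi, Function.comp_def] using
      (measurable_pi_apply (X := fun _ => α) i).comp (measurable_fst (β := ι → α))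

/-- Replacing the coordinates in `J` by those of an independent copy preserves a product law. -/
theorem measurePreserving_piecewise (Q : ι → Measure α) [∀ i, IsProbabilityMeasure (Q i)]
    (J : Finset ι) :
    MeasurePreserving (fun p : (ι → α) × (ι → α) => J.piecewise p.2 p.1)
      ((Measure.pi Q).prod (Measure.pi Q)) (Measure.pi Q) := by
  refine ⟨measurable_piecewise J, ?_⟩
  symm
  refine Measure.pi_eq fun s hs => ?_
  rw [Measure.map_apply (measurable_piecewise J) (MeasurableSet.univ_pi hs)]
  have hpre : (fun p : (ι → α) × (ι → α) => J.piecewise p.2 p.1) ⁻¹' Set.univ.pi s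
      = (Set.univ.pi fun i => if i ∈ J then Set.univ else s i) ×ˢ
        (Set.univ.pi fun i => if i ∈ J then s i else Set.univ) := by
    ext p
    simp only [Set.mem_preimage, Set.mem_univ_pi, Set.mem_prod, Finset.piecewise,
      ← forall_and]
    refine forall_congr' fun i => ?_
    by_cases hi : i ∈ J <;> simp [hi]
  rw [hpre, Measure.prod_prod, Measure.pi_pi, Measure.pi_pi, ← Finset.prod_mul_distrib]
  refine Finset.prod_congr rfl fun i _ => ?_
  by_cases hi : i ∈ J <;> simp [hi]

/-- A bound that holds for independent evaluation data and arbitrary fixed training data holds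
when both parts come from the same product law. -/
theorem lintegral_pi_le_of_train (Q : ι → Measure α) [∀ i, IsProbabilityMeasure (Q i)]
    (J : Finset ι) (G : ((Jᶜ : Finset ι) → α) → (ι → α) → ℝ≥0∞)
    (hG : Measurable fun p : ((Jᶜ : Finset ι) → α) × (ι → α) => G p.1 p.2)
    (hJ : ∀ w x y, (∀ i ∈ J, x i = y i) → G w x = G w y) {B : ℝ≥0∞}
    (hB : ∀ w, ∫⁻ y, G w y ∂Measure.pi Q ≤ B) :
    ∫⁻ x, G (fun i => x i) x ∂Measure.pi Q ≤ B := by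
  have hres : Measurable fun x : ι → α => (fun i : (Jᶜ : Finset ι) => x i) :=
    measurable_pi_lambda _ fun i => measurable_pi_apply _
  have hm : Measurable fun x : ι → α => G (fun i => x i) x := hG.comp (hres.prodMk measurable_id)
  -- The evaluation coordinates are replaced by those of an independent copy `y`. Training data then
  -- depend on `x` alone, and the inner integral over `y` is one with frozen training data.
  rw [← (measurePreserving_piecewise Q J).lintegral_comp hm]
  refine (lintegral_prod _ (hm.comp (measurable_piecewise J)).aemeasurable).trans_le ?_
  calc ∫⁻ x, ∫⁻ y, G (fun i => J.piecewise y x i) (J.piecewise y x) ∂Measure.pi Q ∂Measure.pi Q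
      = ∫⁻ x, ∫⁻ y, G (fun i : (Jᶜ : Finset ι) => x i) y ∂Measure.pi Q ∂Measure.pi Q := by
        refine lintegral_congr fun x => lintegral_congr fun y => ?_
        have h1 : (fun i : (Jᶜ : Finset ι) => J.piecewise y x i) =
            fun i : (Jᶜ : Finset ι) => x i := by
          ext i
          exact Finset.piecewise_eq_of_notMem _ _ _ (Finset.mem_compl.1 i.2)
        rw [h1]
        exact hJ _ _ _ fun i hi => Finset.piecewise_eq_of_mem _ _ _ hi
    _ ≤ ∫⁻ _, B ∂Measure.pi Q := lintegral_mono fun x => hB _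
    _ = B := by simp

omit [DecidableEq ι] in
/-- The second moment of a sum of centered independent terms. -/
theorem lintegral_sq_sum_sub_integral_le (Q : ι → Measure α) [∀ i, IsProbabilityMeasure (Q i)]
    (J : Finset ι) (h : ι → α → ℝ) (hh : ∀ i, Measurable (h i)) {B : ℝ≥0∞} (hB : B ≠ ∞)
    (hle : ∀ i, ∫⁻ a, ENNReal.ofReal (h i a ^ 2) ∂Q i ≤ B) :
    ∫⁻ x, ENNReal.ofReal ((∑ i ∈ J, (h i (x i) - ∫ a, h i a ∂Q i)) ^ 2) ∂Measure.pi Q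
      ≤ J.card * B := by
  have hL : ∀ i, MemLp (h i) 2 (Q i) := by
    intro i
    rw [memLp_two_iff_integrable_sq (hh i).aestronglyMeasurable]
    refine ⟨((hh i).pow_const 2).aestronglyMeasurable, ?_⟩
    rw [hasFiniteIntegral_iff_ofReal (ae_of_all _ fun a => sq_nonneg _)]
    exact (hle i).trans_lt hB.lt_top
  have hmp : ∀ i, MeasurePreserving (fun x : ι → α => x i) (Measure.pi Q) (Q i) :=
    fun i => measurePreserving_eval Q i
  have hL' : ∀ i, MemLp (fun x : ι → α => h i (x i)) 2 (Measure.pi Q) :=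
    fun i => (hL i).comp_measurePreserving (hmp i)
  have hint : ∀ i, ∫ x, h i (x i) ∂Measure.pi Q = ∫ a, h i a ∂Q i := fun i => by
    rw [← (hmp i).map_eq, integral_map (hmp i).aemeasurable]
    exact (hh i).aestronglyMeasurable
  have hindep : iIndepFun (fun i (x : ι → α) => h i (x i)) (Measure.pi Q) :=
    iIndepFun_pi fun i => (hh i).aemeasurable
  have hsum : MemLp (∑ i ∈ J, fun x : ι → α => h i (x i)) 2 (Measure.pi Q) :=
    memLp_finsetSum' J fun i _ => hL' i
  -- Independence makes variances additive; this is what yields a bound linear in `J.card`.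
  have hvar : Var[∑ i ∈ J, fun x : ι → α => h i (x i); Measure.pi Q]
      = ∑ i ∈ J, Var[fun x : ι → α => h i (x i); Measure.pi Q] :=
    IndepFun.variance_sum (fun i _ => hL' i) fun i _ j _ hij => hindep.indepFun hij
  have hmean : ∫ x, (∑ i ∈ J, fun x : ι → α => h i (x i)) x ∂Measure.pi Q
      = ∑ i ∈ J, ∫ a, h i a ∂Q i := by
    simp only [Finset.sum_apply]
    rw [integral_finsetSum _ fun i _ => (hL' i).integrable one_le_two]
    exact Finset.sum_congr rfl fun i _ => hint i
  have hvi : ∀ i, ENNReal.ofReal (Var[fun x : ι → α => h i (x i); Measure.pi Q]) ≤ B := by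
    intro i
    refine (ENNReal.ofReal_le_ofReal (variance_le_expectation_sq
      ((hh i).comp (measurable_pi_apply i)).aestronglyMeasurable)).trans ?_
    refine le_trans (le_of_eq ?_) (hle i)
    rw [ofReal_integral_eq_lintegral_ofReal]
    · rw [← (hmp i).lintegral_comp ((hh i).pow_const 2).ennreal_ofReal]
      rfl
    · exact (hL' i).integrable_sq
    · exact ae_of_all _ fun x => sq_nonneg _
  calc ∫⁻ x, ENNReal.ofReal ((∑ i ∈ J, (h i (x i) - ∫ a, h i a ∂Q i)) ^ 2) ∂Measure.pi Q
      = evariance (∑ i ∈ J, fun x : ι → α => h i (x i)) (Measure.pi Q) := by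
        rw [evariance, hmean]
        refine lintegral_congr fun x => ?_
        rw [Finset.sum_apply, ← Finset.sum_sub_distrib, ← ofReal_norm,
          ← ENNReal.ofReal_pow (norm_nonneg _), Real.norm_eq_abs, sq_abs]
    _ = ENNReal.ofReal (Var[∑ i ∈ J, fun x : ι → α => h i (x i); Measure.pi Q]) :=
        hsum.ofReal_variance_eq.symm
    _ = ∑ i ∈ J, ENNReal.ofReal (Var[fun x : ι → α => h i (x i); Measure.pi Q]) := by
        rw [hvar, ENNReal.ofReal_sum_of_nonneg fun i _ => variance_nonneg _ _]
    _ ≤ ∑ i ∈ J, B := Finset.sum_le_sum fun i _ => hvi i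
    _ = J.card * B := by simp

end ProductMeasure

/-! ### Conditioning an i.i.d. sample on all its labels. -/

section Labels

/-- A version of the conditional law of `P` given a binary label that is always a probability
measure. -/
def labelLaw {α : Type*} [MeasurableSpace α] (P : Measure α) (lab : α → Bool) (b : Bool) :
    Measure α :=
  if P {a | lab a = b} = 0 then P else P[|{a | lab a = b}]

variable {α : Type*} [MeasurableSpace α] (P : Measure α) [IsProbabilityMeasure P]
  (lab : α → Bool)

instance isProbabilityMeasure_labelLaw (b : Bool) : IsProbabilityMeasure (labelLaw P lab b) := by
  unfold labelLaw
  split_ifs with h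
  · infer_instance
  · exact cond_isProbabilityMeasure h

variable {P lab}

theorem restrict_label_eq (b : Bool) :
    P.restrict {a | lab a = b} = P {a | lab a = b} • labelLaw P lab b := by
  unfold labelLaw
  split_ifs with h
  · simp [h]
  · rw [ProbabilityTheory.cond, smul_smul, ENNReal.mul_inv_cancel h (measure_ne_top _ _), one_smul]

/-- The density of a label law is at most `1 / P(lab = b)`, or `1` for a null label. Second moment
bounds under `P` thus pass to both label laws with one constant. -/
theorem exists_labelLaw_le (P : Measure α) [IsProbabilityMeasure P] (lab : α → Bool) :
    ∃ M : ℝ≥0∞, M ≠ ∞ ∧ ∀ b, labelLaw P lab b ≤ M • P := by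
  have h : ∀ b, ∃ M : ℝ≥0∞, M ≠ ∞ ∧ labelLaw P lab b ≤ M • P := by
    intro b
    unfold labelLaw
    split_ifs with h
    · exact ⟨1, ENNReal.one_ne_top, by simp⟩
    · refine ⟨(P {a | lab a = b})⁻¹, ENNReal.inv_ne_top.2 h, ?_⟩
      rw [ProbabilityTheory.cond]
      gcongr
      exact Measure.restrict_le_self
  choose M hM hle using h
  refine ⟨M true + M false, by simp [hM], fun b => (hle b).trans ?_⟩
  refine Measure.le_iff.2 fun s _ => ?_
  simp only [Measure.smul_apply, smul_eq_mul]
  gcongr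
  cases b <;> simp

/-- Expectations under a product law, stratified by the labels of all coordinates. -/
theorem lintegral_pi_le_of_labels {ι : Type*} [Fintype ι] [DecidableEq ι] (hlab : Measurable lab)
    (G : (ι → Bool) → (ι → α) → ℝ≥0∞) {B : ℝ≥0∞}
    (hB : ∀ r, ∫⁻ x, G r x ∂Measure.pi (fun i => labelLaw P lab (r i)) ≤ B) :
    ∫⁻ x, G (fun i => lab (x i)) x ∂Measure.pi (fun _ : ι => P) ≤ B := by
  set c : Bool → ℝ≥0∞ := fun b => P {a | lab a = b} with hc
  have hms : ∀ b, MeasurableSet {a | lab a = b} := fun b => hlab (measurableSet_singleton b)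
  let A : (ι → Bool) → Set (ι → α) := fun r => Set.univ.pi fun i => {a | lab a = r i}
  have hA : ∀ r, MeasurableSet (A r) := fun r => MeasurableSet.univ_pi fun i => hms _
  have hmem : ∀ r x, x ∈ A r ↔ (fun i => lab (x i)) = r := fun r x => by
    simp [A, funext_iff]
  -- On the box where the label vector equals `r`, the sample is a product of label laws, weighted
  -- by the probability of `r`. A null label gives weight zero, so the convention in `labelLaw` is
  -- harmless.
  have hrestr : ∀ r, (Measure.pi fun _ : ι => P).restrict (A r)
      = (∏ i, c (r i)) • Measure.pi (fun i => labelLaw P lab (r i)) := by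
    intro r
    rw [Measure.restrict_pi_pi]
    refine Measure.pi_eq fun s hs => ?_
    rw [Measure.smul_apply, Measure.pi_pi, smul_eq_mul, ← Finset.prod_mul_distrib]
    refine Finset.prod_congr rfl fun i _ => ?_
    rw [restrict_label_eq, Measure.smul_apply, smul_eq_mul]
  have hcover : ⋃ r, A r = Set.univ := by
    refine Set.eq_univ_of_forall fun x => Set.mem_iUnion.2 ⟨_, (hmem _ x).2 rfl⟩
  have hdisj : Pairwise (Function.onFun Disjoint A) := by
    intro r r' hrr'
    refine Set.disjoint_left.2 fun x hx hx' => hrr' ?_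
    rw [← (hmem r x).1 hx, (hmem r' x).1 hx']
  have hsum : ∀ f : (ι → Bool) → (ι → α) → ℝ≥0∞,
      ∫⁻ x, f (fun i => lab (x i)) x ∂Measure.pi (fun _ : ι => P)
      = ∑ r, (∏ i, c (r i)) * ∫⁻ x, f r x ∂Measure.pi (fun i => labelLaw P lab (r i)) := by
    intro f
    rw [← setLIntegral_univ, ← hcover, lintegral_iUnion hA hdisj, tsum_fintype]
    refine Finset.sum_congr rfl fun r _ => ?_
    rw [setLIntegral_congr_fun (hA r) (g := f r) fun x hx => by simp only [(hmem r x).1 hx],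
      hrestr, lintegral_smul_measure, smul_eq_mul]
  -- The decomposition applied to the constant `1` shows that the weights form a probability vector.
  have hone : ∑ r : ι → Bool, ∏ i, c (r i) = 1 := by
    have := hsum fun _ _ => 1
    simpa using this.symm
  rw [hsum]
  calc ∑ r, (∏ i, c (r i)) * ∫⁻ x, G r x ∂Measure.pi (fun i => labelLaw P lab (r i))
      ≤ ∑ r : ι → Bool, (∏ i, c (r i)) * B := by gcongr with r; exact hB r
    _ = B := by rw [← Finset.sum_mul, hone, one_mul]

end Labels

/-! ### Moments of cross-fitted sums given labels, folds and training data. -/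

section DrawnSample

variable {dx ds K : ℕ} {Ω 𝒰 : Type*} [MeasurableSpace Ω] [MeasurableSpace 𝒰] {μ : Measure Ω}
  [IsProbabilityMeasure μ] {P : Measure (Full dx ds)} [IsProbabilityMeasure P]
  {D : ℕ → Ω → Full dx ds} {F : FoldRule K 𝒰} {U : ℕ → Ω → 𝒰}

omit [IsProbabilityMeasure P] in
theorem Design.map_units (h : Design μ P D F U) (N : ℕ) :
    μ.map (fun ω (i : Fin N) => D i ω) = Measure.pi fun _ : Fin N => P := by
  have hi : iIndepFun (fun (i : Fin N) => D i) μ := h.indep.precomp Fin.val_injective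
  rw [(iIndepFun_iff_map_fun_eq_pi_map fun i => (h.measurable_unit _).aemeasurable).1 hi]
  congr 1
  ext1 i
  exact h.law i

omit [IsProbabilityMeasure P] in
theorem Design.map_seed_units (h : Design μ P D F U) (N : ℕ) :
    μ.map (fun ω => (U N ω, fun i : Fin N => D i ω))
      = (μ.map (U N)).prod (Measure.pi fun _ : Fin N => P) := by
  have hres : Measurable fun (x : ℕ → Full dx ds) (i : Fin N) => x i :=
    measurable_pi_lambda _ fun i => measurable_pi_apply _
  have hi : IndepFun (U N) (fun ω (i : Fin N) => D i ω) μ :=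
    (h.indep_seed N).comp measurable_id hres
  rw [← h.map_units N]
  exact (indepFun_iff_map_prod_eq_prod_map_map (h.measurable_seed N).aemeasurable
    (measurable_pi_lambda _ fun i => h.measurable_unit _).aemeasurable).1 hi

/-- There are finitely many label vectors, so measurability in the seed for each fixed vector
suffices. -/
theorem measurable_foldRule (hF : ∀ N b, Measurable (F N b)) (N : ℕ) :
    Measurable fun p : 𝒰 × (Fin N → Full dx ds) => F N (fun i => R (p.2 i)) p.1 := by
  have h1 : Measurable fun p : (Fin N → Bool) × 𝒰 => F N p.1 p.2 :=
    measurable_from_prod_countable_right fun r => hF N r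
  refine h1.comp (f := fun p : 𝒰 × (Fin N → Full dx ds) => (fun i => R (p.2 i), p.1)) ?_
  refine Measurable.prodMk (measurable_pi_lambda _ fun i => ?_) measurable_fst
  exact measurable_R.comp ((measurable_pi_apply i).comp measurable_snd)

/-- A function of the labels, the folds and the units of a sample that is measurable in the
units is jointly measurable in the seed and the units. -/
theorem measurable_of_labels_folds {E : Type*} [MeasurableSpace E]
    (hF : ∀ N b, Measurable (F N b)) (N : ℕ)
    {G : (Fin N → Bool) → (Fin N → Fin K) → (Fin N → Full dx ds) → E}
    (hG : ∀ r a, Measurable (G r a)) :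
    Measurable fun p : 𝒰 × (Fin N → Full dx ds) =>
      G (fun i => R (p.2 i)) (F N (fun i => R (p.2 i)) p.1) p.2 := by
  have h1 : Measurable fun p : ((Fin N → Bool) × (Fin N → Fin K)) × (Fin N → Full dx ds) =>
      G p.1.1 p.1.2 p.2 := measurable_from_prod_countable_right fun q => hG q.1 q.2
  refine h1.comp (f := fun p : 𝒰 × (Fin N → Full dx ds) =>
    (((fun i => R (p.2 i)), F N (fun i => R (p.2 i)) p.1), p.2)) ?_
  refine Measurable.prodMk (Measurable.prodMk (measurable_pi_lambda _ fun i => ?_)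
    (measurable_foldRule hF N)) measurable_snd
  exact measurable_R.comp ((measurable_pi_apply i).comp measurable_snd)

omit [IsProbabilityMeasure μ] [IsProbabilityMeasure P] in
/-- A statistic of the sample that is measurable in the units for all fixed folds is a random
variable. -/
theorem Design.measurable_statistic (h : Design μ P D F U) {E : Type*} [MeasurableSpace E] (N : ℕ)
    {G : Sample dx ds K N → E} (hG : ∀ a, Measurable fun x => G ⟨x, a⟩) :
    Measurable fun ω => G (drawSample F (fun i => D i ω) (U N ω) N) :=
  (measurable_of_labels_folds h.measurable_rule N (G := fun _ a x => G ⟨x, a⟩)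
    fun _ a => hG a).comp
    ((h.measurable_seed N).prodMk (measurable_pi_lambda _ fun i => h.measurable_unit i))

/-- A bound for the expectation of a statistic that holds conditionally on all labels and all
folds. -/
theorem Design.lintegral_le (h : Design μ P D F U) (N : ℕ)
    (G : (Fin N → Bool) → Sample dx ds K N → ℝ≥0∞) (hG : ∀ r a, Measurable fun x => G r ⟨x, a⟩)
    {B : ℝ≥0∞}
    (hB : ∀ r a, ∫⁻ x, G r ⟨x, a⟩ ∂Measure.pi (fun i => labelLaw P R (r i)) ≤ B) :
    ∫⁻ ω, G (fun i => R (D i ω)) (drawSample F (fun i => D i ω) (U N ω) N) ∂μ ≤ B := by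
  have hm := measurable_of_labels_folds h.measurable_rule N (G := fun r a x => G r ⟨x, a⟩) hG
  have hpair : Measurable fun ω => (U N ω, fun i : Fin N => D i ω) :=
    (h.measurable_seed N).prodMk (measurable_pi_lambda _ fun i => h.measurable_unit i)
  have : IsProbabilityMeasure (μ.map (U N)) :=
    Measure.isProbabilityMeasure_map (h.measurable_seed N).aemeasurable
  calc ∫⁻ ω, G (fun i => R (D i ω)) (drawSample F (fun i => D i ω) (U N ω) N) ∂μ
      = ∫⁻ p, G (fun i => R (p.2 i)) ⟨p.2, F N (fun i => R (p.2 i)) p.1⟩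
          ∂(μ.map fun ω => (U N ω, fun i : Fin N => D i ω)) := (lintegral_map hm hpair).symm
    _ = ∫⁻ u, ∫⁻ x, G (fun i => R (x i)) ⟨x, F N (fun i => R (x i)) u⟩
          ∂(Measure.pi fun _ : Fin N => P) ∂(μ.map (U N)) := by
        rw [h.map_seed_units, lintegral_prod _ hm.aemeasurable]
    -- With the seed frozen, the labels determine the folds; conditioning on the labels therefore
    -- leaves a product law with deterministic folds.
    _ ≤ ∫⁻ _, B ∂(μ.map (U N)) := lintegral_mono fun u =>
        lintegral_pi_le_of_labels measurable_R (fun r x => G r ⟨x, F N r u⟩)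
          fun r => hB r _
    _ = B := by simp

/-- The training data of the `k`-th fold. -/
def Sample.train {N : ℕ} (s : Sample dx ds K N) (k : Fin K) :
    ((s.foldSet k)ᶜ : Finset (Fin N)) → Obs dx ds := fun i => observe (s.unit i)

theorem measurable_S : Measurable (S : Full dx ds → _) := by
  have h1 : Measurable fun p : Bool × Full dx ds => Spot p.1 p.2 :=
    measurable_from_prod_countable_right fun t => measurable_Spot t
  exact h1.comp (measurable_T.prodMk measurable_id)

theorem measurable_Y : Measurable (Y : Full dx ds → _) := by
  have h1 : Measurable fun p : Bool × Full dx ds => Ypot p.1 p.2 :=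
    measurable_from_prod_countable_right fun t => measurable_Ypot t
  exact h1.comp (measurable_T.prodMk measurable_id)

theorem measurable_observe : Measurable (observe : Full dx ds → Obs dx ds) :=
  measurable_X.prodMk (measurable_T.prodMk (measurable_S.prodMk
    ((Measurable.ite (measurable_R (measurableSet_singleton true)) measurable_Y
      measurable_const).prodMk measurable_R)))

theorem measurable_observe_restrict {N : ℕ} (J : Finset (Fin N)) :
    Measurable fun (x : Fin N → Full dx ds) (i : J) => observe (x i) :=
  measurable_pi_lambda _ fun _ => measurable_observe.comp (measurable_pi_apply _)

theorem measurable_observe_pi {N : ℕ} (J : Finset (Fin N)) :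
    Measurable fun (w : J → Full dx ds) (i : J) => observe (w i) :=
  measurable_pi_lambda _ fun _ => measurable_observe.comp (measurable_pi_apply _)

/-- Cross-fitted sums, centered given the labels, the folds and the training data. -/
theorem Design.lintegral_sq_foldSum_le (h : Design μ P D F U) (N : ℕ) (k : Fin K)
    (g : (J : Finset (Fin N)) → (J → Obs dx ds) → Full dx ds → ℝ)
    (hg : ∀ J : Finset (Fin N), Measurable fun p : (J → Obs dx ds) × Full dx ds => g J p.1 p.2)
    {B : ℝ≥0∞} (hBtop : B ≠ ∞)
    (hB : ∀ J w b, ∫⁻ d, ENNReal.ofReal (g J w d ^ 2) ∂labelLaw P R b ≤ B) :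
    ∫⁻ ω, ENNReal.ofReal ((∑ i ∈ (drawSample F (fun i => D i ω) (U N ω) N).foldSet k,
      (g _ ((drawSample F (fun i => D i ω) (U N ω) N).train k) (D i ω)
        - ∫ d, g _ ((drawSample F (fun i => D i ω) (U N ω) N).train k) d
          ∂labelLaw P R (R (D i ω)))) ^ 2) ∂μ ≤ N * B := by
  have hint : ∀ (J : Finset (Fin N)) b, Measurable fun w => ∫ d, g J w d ∂labelLaw P R b :=
    fun J b => ((hg J).stronglyMeasurable.integral_prod_right').measurable
  refine h.lintegral_le N (fun r s => ENNReal.ofReal ((∑ i ∈ s.foldSet k,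
      (g _ (s.train k) (s.unit i) - ∫ d, g _ (s.train k) d ∂labelLaw P R (r i))) ^ 2))
    (fun r a => ?_) (fun r a => ?_)
  -- The fold is determined by `a` and no longer depends on the units.
  · set J : Finset (Fin N) := Finset.univ.filter fun i => a i = k with hJ
    change Measurable fun x : Fin N → Full dx ds => ENNReal.ofReal ((∑ i ∈ J,
      (g Jᶜ (fun i => observe (x i)) (x i)
        - ∫ d, g Jᶜ (fun i => observe (x i)) d ∂labelLaw P R (r i))) ^ 2)
    refine ((Finset.measurable_fun_sum _ fun i _ => ?_).pow_const 2).ennreal_ofReal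
    exact ((hg _).comp ((measurable_observe_restrict _).prodMk (measurable_pi_apply i))).sub
      ((hint _ _).comp (measurable_observe_restrict _))
  · set J : Finset (Fin N) := Finset.univ.filter fun i => a i = k with hJ
    -- Freezing the records outside `J` leaves a sum of independent centered terms, to which the
    -- variance bound applies.
    refine lintegral_pi_le_of_train (fun i => labelLaw P R (r i)) J
      (fun w y => ENNReal.ofReal ((∑ i ∈ J, (g Jᶜ (fun i => observe (w i)) (y i)
        - ∫ d, g Jᶜ (fun i => observe (w i)) d ∂labelLaw P R (r i))) ^ 2)) ?_ ?_ ?_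
    · refine ((Finset.measurable_fun_sum _ fun i _ => ?_).pow_const 2).ennreal_ofReal
      exact ((hg Jᶜ).comp (((measurable_observe_pi Jᶜ).comp measurable_fst).prodMk
        ((measurable_pi_apply i).comp measurable_snd))).sub
        ((hint Jᶜ (r i)).comp ((measurable_observe_pi Jᶜ).comp measurable_fst))
    · intro w x y hxy
      rw [Finset.sum_congr rfl fun i hi => by rw [hxy i hi]]
    · intro w
      refine (lintegral_sq_sum_sub_integral_le (fun i => labelLaw P R (r i)) J
        (fun i d => g Jᶜ (fun i => observe (w i)) d)
        (fun i => (hg Jᶜ).comp (measurable_const.prodMk measurable_id)) hBtop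
        fun i => hB _ _ _).trans ?_
      gcongr
      simpa using Finset.card_le_univ J

/-- First moments of cross-fitted sums. -/
theorem Design.lintegral_foldSum_le (h : Design μ P D F U) (N : ℕ) (k : Fin K)
    (g : (J : Finset (Fin N)) → (J → Obs dx ds) → Full dx ds → ℝ≥0∞)
    (hg : ∀ J : Finset (Fin N), Measurable fun p : (J → Obs dx ds) × Full dx ds => g J p.1 p.2)
    {B : ℝ≥0∞} (hB : ∀ J w b, ∫⁻ d, g J w d ∂labelLaw P R b ≤ B) :
    ∫⁻ ω, ∑ i ∈ (drawSample F (fun i => D i ω) (U N ω) N).foldSet k,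
      g _ ((drawSample F (fun i => D i ω) (U N ω) N).train k) (D i ω) ∂μ ≤ N * B := by
  refine h.lintegral_le N (fun _ s => ∑ i ∈ s.foldSet k, g _ (s.train k) (s.unit i))
    (fun r a => ?_) (fun r a => ?_)
  · set J : Finset (Fin N) := Finset.univ.filter fun i => a i = k with hJ
    change Measurable fun x : Fin N → Full dx ds =>
      ∑ i ∈ J, g Jᶜ (fun i => observe (x i)) (x i)
    exact Finset.measurable_fun_sum _ fun i _ =>
      (hg _).comp ((measurable_observe_restrict _).prodMk (measurable_pi_apply i))
  · set J : Finset (Fin N) := Finset.univ.filter fun i => a i = k with hJ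
    refine lintegral_pi_le_of_train (fun i => labelLaw P R (r i)) J
      (fun w y => ∑ i ∈ J, g Jᶜ (fun i => observe (w i)) (y i)) ?_ ?_ ?_
    · exact Finset.measurable_fun_sum _ fun i _ => (hg Jᶜ).comp
        (((measurable_observe_pi Jᶜ).comp measurable_fst).prodMk
          ((measurable_pi_apply i).comp measurable_snd))
    · intro w x y hxy
      exact Finset.sum_congr rfl fun i hi => by rw [hxy i hi]
    · intro w
      have hgw : Measurable fun d => g Jᶜ (fun i => observe (w i)) d :=
        (hg Jᶜ).comp (measurable_const.prodMk measurable_id)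
      calc ∫⁻ y, ∑ i ∈ J, g Jᶜ (fun i => observe (w i)) (y i)
            ∂Measure.pi (fun i => labelLaw P R (r i))
          = ∑ i ∈ J, ∫⁻ y, g Jᶜ (fun i => observe (w i)) (y i)
            ∂Measure.pi (fun i => labelLaw P R (r i)) :=
            lintegral_finsetSum _ fun i _ => hgw.comp (measurable_pi_apply i)
        _ = ∑ i ∈ J, ∫⁻ d, g Jᶜ (fun i => observe (w i)) d ∂labelLaw P R (r i) :=
            Finset.sum_congr rfl fun i _ =>
              (measurePreserving_eval (fun i => labelLaw P R (r i)) i).lintegral_comp hgw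
        _ ≤ ∑ i ∈ J, B := Finset.sum_le_sum fun i _ => hB _ _ _
        _ ≤ N * B := by
          rw [Finset.sum_const, nsmul_eq_mul]
          gcongr
          simpa using Finset.card_le_univ J

end DrawnSample

end

end SurrogateATE

namespace SurrogateATE

noncomputable section

/-! ### Conditional laws as densities and conditional means. -/

section Cond

variable {α : Type*} [MeasurableSpace α] {Q : Measure α}

theorem integral_cond_eq (A : Set α) (f : α → ℝ) :
    ∫ a, f a ∂Q[|A] = (Q A)⁻¹.toReal • ∫ a in A, f a ∂Q := by
  rw [ProbabilityTheory.cond, integral_smul_measure]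

theorem lintegral_cond_eq (A : Set α) (f : α → ℝ≥0∞) :
    ∫⁻ a, f a ∂Q[|A] = (Q A)⁻¹ * ∫⁻ a in A, f a ∂Q := by
  rw [ProbabilityTheory.cond, lintegral_smul_measure, smul_eq_mul]

end Cond

section ConditionalLaws

variable {α β γ : Type*} [MeasurableSpace α] [MeasurableSpace β] [StandardBorelSpace β]
  [Nonempty β] [MeasurableSpace γ] {Q : Measure α} [IsFiniteMeasure Q] {B : α → β} {Z : α → γ}

/-- The conditional probability of `B ∈ s` given `Z` is the density of the law of `Z` on
`B ∈ s`. -/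
theorem map_restrict_preimage_eq_withDensity (hB : Measurable B) (hZ : Measurable Z) {s : Set β}
    (hs : MeasurableSet s) :
    (Q.restrict (B ⁻¹' s)).map Z = (Q.map Z).withDensity fun z => condDistrib B Z Q z s := by
  ext u hu
  rw [Measure.map_apply hZ hu, Measure.restrict_apply (hZ hu), withDensity_apply _ hu,
    setLIntegral_map hu (Kernel.measurable_coe _ hs) hZ,
    setLIntegral_preimage_condDistrib hZ hB.aemeasurable hs hu]

theorem setLIntegral_preimage_comp (hB : Measurable B) (hZ : Measurable Z) {s : Set β}
    (hs : MeasurableSet s) {g : γ → ℝ≥0∞} (hg : Measurable g) :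
    ∫⁻ a in B ⁻¹' s, g (Z a) ∂Q = ∫⁻ a, condDistrib B Z Q (Z a) s * g (Z a) ∂Q := by
  rw [← lintegral_map hg hZ, map_restrict_preimage_eq_withDensity hB hZ hs,
    lintegral_withDensity_eq_lintegral_mul _ (Kernel.measurable_coe _ hs) hg,
    lintegral_map ((Kernel.measurable_coe _ hs).mul hg) hZ]
  rfl

theorem setIntegral_preimage_comp (hB : Measurable B) (hZ : Measurable Z) {s : Set β}
    (hs : MeasurableSet s) {g : γ → ℝ} (hg : Measurable g) :
    ∫ a in B ⁻¹' s, g (Z a) ∂Q = ∫ a, (condDistrib B Z Q (Z a)).real s * g (Z a) ∂Q := by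
  rw [← integral_map hZ.aemeasurable hg.aestronglyMeasurable,
    map_restrict_preimage_eq_withDensity hB hZ hs,
    integral_withDensity_eq_integral_toReal_smul (Kernel.measurable_coe _ hs)
      (ae_of_all _ fun z => measure_lt_top _ _)]
  exact integral_map hZ.aemeasurable (((Kernel.measurable_coe (condDistrib B Z Q)
    hs).ennreal_toReal).mul hg).aestronglyMeasurable

/-- Under conditional independence the conditional law of `B` given `(Z, V)` may be replaced by
the one given `Z`. -/
theorem setIntegral_preimage_comp_of_condIndepFun [StandardBorelSpace α] {δ : Type*}
    [MeasurableSpace δ] [StandardBorelSpace δ] [Nonempty δ] {V : α → δ} (hB : Measurable B)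
    (hZ : Measurable Z) (hV : Measurable V)
    (h : CondIndepFun (MeasurableSpace.comap Z inferInstance) hZ.comap_le V B Q) {s : Set β}
    (hs : MeasurableSet s) {g : γ × δ → ℝ} (hg : Measurable g) :
    ∫ a in B ⁻¹' s, g (Z a, V a) ∂Q
      = ∫ a, (condDistrib B Z Q (Z a)).real s * g (Z a, V a) ∂Q := by
  rw [setIntegral_preimage_comp hB (hZ.prodMk hV) hs hg]
  -- Conditional independence in kernel form: the law of `B` given `(Z, V)` does not see `V`.
  have h1 := (condIndepFun_iff_condDistrib_prod_ae_eq_prodMkRight hB hV hZ).1 h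
  refine integral_congr_ae ?_
  filter_upwards [ae_of_ae_map (hZ.prodMk hV).aemeasurable h1] with a ha
  rw [ha]
  rfl

/-- The conditional mean of `V` given `Z`, integrated against functions of `Z`. -/
theorem integral_comp_mul_eq_integral_condDistrib {V : α → ℝ} (hZ : Measurable Z)
    (hV : Integrable V Q) {g : γ → ℝ} (hg : Measurable g)
    (hgV : Integrable (fun a => g (Z a) * V a) Q) :
    Integrable (fun a => g (Z a) * ∫ y, y ∂condDistrib V Z Q (Z a)) Q ∧
    ∫ a, g (Z a) * V a ∂Q = ∫ a, g (Z a) * ∫ y, y ∂condDistrib V Z Q (Z a) ∂Q := by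
  have hgm : StronglyMeasurable[MeasurableSpace.comap Z inferInstance] fun a => g (Z a) :=
    (hg.comp (comap_measurable Z)).stronglyMeasurable
  have h1 := condExp_mul_of_stronglyMeasurable_left hgm hgV hV
  have h2 := condExp_ae_eq_integral_condDistrib' hZ hV
  have h3 : Q[(fun a => g (Z a)) * V | MeasurableSpace.comap Z inferInstance]
      =ᵐ[Q] fun a => g (Z a) * ∫ y, y ∂condDistrib V Z Q (Z a) := by
    filter_upwards [h1, h2] with a h1 h2
    rw [h1, Pi.mul_apply, h2]
  refine ⟨integrable_condExp.congr h3, ?_⟩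
  rw [← integral_congr_ae h3, integral_condExp hZ.comap_le]
  rfl

/-- Conditional expectation is a contraction of `L²`. -/
theorem memLp_integral_condDistrib {V : α → ℝ} (hZ : Measurable Z) (hV : MemLp V 2 Q) :
    MemLp (fun a => ∫ y, y ∂condDistrib V Z Q (Z a)) 2 Q :=
  (hV.condExp (m := MeasurableSpace.comap Z inferInstance) one_le_two).ae_eq
    (condExp_ae_eq_integral_condDistrib' hZ (hV.integrable one_le_two))

theorem integral_restrict_eq_of_cond {A : Set α} {f g : α → ℝ}
    (h : ∫ a, f a ∂Q[|A] = ∫ a, g a ∂Q[|A]) : ∫ a in A, f a ∂Q = ∫ a in A, g a ∂Q := by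
  by_cases hA : Q A = 0
  · simp [Measure.restrict_eq_zero.2 hA]
  · rw [integral_cond_eq, integral_cond_eq] at h
    refine smul_right_injective ℝ ?_ h
    exact (ENNReal.toReal_pos (ENNReal.inv_ne_zero.2 (measure_ne_top _ _))
      (ENNReal.inv_ne_top.2 hA)).ne'

end ConditionalLaws

/-! ### Weighting identities for the true nuisance parameters. -/

section Identification

variable {dx ds : ℕ} {P : Measure (Full dx ds)}

/-- The event `T = t`. -/
def armSet (dx ds : ℕ) (t : Bool) : Set (Full dx ds) := {d | T d = t}

/-- The event `T = t, R = 1`. -/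
def labelledSet (dx ds : ℕ) (t : Bool) : Set (Full dx ds) := {d | T d = t ∧ R d = true}

theorem measurableSet_armSet (t : Bool) : MeasurableSet (armSet dx ds t) :=
  measurable_T (measurableSet_singleton t)

theorem labelledSet_eq (t : Bool) :
    labelledSet dx ds t = R ⁻¹' {true} ∩ armSet dx ds t := by
  ext d
  exact and_comm

theorem measurableSet_labelledSet (t : Bool) : MeasurableSet (labelledSet dx ds t) := by
  rw [labelledSet_eq]
  exact (measurable_R (measurableSet_singleton true)).inter (measurableSet_armSet t)

/-- The probability of the arm `t` according to `η`. -/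
def Nuisance.arm (η : Nuisance dx ds) (t : Bool) (x : Fin dx → ℝ) : ℝ :=
  if t = true then η.e x else 1 - η.e x

/-- All components of `η` are measurable. -/
structure Nuisance.IsMeasurable (η : Nuisance dx ds) : Prop where
  e : Measurable η.e
  r : ∀ t, Measurable fun p : (Fin dx → ℝ) × (Fin ds → ℝ) => η.r t p.1 p.2
  mu : ∀ t, Measurable (η.mu t)
  muS : ∀ t, Measurable fun p : (Fin dx → ℝ) × (Fin ds → ℝ) => η.muS t p.1 p.2

theorem Nuisance.IsMeasurable.arm {η : Nuisance dx ds} (h : η.IsMeasurable) (t : Bool) :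
    Measurable (η.arm t) := by
  unfold Nuisance.arm
  cases t
  · simpa using h.e.const_sub 1
  · simpa using h.e

theorem ae_restrict_arm {t : Bool} {p : Full dx ds → Prop} (h : ∀ d, T d = t → p d) :
    ∀ᵐ d ∂P.restrict (armSet dx ds t), p d := by
  filter_upwards [ae_restrict_mem (measurableSet_armSet t)] with d hd using h d hd

theorem ae_restrict_labelled {t : Bool} {p : Full dx ds → Prop}
    (h : ∀ d, T d = t → R d = true → p d) :
    ∀ᵐ d ∂P.restrict (labelledSet dx ds t), p d := by
  filter_upwards [ae_restrict_mem (measurableSet_labelledSet t)] with d hd using h d hd.1 hd.2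

/-- The labelling propensity is a conditional probability under the law given `T = t`; this
translates it back to a restriction of `P`. -/
theorem cond_arm_restrict (t : Bool) :
    (P[|armSet dx ds t]).restrict (R ⁻¹' {true})
      = (P (armSet dx ds t))⁻¹ • P.restrict (labelledSet dx ds t) := by
  rw [ProbabilityTheory.cond, Measure.restrict_smul, Measure.restrict_restrict
    (measurable_R (measurableSet_singleton true)), labelledSet_eq]

variable [IsProbabilityMeasure P]

theorem etaStar_isMeasurable : (etaStar P).IsMeasurable where
  e := (Kernel.measurable_coe _ (measurableSet_singleton true)).ennreal_toReal
  r _ := (Kernel.measurable_coe _ (measurableSet_singleton true)).ennreal_toReal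
  mu _ := (StronglyMeasurable.integral_condDistrib (f := fun p : (Fin dx → ℝ) × ℝ => p.2)
    measurable_snd.stronglyMeasurable).measurable
  muS _ := (StronglyMeasurable.integral_condDistrib
    (f := fun p : ((Fin dx → ℝ) × (Fin ds → ℝ)) × ℝ => p.2)
    measurable_snd.stronglyMeasurable).measurable

theorem etaStar_arm (t : Bool) (x : Fin dx → ℝ) :
    (etaStar P).arm t x = (condDistrib T X P x).real {t} := by
  cases t
  · have h : ({false} : Set Bool) = {true}ᶜ := by ext b; cases b <;> simp
    rw [h, probReal_compl_eq_one_sub (measurableSet_singleton true)]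
    simp [Nuisance.arm, etaStar]
  · simp [Nuisance.arm, etaStar]

theorem measurable_XS : Measurable fun d : Full dx ds => (X d, S d) :=
  measurable_X.prodMk measurable_S

/-- Weighting by the propensity score. -/
theorem setLIntegral_arm (t : Bool) {g : (Fin dx → ℝ) → ℝ≥0∞} (hg : Measurable g) :
    ∫⁻ d in armSet dx ds t, g (X d) ∂P
      = ∫⁻ d, ENNReal.ofReal ((etaStar P).arm t (X d)) * g (X d) ∂P := by
  have := setLIntegral_preimage_comp (Q := P) measurable_T measurable_X
    (measurableSet_singleton t) hg
  refine this.trans (lintegral_congr fun d => ?_)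
  rw [etaStar_arm, ofReal_measureReal]

theorem setIntegral_arm (t : Bool) {g : (Fin dx → ℝ) → ℝ} (hg : Measurable g) :
    ∫ d in armSet dx ds t, g (X d) ∂P = ∫ d, (etaStar P).arm t (X d) * g (X d) ∂P := by
  simp only [etaStar_arm]
  exact setIntegral_preimage_comp (Q := P) measurable_T measurable_X
    (measurableSet_singleton t) hg

/-- This is where `Y(t) ⟂ T | X` enters: the propensity weight is legitimate even though the
integrand contains a potential outcome. -/
theorem setIntegral_arm_Ypot (h : Unconfounded P) (t : Bool) {g : (Fin dx → ℝ) × ℝ → ℝ}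
    (hg : Measurable g) :
    ∫ d in armSet dx ds t, g (X d, Ypot t d) ∂P
      = ∫ d, (etaStar P).arm t (X d) * g (X d, Ypot t d) ∂P := by
  simp only [etaStar_arm]
  have hci : CondIndepFun (MeasurableSpace.comap X inferInstance) measurable_X.comap_le
      (Ypot t) T P := (h.treatment t).comp measurable_fst measurable_id
  exact setIntegral_preimage_comp_of_condIndepFun measurable_T measurable_X (measurable_Ypot t)
    hci (measurableSet_singleton t) hg

/-- The outcome regression. -/
theorem setIntegral_arm_mul_Y (t : Bool) (hY : Integrable Y P) {g : (Fin dx → ℝ) → ℝ}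
    (hg : Measurable g) (hgY : IntegrableOn (fun d => g (X d) * Y d) (armSet dx ds t) P) :
    ∫ d in armSet dx ds t, g (X d) * Y d ∂P
      = ∫ d in armSet dx ds t, g (X d) * (etaStar P).mu t (X d) ∂P := by
  by_cases h0 : P (armSet dx ds t) = 0
  · simp [Measure.restrict_eq_zero.2 h0]
  have hc : (P (armSet dx ds t))⁻¹ ≠ ∞ := ENNReal.inv_ne_top.2 h0
  exact integral_restrict_eq_of_cond (integral_comp_mul_eq_integral_condDistrib
    (Q := P[|armSet dx ds t]) measurable_X (hY.integrableOn.smul_measure hc) hg (hgY.smul_measure hc)).2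

/-- The tower property under the law given `T = t, R = 1`, which is the law in which `μ̃*` is a
regression. No unconfoundedness is involved. -/
theorem setIntegral_labelled_mul_Y (t : Bool) (hY : Integrable Y P)
    {g : (Fin dx → ℝ) × (Fin ds → ℝ) → ℝ} (hg : Measurable g)
    (hgY : IntegrableOn (fun d => g (X d, S d) * Y d) (labelledSet dx ds t) P) :
    ∫ d in labelledSet dx ds t, g (X d, S d) * Y d ∂P
      = ∫ d in labelledSet dx ds t, g (X d, S d) * (etaStar P).muS t (X d) (S d) ∂P := by
  by_cases h0 : P (labelledSet dx ds t) = 0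
  · simp [Measure.restrict_eq_zero.2 h0]
  have hc : (P (labelledSet dx ds t))⁻¹ ≠ ∞ := ENNReal.inv_ne_top.2 h0
  exact integral_restrict_eq_of_cond (integral_comp_mul_eq_integral_condDistrib
    (Q := P[|labelledSet dx ds t]) measurable_XS (hY.integrableOn.smul_measure hc) hg (hgY.smul_measure hc)).2

/-- Weighting by the labelling propensity score. -/
theorem setLIntegral_labelled (t : Bool) {g : (Fin dx → ℝ) × (Fin ds → ℝ) → ℝ≥0∞}
    (hg : Measurable g) :
    ∫⁻ d in labelledSet dx ds t, g (X d, S d) ∂P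
      = ∫⁻ d in armSet dx ds t,
          ENNReal.ofReal ((etaStar P).r t (X d) (S d)) * g (X d, S d) ∂P := by
  have hsub : labelledSet dx ds t ⊆ armSet dx ds t := fun d hd => hd.1
  by_cases h0 : P (armSet dx ds t) = 0
  · simp [Measure.restrict_eq_zero.2 h0, Measure.restrict_eq_zero.2 (measure_mono_null hsub h0)]
  have hc : (P (armSet dx ds t))⁻¹ ≠ ∞ := ENNReal.inv_ne_top.2 h0
  have hc' : (P (armSet dx ds t))⁻¹ ≠ 0 := ENNReal.inv_ne_zero.2 (measure_ne_top _ _)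
  have := setLIntegral_preimage_comp (Q := P[|armSet dx ds t]) measurable_R measurable_XS
    (measurableSet_singleton true) hg
  rw [cond_arm_restrict] at this
  rw [lintegral_smul_measure, lintegral_cond_eq, smul_eq_mul,
    ENNReal.mul_right_inj hc' hc] at this
  refine this.trans (lintegral_congr fun d => ?_)
  congr 1
  exact (ENNReal.ofReal_toReal (measure_ne_top _ _)).symm

/-- Outcomes are missing at random: since `R ⟂ Y(t) | (X, T = t, S(t))`, weighting by `r*` remains
valid for integrands that involve the outcome. -/
theorem setIntegral_labelled_Y (h : Unconfounded P) (t : Bool)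
    {g : ((Fin dx → ℝ) × (Fin ds → ℝ)) × ℝ → ℝ} (hg : Measurable g) :
    ∫ d in labelledSet dx ds t, g ((X d, S d), Y d) ∂P
      = ∫ d in armSet dx ds t, (etaStar P).r t (X d) (S d) * g ((X d, S d), Y d) ∂P := by
  have hsub : labelledSet dx ds t ⊆ armSet dx ds t := fun d hd => hd.1
  by_cases h0 : P (armSet dx ds t) = 0
  · simp [Measure.restrict_eq_zero.2 h0, Measure.restrict_eq_zero.2 (measure_mono_null hsub h0)]
  have hc : (P (armSet dx ds t))⁻¹ ≠ ∞ := ENNReal.inv_ne_top.2 h0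
  have hc' : (P (armSet dx ds t))⁻¹ ≠ 0 := ENNReal.inv_ne_zero.2 (measure_ne_top _ _)
  -- The assumption conditions on `S(t)` whereas `r*` conditions on `S`; the two coincide on the
  -- arm, and so do the conditional laws.
  have hXS : (fun d : Full dx ds => (X d, S d)) =ᵐ[P[|armSet dx ds t]]
      fun d => (X d, Spot t d) := by
    refine Measure.ae_smul_measure (ae_restrict_arm fun d hd => ?_) _
    simp only [S, hd]
  have hci : CondIndepFun (MeasurableSpace.comap (fun d => (X d, Spot t d)) inferInstance)
      (measurable_X.prodMk (measurable_Spot t)).comap_le (Ypot t) R (P[|armSet dx ds t]) :=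
    (h.labelling t).symm
  have := setIntegral_preimage_comp_of_condIndepFun (Q := P[|armSet dx ds t]) measurable_R
    (measurable_X.prodMk (measurable_Spot t)) (measurable_Ypot t) hci
    (measurableSet_singleton true) hg
  rw [cond_arm_restrict, ← condDistrib_congr_right hXS] at this
  rw [integral_smul_measure, integral_cond_eq] at this
  have h3 := smul_right_injective ℝ (ENNReal.toReal_pos hc' hc).ne' this
  refine Eq.trans ?_ (h3.trans ?_)
  · refine integral_congr_ae (ae_restrict_labelled fun d hd _ => ?_)
    simp only [S, Y, hd]
  · refine integral_congr_ae (ae_restrict_arm fun d hd => ?_)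
    simp only [S, Y, hd, etaStar]
    rfl

end Identification

end

end SurrogateATE

namespace SurrogateATE

noncomputable section

/-! ### Square norms and weighted Cauchy–Schwarz. -/

section SquareNorms

variable {α : Type*} [MeasurableSpace α] {μ ν : Measure α}

theorem eLpNorm_two_sq (f : α → ℝ) (μ : Measure α) :
    eLpNorm f 2 μ ^ 2 = ∫⁻ a, ENNReal.ofReal (f a ^ 2) ∂μ := by
  have h := eLpNorm_nnreal_pow_eq_lintegral (f := f) (μ := μ) (p := 2) two_ne_zero
  simp only [NNReal.coe_ofNat, ENNReal.coe_ofNat, ENNReal.rpow_ofNat] at h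
  rw [h]
  refine lintegral_congr fun a => ?_
  rw [← ofReal_norm, ← ENNReal.ofReal_pow (norm_nonneg _), Real.norm_eq_abs, sq_abs]

theorem eLpNorm_two_le_of_lintegral_sq_le {f g : α → ℝ} {c : ℝ≥0∞}
    (h : ∫⁻ a, ENNReal.ofReal (f a ^ 2) ∂μ ≤ c ^ 2 * ∫⁻ a, ENNReal.ofReal (g a ^ 2) ∂ν) :
    eLpNorm f 2 μ ≤ c * eLpNorm g 2 ν := by
  rw [← eLpNorm_two_sq, ← eLpNorm_two_sq, ← mul_pow] at h
  exact (ENNReal.pow_le_pow_left_iff two_ne_zero).1 h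

/-- The Cauchy–Schwarz inequality with a bounded weight. -/
theorem enorm_integral_mul_mul_le {w f g : α → ℝ} {c : ℝ} (hw : ∀ᵐ a ∂μ, |w a| ≤ c)
    (hf : AEMeasurable f μ) (hg : AEMeasurable g μ) :
    ‖∫ a, w a * (f a * g a) ∂μ‖ₑ ≤ ENNReal.ofReal c * (eLpNorm f 2 μ * eLpNorm g 2 μ) := by
  refine (enorm_integral_le_lintegral_enorm _).trans ?_
  calc ∫⁻ a, ‖w a * (f a * g a)‖ₑ ∂μ
      ≤ ∫⁻ a, ENNReal.ofReal c * (‖f a‖ₑ * ‖g a‖ₑ) ∂μ := by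
        refine lintegral_mono_ae ?_
        filter_upwards [hw] with a ha
        rw [enorm_mul, enorm_mul]
        gcongr
        rw [← ofReal_norm]
        exact ENNReal.ofReal_le_ofReal ha
    _ = ENNReal.ofReal c * ∫⁻ a, ‖f a‖ₑ * ‖g a‖ₑ ∂μ := by
        rw [lintegral_const_mul' _ _ ENNReal.ofReal_ne_top]
    _ ≤ ENNReal.ofReal c * (eLpNorm f 2 μ * eLpNorm g 2 μ) := by
        gcongr
        have h := ENNReal.lintegral_mul_le_Lp_mul_Lq μ Real.HolderConjugate.two_two hf.enorm
          hg.enorm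
        refine h.trans (le_of_eq ?_)
        rw [eLpNorm_eq_lintegral_rpow_enorm_toReal two_ne_zero ENNReal.ofNat_ne_top,
          eLpNorm_eq_lintegral_rpow_enorm_toReal two_ne_zero ENNReal.ofNat_ne_top]
        simp

end SquareNorms

/-! ### Consequences of overlap: comparison of norms and identification of arm means. -/

section Overlap

variable {dx ds : ℕ} {P : Measure (Full dx ds)} [IsProbabilityMeasure P] {ε : ℝ}

omit [IsProbabilityMeasure P] in
theorem PropensityBounded.arm {η : Nuisance dx ds} (h : PropensityBounded P ε η) (hε : 0 < ε)
    (t : Bool) : ∀ᵐ d ∂P, η.arm t (X d) ∈ Set.Icc ε 1 := by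
  filter_upwards [h.e] with d hd
  cases t
  · simp only [Nuisance.arm, Bool.false_eq_true, if_false]
    exact ⟨by linarith [hd.2], by linarith [hd.1]⟩
  · simp only [Nuisance.arm, if_true]
    exact ⟨hd.1, by linarith [hd.2]⟩

omit [IsProbabilityMeasure P] in
theorem PropensityBounded.r_arm {η : Nuisance dx ds} (h : PropensityBounded P ε η) (t : Bool) :
    ∀ᵐ d ∂P.restrict (armSet dx ds t), η.r t (X d) (S d) ∈ Set.Icc ε 1 := by
  filter_upwards [ae_restrict_of_ae h.r, ae_restrict_mem (measurableSet_armSet t)] with d hd ht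
  have ht' : T d = t := ht
  rwa [ht'] at hd

theorem StrictOverlap.propensityBounded (h : StrictOverlap P ε) :
    PropensityBounded P ε (etaStar P) where
  e := h.treatment
  r := by
    filter_upwards [h.labelling true, h.labelling false] with d h1 h2
    rcases hT : T d with _ | _
    · simpa only [S, hT] using h2
    · simpa only [S, hT] using h1

/-- Given any covariate value, each arm has probability at least `ε`. Norms on one arm therefore
control norms under `P`, as is needed because `μ(t, ·)` is evaluated on all units although its error
is measured on the arm only. -/
theorem lintegral_le_setLIntegral_arm (h : PropensityBounded P ε (etaStar P)) (hε : 0 < ε)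
    (t : Bool) {g : (Fin dx → ℝ) → ℝ≥0∞} (hg : Measurable g) :
    ENNReal.ofReal ε * ∫⁻ d, g (X d) ∂P ≤ ∫⁻ d in armSet dx ds t, g (X d) ∂P := by
  rw [setLIntegral_arm t hg, ← lintegral_const_mul' _ _ ENNReal.ofReal_ne_top]
  refine lintegral_mono_ae ?_
  filter_upwards [h.arm hε t] with d hd
  gcongr
  exact hd.1

theorem setLIntegral_arm_le_labelled (h : PropensityBounded P ε (etaStar P))
    (t : Bool) {g : (Fin dx → ℝ) × (Fin ds → ℝ) → ℝ≥0∞} (hg : Measurable g) :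
    ENNReal.ofReal ε * ∫⁻ d in armSet dx ds t, g (X d, S d) ∂P
      ≤ ∫⁻ d in labelledSet dx ds t, g (X d, S d) ∂P := by
  rw [setLIntegral_labelled t hg, ← lintegral_const_mul' _ _ ENNReal.ofReal_ne_top]
  refine lintegral_mono_ae ?_
  filter_upwards [h.r_arm t] with d hd
  gcongr
  exact hd.1

/-- The factor is squared, at the cost of using `ε⁻¹ ≥ 1`, so that norm inequalities carry `ε⁻¹` and
no square root. -/
theorem inv_sq_bound {ε : ℝ} (hε : 0 < ε) (hε1 : ε ≤ 1) {a b : ℝ≥0∞}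
    (h : ENNReal.ofReal ε * a ≤ b) : a ≤ ENNReal.ofReal ε⁻¹ ^ 2 * b := by
  have h1 : ENNReal.ofReal ε⁻¹ * ENNReal.ofReal ε = 1 := by
    rw [← ENNReal.ofReal_mul (by positivity), inv_mul_cancel₀ hε.ne', ENNReal.ofReal_one]
  have h2 : 1 ≤ ENNReal.ofReal ε⁻¹ := by
    rw [ENNReal.one_le_ofReal]
    exact (one_le_inv₀ hε).2 hε1
  calc a = ENNReal.ofReal ε⁻¹ * (ENNReal.ofReal ε * a) := by rw [← mul_assoc, h1, one_mul]
    _ ≤ ENNReal.ofReal ε⁻¹ * b := by gcongr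
    _ = 1 * (ENNReal.ofReal ε⁻¹ * b) := (one_mul _).symm
    _ ≤ ENNReal.ofReal ε⁻¹ * (ENNReal.ofReal ε⁻¹ * b) := by gcongr
    _ = ENNReal.ofReal ε⁻¹ ^ 2 * b := by rw [sq, mul_assoc]

/-- Functions of the covariates are controlled on either arm. -/
theorem eLpNorm_le_arm (h : PropensityBounded P ε (etaStar P)) (hε : 0 < ε) (hε1 : ε ≤ 1)
    (t : Bool) {f : (Fin dx → ℝ) → ℝ} (hf : Measurable f) :
    eLpNorm (fun d => f (X d)) 2 P
      ≤ ENNReal.ofReal ε⁻¹ * eLpNorm (fun d => f (X d)) 2 (P.restrict (armSet dx ds t)) :=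
  eLpNorm_two_le_of_lintegral_sq_le (inv_sq_bound hε hε1
    (lintegral_le_setLIntegral_arm h hε t (hf.pow_const 2).ennreal_ofReal))

theorem eLpNorm_arm_le_labelled (h : PropensityBounded P ε (etaStar P)) (hε : 0 < ε)
    (hε1 : ε ≤ 1) (t : Bool) {f : (Fin dx → ℝ) × (Fin ds → ℝ) → ℝ} (hf : Measurable f) :
    eLpNorm (fun d => f (X d, S d)) 2 (P.restrict (armSet dx ds t)) ≤ ENNReal.ofReal ε⁻¹ *
      eLpNorm (fun d => f (X d, S d)) 2 (P.restrict (labelledSet dx ds t)) :=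
  eLpNorm_two_le_of_lintegral_sq_le (inv_sq_bound hε hε1
    (setLIntegral_arm_le_labelled h t (hf.pow_const 2).ennreal_ofReal))

omit [IsProbabilityMeasure P] in
theorem memLp_restrict_of_memLp_cond [IsFiniteMeasure P] {A : Set (Full dx ds)}
    {f : Full dx ds → ℝ} (h : P A ≠ 0 → MemLp f 2 P[|A]) : MemLp f 2 (P.restrict A) := by
  by_cases hA : P A = 0
  · rw [Measure.restrict_eq_zero.2 hA]
    exact memLp_measure_zero
  · have h1 := (h hA).smul_measure (c := P A) (measure_ne_top _ _)
    rwa [ProbabilityTheory.cond, smul_smul, ENNReal.mul_inv_cancel hA (measure_ne_top _ _),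
      one_smul] at h1

theorem memLp_mu_arm (t : Bool) (hY : MemLp Y 2 P) :
    MemLp (fun d => (etaStar P).mu t (X d)) 2 (P.restrict (armSet dx ds t)) :=
  memLp_restrict_of_memLp_cond fun h0 => memLp_integral_condDistrib
    (Q := P[|armSet dx ds t]) measurable_X
    ((hY.restrict _).smul_measure (ENNReal.inv_ne_top.2 h0))

theorem memLp_muS_labelled (t : Bool) (hY : MemLp Y 2 P) :
    MemLp (fun d => (etaStar P).muS t (X d) (S d)) 2 (P.restrict (labelledSet dx ds t)) :=
  memLp_restrict_of_memLp_cond fun h0 => memLp_integral_condDistrib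
    (Q := P[|labelledSet dx ds t]) measurable_XS
    ((hY.restrict _).smul_measure (ENNReal.inv_ne_top.2 h0))

/-- On its own arm `μ*(t, ·)` is a conditional mean of a square integrable variable; overlap extends
this to all of `P`. -/
theorem memLp_mu (h : PropensityBounded P ε (etaStar P)) (hε : 0 < ε) (hε1 : ε ≤ 1) (t : Bool)
    (hY : MemLp Y 2 P) : MemLp (fun d => (etaStar P).mu t (X d)) 2 P :=
  ⟨((etaStar_isMeasurable.mu t).comp measurable_X).aestronglyMeasurable,
    (eLpNorm_le_arm h hε hε1 t (etaStar_isMeasurable.mu t)).trans_lt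
      (ENNReal.mul_lt_top ENNReal.ofReal_lt_top (memLp_mu_arm t hY).2)⟩

theorem memLp_muS_arm (h : PropensityBounded P ε (etaStar P)) (hε : 0 < ε) (hε1 : ε ≤ 1)
    (t : Bool) (hY : MemLp Y 2 P) :
    MemLp (fun d => (etaStar P).muS t (X d) (S d)) 2 (P.restrict (armSet dx ds t)) :=
  ⟨((etaStar_isMeasurable.muS t).comp measurable_XS).aestronglyMeasurable,
    (eLpNorm_arm_le_labelled h hε hε1 t (etaStar_isMeasurable.muS t)).trans_lt
      (ENNReal.mul_lt_top ENNReal.ofReal_lt_top (memLp_muS_labelled t hY).2)⟩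

theorem abs_inv_le_of_mem {ε x : ℝ} (hε : 0 < ε) (hx : x ∈ Set.Icc ε 1) : |x⁻¹| ≤ ε⁻¹ := by
  rw [abs_of_pos (inv_pos.2 (hε.trans_le hx.1))]
  exact (inv_le_inv₀ (hε.trans_le hx.1) hε).2 hx.1

omit [IsProbabilityMeasure P] in
theorem labelledSet_subset (t : Bool) : labelledSet dx ds t ⊆ armSet dx ds t := fun _ hd => hd.1

omit [IsProbabilityMeasure P] in
theorem ae_labelled_of_arm {t : Bool} {p : Full dx ds → Prop}
    (h : ∀ᵐ d ∂P.restrict (armSet dx ds t), p d) :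
    ∀ᵐ d ∂P.restrict (labelledSet dx ds t), p d :=
  ae_mono (Measure.restrict_mono (labelledSet_subset t) le_rfl) h

/-- Identification of the arm mean. -/
theorem integral_Ypot_eq (hu : Unconfounded P) (h : PropensityBounded P ε (etaStar P))
    (hε : 0 < ε) (t : Bool) (hY : Integrable Y P) :
    ∫ d, Ypot t d ∂P = ∫ d, (etaStar P).mu t (X d) ∂P := by
  have hm : Measurable fun x => ((etaStar P).arm t x)⁻¹ := (etaStar_isMeasurable.arm t).inv
  have hint : IntegrableOn (fun d => ((etaStar P).arm t (X d))⁻¹ * Y d) (armSet dx ds t) P := by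
    refine hY.integrableOn.bdd_mul (c := ε⁻¹) (hm.comp measurable_X).aestronglyMeasurable ?_
    filter_upwards [ae_restrict_of_ae (h.arm hε t)] with d hd
    exact abs_inv_le_of_mem hε hd
  -- Inverse propensity weighting: inserting `a · a⁻¹` leads to the arm, where `Y(t) = Y` is
  -- replaced by its regression on `X`, and the same weight leads back.
  calc ∫ d, Ypot t d ∂P
      = ∫ d, (etaStar P).arm t (X d) * (((etaStar P).arm t (X d))⁻¹ * Ypot t d) ∂P := by
        refine integral_congr_ae ?_
        filter_upwards [h.arm hε t] with d hd
        rw [mul_inv_cancel_left₀ (hε.trans_le hd.1).ne']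
    _ = ∫ d in armSet dx ds t, ((etaStar P).arm t (X d))⁻¹ * Ypot t d ∂P :=
        (setIntegral_arm_Ypot hu t (g := fun p => ((etaStar P).arm t p.1)⁻¹ * p.2)
          ((hm.comp measurable_fst).mul measurable_snd)).symm
    _ = ∫ d in armSet dx ds t, ((etaStar P).arm t (X d))⁻¹ * Y d ∂P := by
        refine integral_congr_ae (ae_restrict_arm fun d hd => ?_)
        simp only [Y, hd]
    _ = ∫ d in armSet dx ds t, ((etaStar P).arm t (X d))⁻¹ * (etaStar P).mu t (X d) ∂P :=
        setIntegral_arm_mul_Y t hY hm hint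
    _ = ∫ d, (etaStar P).arm t (X d) *
          (((etaStar P).arm t (X d))⁻¹ * (etaStar P).mu t (X d)) ∂P :=
        setIntegral_arm t (g := fun x => ((etaStar P).arm t x)⁻¹ * (etaStar P).mu t x)
          (hm.mul (etaStar_isMeasurable.mu t))
    _ = ∫ d, (etaStar P).mu t (X d) ∂P := by
        refine integral_congr_ae ?_
        filter_upwards [h.arm hε t] with d hd
        rw [mul_inv_cancel_left₀ (hε.trans_le hd.1).ne']

/-- The surrogate regression has the same integrals against functions of the covariates as the
outcome regression: outcomes are missing at random. -/
theorem setIntegral_arm_mul_muS (hu : Unconfounded P) (h : PropensityBounded P ε (etaStar P))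
    (hε : 0 < ε) (t : Bool) (hY : Integrable Y P) {f : (Fin dx → ℝ) → ℝ} (hf : Measurable f)
    {c : ℝ} (hc : ∀ᵐ d ∂P, |f (X d)| ≤ c) :
    ∫ d in armSet dx ds t, f (X d) * (etaStar P).muS t (X d) (S d) ∂P
      = ∫ d in armSet dx ds t, f (X d) * (etaStar P).mu t (X d) ∂P := by
  set r : Full dx ds → ℝ := fun d => (etaStar P).r t (X d) (S d) with hr
  have hm : Measurable fun p : (Fin dx → ℝ) × (Fin ds → ℝ) =>
      ((etaStar P).r t p.1 p.2)⁻¹ * f p.1 :=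
    (etaStar_isMeasurable.r t).inv.mul (hf.comp measurable_fst)
  have hrb := h.r_arm t
  have hfY : Integrable (fun d => f (X d) * Y d) P :=
    hY.bdd_mul (c := c) (hf.comp measurable_X).aestronglyMeasurable hc
  have hint : IntegrableOn (fun d => (r d)⁻¹ * f (X d) * Y d) (labelledSet dx ds t) P := by
    simp only [mul_assoc]
    refine hfY.integrableOn.bdd_mul (c := ε⁻¹)
      ((etaStar_isMeasurable.r t).inv.comp measurable_XS).aestronglyMeasurable ?_
    filter_upwards [ae_labelled_of_arm hrb] with d hd
    exact abs_inv_le_of_mem hε hd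
  have key : ∀ Z : Full dx ds → ℝ, ∀ᵐ d ∂P.restrict (armSet dx ds t),
      f (X d) * Z d = r d * ((r d)⁻¹ * f (X d) * Z d) := fun Z => by
    filter_upwards [hrb] with d hd
    rw [mul_assoc, mul_inv_cancel_left₀ (hε.trans_le hd.1).ne']
  -- The weight `r⁻¹` leads from the arm to labelled units, where `μ̃*` and `Y` are interchangeable.
  -- Missingness at random permits the return with `Y` in the integrand, which is then regressed on
  -- `X`.
  calc ∫ d in armSet dx ds t, f (X d) * (etaStar P).muS t (X d) (S d) ∂P
      = ∫ d in armSet dx ds t, r d * ((r d)⁻¹ * f (X d) * (etaStar P).muS t (X d) (S d)) ∂P :=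
        integral_congr_ae (key _)
    _ = ∫ d in labelledSet dx ds t, (r d)⁻¹ * f (X d) * (etaStar P).muS t (X d) (S d) ∂P :=
        (setIntegral_labelled_Y hu t (g := fun p => ((etaStar P).r t p.1.1 p.1.2)⁻¹ * f p.1.1 *
          (etaStar P).muS t p.1.1 p.1.2) ((hm.mul (etaStar_isMeasurable.muS t)).comp
            measurable_fst)).symm
    _ = ∫ d in labelledSet dx ds t, (r d)⁻¹ * f (X d) * Y d ∂P :=
        (setIntegral_labelled_mul_Y t hY (g := fun p => ((etaStar P).r t p.1 p.2)⁻¹ * f p.1) hm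
          hint).symm
    _ = ∫ d in armSet dx ds t, r d * ((r d)⁻¹ * f (X d) * Y d) ∂P :=
        setIntegral_labelled_Y hu t (g := fun p => ((etaStar P).r t p.1.1 p.1.2)⁻¹ * f p.1.1 *
          p.2) ((hm.comp measurable_fst).mul measurable_snd)
    _ = ∫ d in armSet dx ds t, f (X d) * Y d ∂P := (integral_congr_ae (key _)).symm
    _ = ∫ d in armSet dx ds t, f (X d) * (etaStar P).mu t (X d) ∂P :=
        setIntegral_arm_mul_Y t hY hf hfY.integrableOn

end Overlap

end

end SurrogateATE

namespace SurrogateATE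

noncomputable section

/-! ### The score as a difference of two arm scores. -/

section ArmScore

variable {dx ds : ℕ}

/-- The part of the score that estimates `E[Y(t)]`. -/
def armScore (η : Nuisance dx ds) (t : Bool) (d : Full dx ds) : ℝ :=
  η.mu t (X d)
    + (labelledSet dx ds t).indicator
      (fun d => (η.arm t (X d) * η.r t (X d) (S d))⁻¹ * (Y d - η.muS t (X d) (S d))) d
    + (armSet dx ds t).indicator
      (fun d => (η.arm t (X d))⁻¹ * (η.muS t (X d) (S d) - η.mu t (X d))) d

/-- A case check over `T` and `R`. The placeholder recorded for a missing outcome is irrelevant,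
since the outcome only occurs with a factor `R`. -/
theorem score_observe (η : Nuisance dx ds) (d : Full dx ds) :
    score η (observe d) = armScore η true d - armScore η false d := by
  rcases hT : T d with _ | _ <;> rcases hR : R d with _ | _ <;>
    simp [score, observe, armScore, labelledSet, armSet, ind, Nuisance.arm, Set.indicator, hT,
      hR] <;> ring

variable {η : Nuisance dx ds}

theorem Nuisance.IsMeasurable.comp_arm (h : η.IsMeasurable) (t : Bool) :
    Measurable fun d : Full dx ds => η.arm t (X d) := (h.arm t).comp measurable_X

theorem Nuisance.IsMeasurable.comp_mu (h : η.IsMeasurable) (t : Bool) :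
    Measurable fun d : Full dx ds => η.mu t (X d) := (h.mu t).comp measurable_X

theorem Nuisance.IsMeasurable.comp_r (h : η.IsMeasurable) (t : Bool) :
    Measurable fun d : Full dx ds => η.r t (X d) (S d) := (h.r t).comp measurable_XS

theorem Nuisance.IsMeasurable.comp_muS (h : η.IsMeasurable) (t : Bool) :
    Measurable fun d : Full dx ds => η.muS t (X d) (S d) := (h.muS t).comp measurable_XS

theorem measurable_armScore (h : η.IsMeasurable) (t : Bool) : Measurable (armScore η t) := by
  refine ((h.comp_mu t).add (Measurable.indicator ?_ (measurableSet_labelledSet t))).add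
    (Measurable.indicator ?_ (measurableSet_armSet t))
  · exact ((h.comp_arm t).mul (h.comp_r t)).inv.mul (measurable_Y.sub (h.comp_muS t))
  · exact (h.comp_arm t).inv.mul ((h.comp_muS t).sub (h.comp_mu t))

end ArmScore

/-! ### Errors on one arm against errors at the realized treatment. -/

section Distances

variable {dx ds : ℕ} {P : Measure (Full dx ds)} (η η' : Nuisance dx ds) (t : Bool)

theorem eLpNorm_arm_sub :
    eLpNorm (fun d => η.arm t (X d) - η'.arm t (X d)) 2 P = distE P η η' := by
  refine eLpNorm_congr_norm_ae (ae_of_all _ fun d => ?_)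
  cases t
  · simp only [Nuisance.arm, Bool.false_eq_true, if_false]
    rw [sub_sub_sub_cancel_left, norm_sub_rev]
  · simp [Nuisance.arm]

/-- The distances evaluate nuisance functions at the realized `T`, so they see `η.mu t`, `η.r t` and
`η.muS t` only where `T = t`. -/
theorem eLpNorm_restrict_arm_le {f g : Full dx ds → ℝ} (h : ∀ d, T d = t → f d = g d) :
    eLpNorm f 2 (P.restrict (armSet dx ds t)) ≤ eLpNorm g 2 P := by
  rw [eLpNorm_congr_ae (ae_restrict_arm h)]
  exact eLpNorm_mono_measure _ Measure.restrict_le_self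

theorem eLpNorm_r_arm_le :
    eLpNorm (fun d => η.r t (X d) (S d) - η'.r t (X d) (S d)) 2 (P.restrict (armSet dx ds t))
      ≤ distR P η η' := eLpNorm_restrict_arm_le t fun d hd => by rw [hd]

theorem eLpNorm_mu_arm_le :
    eLpNorm (fun d => η.mu t (X d) - η'.mu t (X d)) 2 (P.restrict (armSet dx ds t))
      ≤ distMu P η η' := eLpNorm_restrict_arm_le t fun d hd => by rw [hd]

theorem eLpNorm_muS_arm_le :
    eLpNorm (fun d => η.muS t (X d) (S d) - η'.muS t (X d) (S d)) 2
      (P.restrict (armSet dx ds t)) ≤ distMuS P η η' :=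
  eLpNorm_restrict_arm_le t fun d hd => by rw [hd]

end Distances

/-! ### Product structure of the bias. -/

section Bias

variable {dx ds : ℕ} {P : Measure (Full dx ds)} [IsProbabilityMeasure P] {ε : ℝ}
  {η : Nuisance dx ds}

theorem abs_inv_mul_inv_le {ε x y : ℝ} (hε : 0 < ε) (hx : x ∈ Set.Icc ε 1)
    (hy : y ∈ Set.Icc ε 1) : |(x * y)⁻¹| ≤ ε⁻¹ ^ 2 := by
  rw [mul_inv, abs_mul, sq]
  exact mul_le_mul (abs_inv_le_of_mem hε hx) (abs_inv_le_of_mem hε hy) (abs_nonneg _)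
    (by positivity)

theorem integrable_mul_of_ae_bound {α : Type*} [MeasurableSpace α] {ν : Measure α}
    {f g : α → ℝ} {c : ℝ} (hg : Integrable g ν) (hf : Measurable f)
    (hb : ∀ᵐ a ∂ν, |f a| ≤ c) : Integrable (fun a => f a * g a) ν :=
  hg.bdd_mul hf.aestronglyMeasurable hb

/-- The product structure of the bias of the score. -/
theorem integral_armScore_sub (hu : Unconfounded P) (h : PropensityBounded P ε (etaStar P))
    (hε : 0 < ε) (hε1 : ε ≤ 1) (hY : MemLp Y 2 P) (t : Bool) (hη : η.IsMeasurable)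
    (hb : PropensityBounded P ε η)
    (hmu : MemLp (fun d => η.mu t (X d) - (etaStar P).mu t (X d)) 2 P)
    (hmuS : MemLp (fun d => η.muS t (X d) (S d) - (etaStar P).muS t (X d) (S d)) 2
      (P.restrict (armSet dx ds t))) :
    Integrable (armScore η t) P ∧ ∫ d, armScore η t d ∂P - ∫ d, Ypot t d ∂P
      = ∫ d, (η.arm t (X d))⁻¹ * ((η.mu t (X d) - (etaStar P).mu t (X d))
          * (η.arm t (X d) - (etaStar P).arm t (X d))) ∂P
        + ∫ d in armSet dx ds t, (η.arm t (X d) * η.r t (X d) (S d))⁻¹ *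
          ((η.muS t (X d) (S d) - (etaStar P).muS t (X d) (S d))
            * (η.r t (X d) (S d) - (etaStar P).r t (X d) (S d))) ∂P := by
  have hs : (etaStar P).IsMeasurable := etaStar_isMeasurable
  have hYi : Integrable Y P := hY.integrable one_le_two
  set PA := P.restrict (armSet dx ds t) with hPA
  set PL := P.restrict (labelledSet dx ds t) with hPL
  set a : Full dx ds → ℝ := fun d => η.arm t (X d) with ha
  set r : Full dx ds → ℝ := fun d => η.r t (X d) (S d) with hr
  set m : Full dx ds → ℝ := fun d => η.mu t (X d) with hm
  set n : Full dx ds → ℝ := fun d => η.muS t (X d) (S d) with hn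
  set a' : Full dx ds → ℝ := fun d => (etaStar P).arm t (X d) with ha'
  set r' : Full dx ds → ℝ := fun d => (etaStar P).r t (X d) (S d) with hr'
  set m' : Full dx ds → ℝ := fun d => (etaStar P).mu t (X d) with hm'
  set n' : Full dx ds → ℝ := fun d => (etaStar P).muS t (X d) (S d) with hn'
  have am : Measurable a := hη.comp_arm t
  have rm : Measurable r := hη.comp_r t
  have haP : ∀ᵐ d ∂P, a d ∈ Set.Icc ε 1 := hb.arm hε t
  have haA : ∀ᵐ d ∂PA, a d ∈ Set.Icc ε 1 := ae_restrict_of_ae haP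
  have hrA : ∀ᵐ d ∂PA, r d ∈ Set.Icc ε 1 := hb.r_arm t
  have hwP : ∀ᵐ d ∂P, |(a d)⁻¹| ≤ ε⁻¹ := by
    filter_upwards [haP] with d hd using abs_inv_le_of_mem hε hd
  have hwA : ∀ᵐ d ∂PA, |(a d)⁻¹| ≤ ε⁻¹ := ae_restrict_of_ae hwP
  have hvA : ∀ᵐ d ∂PA, |(a d * r d)⁻¹| ≤ ε⁻¹ ^ 2 := by
    filter_upwards [haA, hrA] with d h1 h2 using abs_inv_mul_inv_le hε h1 h2
  have hvL : ∀ᵐ d ∂PL, |(a d * r d)⁻¹| ≤ ε⁻¹ ^ 2 := ae_labelled_of_arm hvA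
  have hLA : PL ≤ PA := Measure.restrict_mono (labelledSet_subset t) le_rfl
  have dm : Integrable (fun d => m d - m' d) P := hmu.integrable one_le_two
  have dn : Integrable (fun d => n d - n' d) PA := hmuS.integrable one_le_two
  have dnL : Integrable (fun d => n d - n' d) PL := dn.mono_measure hLA
  have im' : Integrable m' P := (memLp_mu h hε hε1 t hY).integrable one_le_two
  have in' : Integrable n' PA := (memLp_muS_arm h hε hε1 t hY).integrable one_le_two
  have in'L : Integrable n' PL := in'.mono_measure hLA
  have im : Integrable m P := (dm.add im').congr (ae_of_all _ fun d => sub_add_cancel _ _)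
  have hvm : Measurable fun d => (a d * r d)⁻¹ := (am.mul rm).inv
  -- the labelled term
  have hL1 : Integrable (fun d => (a d * r d)⁻¹ * Y d) PL :=
    integrable_mul_of_ae_bound hYi.integrableOn hvm hvL
  have hL2 : Integrable (fun d => (a d * r d)⁻¹ * n' d) PL :=
    integrable_mul_of_ae_bound in'L hvm hvL
  have hL12 : Integrable (fun d => (a d * r d)⁻¹ * Y d - (a d * r d)⁻¹ * n' d) PL := hL1.sub hL2
  have hL3 : Integrable (fun d => (a d * r d)⁻¹ * (n d - n' d)) PL :=
    integrable_mul_of_ae_bound dnL hvm hvL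
  have eL : (fun d => (a d * r d)⁻¹ * (Y d - n d)) = fun d => (a d * r d)⁻¹ * Y d
      - (a d * r d)⁻¹ * n' d - (a d * r d)⁻¹ * (n d - n' d) := by ext d; ring
  have hLint : Integrable (fun d => (a d * r d)⁻¹ * (Y d - n d)) PL := by
    rw [eL]; exact hL12.sub hL3
  have gvm : Measurable fun p : (Fin dx → ℝ) × (Fin ds → ℝ) =>
      (η.arm t p.1 * η.r t p.1 p.2)⁻¹ := (((hη.arm t).comp measurable_fst).mul (hη.r t)).inv
  -- On labelled units `Y` averages to `n'` against functions of `(X, S)`, so only `n - n'`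
  -- survives; it is then transferred to the arm with weight `r'`.
  have hLval : ∫ d, (a d * r d)⁻¹ * (Y d - n d) ∂PL
      = - ∫ d, r' d * ((a d * r d)⁻¹ * (n d - n' d)) ∂PA := by
    rw [eL, integral_sub hL12 hL3, integral_sub hL1 hL2,
      setIntegral_labelled_mul_Y t hYi (g := fun p => (η.arm t p.1 * η.r t p.1 p.2)⁻¹) gvm hL1,
      sub_self, zero_sub]
    congr 1
    exact setIntegral_labelled_Y hu t (g := fun p => (η.arm t p.1.1 * η.r t p.1.1 p.1.2)⁻¹ *
      (η.muS t p.1.1 p.1.2 - (etaStar P).muS t p.1.1 p.1.2))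
      ((gvm.mul ((hη.muS t).sub (hs.muS t))).comp measurable_fst)
  -- the arm term
  have hA1 : Integrable (fun d => (a d)⁻¹ * (n d - n' d)) PA :=
    integrable_mul_of_ae_bound dn am.inv hwA
  have hA2 : Integrable (fun d => (a d)⁻¹ * n' d) PA :=
    integrable_mul_of_ae_bound in' am.inv hwA
  have hA3 : Integrable (fun d => (a d)⁻¹ * m' d) PA :=
    integrable_mul_of_ae_bound im'.integrableOn am.inv hwA
  have hA23 : Integrable (fun d => (a d)⁻¹ * n' d - (a d)⁻¹ * m' d) PA := hA2.sub hA3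
  have hA123 : Integrable (fun d => (a d)⁻¹ * (n d - n' d)
      + ((a d)⁻¹ * n' d - (a d)⁻¹ * m' d)) PA := hA1.add hA23
  have hA4 : Integrable (fun d => (a d)⁻¹ * (m d - m' d)) PA :=
    integrable_mul_of_ae_bound dm.integrableOn am.inv hwA
  have eA : (fun d => (a d)⁻¹ * (n d - m d)) = fun d => (a d)⁻¹ * (n d - n' d)
      + ((a d)⁻¹ * n' d - (a d)⁻¹ * m' d) - (a d)⁻¹ * (m d - m' d) := by ext d; ring
  have hAint : Integrable (fun d => (a d)⁻¹ * (n d - m d)) PA := by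
    rw [eA]; exact hA123.sub hA4
  -- The middle part `n' - m'` integrates to zero against functions of `X`, as both regressions have
  -- the same integrals there.
  have hAval : ∫ d, (a d)⁻¹ * (n d - m d) ∂PA
      = ∫ d, (a d)⁻¹ * (n d - n' d) ∂PA - ∫ d, a' d * ((a d)⁻¹ * (m d - m' d)) ∂P := by
    rw [eA, integral_sub hA123 hA4, integral_add hA1 hA23,
      integral_sub hA2 hA3,
      setIntegral_arm_mul_muS hu h hε t hYi (f := fun x => (η.arm t x)⁻¹) (hη.arm t).inv hwP,
      sub_self, add_zero]
    congr 1
    exact setIntegral_arm t (g := fun x => (η.arm t x)⁻¹ * (η.mu t x - (etaStar P).mu t x))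
      ((hη.arm t).inv.mul ((hη.mu t).sub (hs.mu t)))
  have hLint' : Integrable ((labelledSet dx ds t).indicator
      fun d => (a d * r d)⁻¹ * (Y d - n d)) P :=
    (integrable_indicator_iff (measurableSet_labelledSet t)).2 hLint
  have hAint' : Integrable ((armSet dx ds t).indicator fun d => (a d)⁻¹ * (n d - m d)) P :=
    (integrable_indicator_iff (measurableSet_armSet t)).2 hAint
  refine ⟨(im.add hLint').add hAint', ?_⟩
  have hsplit : ∫ d, armScore η t d ∂P = ∫ d, m d ∂P + ∫ d, (a d * r d)⁻¹ * (Y d - n d) ∂PL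
      + ∫ d, (a d)⁻¹ * (n d - m d) ∂PA := by
    rw [← integral_indicator (measurableSet_labelledSet t),
      ← integral_indicator (measurableSet_armSet t), ← integral_add im hLint']
    exact integral_add (im.add hLint') hAint'
  have hr'b : ∀ᵐ d ∂PA, |r' d| ≤ 1 := by
    filter_upwards [h.r_arm t] with d hd
    rw [abs_of_nonneg (hε.le.trans hd.1)]
    exact hd.2
  have ha'b : ∀ᵐ d ∂P, |a' d| ≤ 1 := by
    filter_upwards [h.arm hε t] with d hd
    rw [abs_of_nonneg (hε.le.trans hd.1)]
    exact hd.2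
  have hB1 : Integrable (fun d => a' d * ((a d)⁻¹ * (m d - m' d))) P :=
    integrable_mul_of_ae_bound (integrable_mul_of_ae_bound dm am.inv hwP) (hs.comp_arm t) ha'b
  have hB2 : Integrable (fun d => r' d * ((a d * r d)⁻¹ * (n d - n' d))) PA :=
    integrable_mul_of_ae_bound (integrable_mul_of_ae_bound dn hvm hvA) (hs.comp_r t) hr'b
  -- The plug-in error `m - m'` and its correction combine with the factor `1 - a'/a = (a - a')/a`.
  have e1 : ∫ d, (a d)⁻¹ * ((m d - m' d) * (a d - a' d)) ∂P
      = ∫ d, (m d - m' d) ∂P - ∫ d, a' d * ((a d)⁻¹ * (m d - m' d)) ∂P := by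
    rw [← integral_sub dm hB1]
    refine integral_congr_ae ?_
    filter_upwards [haP] with d hd
    have : a d ≠ 0 := (hε.trans_le hd.1).ne'
    field_simp
  -- Likewise the two contributions of `n - n'` combine with the factor `1 - r'/r`.
  have e2 : ∫ d, (a d * r d)⁻¹ * ((n d - n' d) * (r d - r' d)) ∂PA
      = ∫ d, (a d)⁻¹ * (n d - n' d) ∂PA
        - ∫ d, r' d * ((a d * r d)⁻¹ * (n d - n' d)) ∂PA := by
    rw [← integral_sub hA1 hB2]
    refine integral_congr_ae ?_
    filter_upwards [haA, hrA] with d hd hd'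
    have h1 : a d ≠ 0 := (hε.trans_le hd.1).ne'
    have h2 : r d ≠ 0 := (hε.trans_le hd'.1).ne'
    field_simp
  rw [hsplit, hLval, hAval, e1, e2, integral_Ypot_eq hu h hε t hYi, integral_sub im im']
  ring

theorem memLp_two_sub_mu (h : PropensityBounded P ε (etaStar P)) (hε : 0 < ε) (hε1 : ε ≤ 1)
    (t : Bool) (hη : η.IsMeasurable) (hmu : distMu P η (etaStar P) ≠ ∞) :
    MemLp (fun d => η.mu t (X d) - (etaStar P).mu t (X d)) 2 P :=
  ⟨((hη.comp_mu t).sub (etaStar_isMeasurable.comp_mu t)).aestronglyMeasurable,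
    (eLpNorm_le_arm h hε hε1 t ((hη.mu t).sub (etaStar_isMeasurable.mu t))).trans_lt
      (ENNReal.mul_lt_top ENNReal.ofReal_lt_top
        ((eLpNorm_mu_arm_le η (etaStar P) t).trans_lt hmu.lt_top))⟩

theorem memLp_two_sub_muS (t : Bool) (hη : η.IsMeasurable)
    (hmuS : distMuS P η (etaStar P) ≠ ∞) :
    MemLp (fun d => η.muS t (X d) (S d) - (etaStar P).muS t (X d) (S d)) 2
      (P.restrict (armSet dx ds t)) :=
  ⟨((hη.comp_muS t).sub (etaStar_isMeasurable.comp_muS t)).aestronglyMeasurable,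
    (eLpNorm_muS_arm_le η (etaStar P) t).trans_lt hmuS.lt_top⟩

/-- Cauchy–Schwarz on each product. In the first, one `ε⁻¹` bounds the weight and the other pays for
passing from the arm to `P`; in the second, both come from the weight `(a r)⁻¹`. -/
theorem enorm_integral_armScore_sub_le (hu : Unconfounded P)
    (h : PropensityBounded P ε (etaStar P)) (hε : 0 < ε) (hε1 : ε ≤ 1) (hY : MemLp Y 2 P)
    (t : Bool) (hη : η.IsMeasurable) (hb : PropensityBounded P ε η)
    (hmu : distMu P η (etaStar P) ≠ ∞) (hmuS : distMuS P η (etaStar P) ≠ ∞) :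
    Integrable (armScore η t) P ∧ ‖∫ d, armScore η t d ∂P - ∫ d, Ypot t d ∂P‖ₑ
      ≤ ENNReal.ofReal (ε⁻¹ ^ 2) * (distE P η (etaStar P) * distMu P η (etaStar P)
        + distR P η (etaStar P) * distMuS P η (etaStar P)) := by
  have hs : (etaStar P).IsMeasurable := etaStar_isMeasurable
  obtain ⟨hint, heq⟩ := integral_armScore_sub hu h hε hε1 hY t hη hb
    (memLp_two_sub_mu h hε hε1 t hη hmu) (memLp_two_sub_muS t hη hmuS)
  refine ⟨hint, ?_⟩
  rw [heq, mul_add]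
  refine (enorm_add_le _ _).trans (add_le_add ?_ ?_)
  · refine (enorm_integral_mul_mul_le (c := ε⁻¹)
      (f := fun d => η.mu t (X d) - (etaStar P).mu t (X d))
      (g := fun d => η.arm t (X d) - (etaStar P).arm t (X d)) ?_ ((hη.comp_mu t).sub
      (hs.comp_mu t)).aemeasurable ((hη.comp_arm t).sub (hs.comp_arm t)).aemeasurable).trans ?_
    · filter_upwards [hb.arm hε t] with d hd using abs_inv_le_of_mem hε hd
    · rw [eLpNorm_arm_sub]
      have h1 := (eLpNorm_le_arm h hε hε1 t ((hη.mu t).sub (hs.mu t))).trans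
        (mul_le_mul_right (eLpNorm_mu_arm_le η (etaStar P) t) _)
      calc _ ≤ ENNReal.ofReal ε⁻¹ * (ENNReal.ofReal ε⁻¹ * distMu P η (etaStar P)
            * distE P η (etaStar P)) := by gcongr; exact h1
        _ = _ := by
          rw [ENNReal.ofReal_pow (by positivity)]
          ring
  · refine (enorm_integral_mul_mul_le (c := ε⁻¹ ^ 2)
      (f := fun d => η.muS t (X d) (S d) - (etaStar P).muS t (X d) (S d))
      (g := fun d => η.r t (X d) (S d) - (etaStar P).r t (X d) (S d)) ?_ ((hη.comp_muS t).sub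
      (hs.comp_muS t)).aemeasurable ((hη.comp_r t).sub (hs.comp_r t)).aemeasurable).trans ?_
    · filter_upwards [ae_restrict_of_ae (hb.arm hε t), hb.r_arm t] with d h1 h2
      exact abs_inv_mul_inv_le hε h1 h2
    · rw [mul_comm (distR P η (etaStar P))]
      gcongr
      · exact eLpNorm_muS_arm_le η (etaStar P) t
      · exact eLpNorm_r_arm_le η (etaStar P) t

/-- The bias of the score is a sum of products of estimation errors. -/
theorem enorm_integral_score_sub_le (hu : Unconfounded P)
    (h : PropensityBounded P ε (etaStar P)) (hε : 0 < ε) (hε1 : ε ≤ 1) (hY : MemLp Y 2 P)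
    (hη : η.IsMeasurable) (hb : PropensityBounded P ε η)
    (hmu : distMu P η (etaStar P) ≠ ∞) (hmuS : distMuS P η (etaStar P) ≠ ∞) :
    Integrable (fun d => score η (observe d)) P ∧
    ‖∫ d, score η (observe d) ∂P - deltaStar P‖ₑ
      ≤ 2 * ENNReal.ofReal (ε⁻¹ ^ 2) * (distE P η (etaStar P) * distMu P η (etaStar P)
        + distR P η (etaStar P) * distMuS P η (etaStar P)) := by
  obtain ⟨i1, b1⟩ := enorm_integral_armScore_sub_le hu h hε hε1 hY true hη hb hmu hmuS
  obtain ⟨i0, b0⟩ := enorm_integral_armScore_sub_le hu h hε hε1 hY false hη hb hmu hmuS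
  simp only [score_observe]
  refine ⟨i1.sub i0, ?_⟩
  rw [integral_sub i1 i0, deltaStar]
  have e : ∫ d, armScore η true d ∂P - ∫ d, armScore η false d ∂P
      - (∫ d, Ypot true d ∂P - ∫ d, Ypot false d ∂P)
      = (∫ d, armScore η true d ∂P - ∫ d, Ypot true d ∂P)
        - (∫ d, armScore η false d ∂P - ∫ d, Ypot false d ∂P) := by ring
  rw [e, mul_assoc, two_mul]
  exact (enorm_sub_le).trans (add_le_add b1 b0)

omit [IsProbabilityMeasure P] in
theorem nuisanceDist_self (η : Nuisance dx ds) : distE P η η = 0 ∧ distR P η η = 0 ∧ distMu P η η = 0 ∧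
    distMuS P η η = 0 := by
  simp [distE, distR, distMu, distMuS]

/-- The efficient influence function identifies the average treatment effect. -/
theorem integral_score_etaStar (hu : Unconfounded P)
    (h : PropensityBounded P ε (etaStar P)) (hε : 0 < ε) (hε1 : ε ≤ 1) (hY : MemLp Y 2 P) :
    ∫ d, score (etaStar P) (observe d) ∂P = deltaStar P := by
  obtain ⟨h1, h2, h3, h4⟩ := nuisanceDist_self (P := P) (etaStar P)
  -- At `η = η*` both error products are zero, so the bias vanishes.
  have := (enorm_integral_score_sub_le hu h hε hε1 hY etaStar_isMeasurable h
    (by simp [h3]) (by simp [h4])).2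
  simp only [h1, h2, zero_mul, add_zero, mul_zero, nonpos_iff_eq_zero, enorm_eq_zero] at this
  exact sub_eq_zero.1 this

end Bias

end

end SurrogateATE

namespace SurrogateATE

noncomputable section

/-! ### Small bounded weights, and pointwise Lipschitz bounds for the score. -/

section Truncation

/-- Bounded weights with a small integral, against an integrable function. -/
theorem exists_lintegral_mul_le {α : Type*} [MeasurableSpace α] {ν : Measure α}
    {Z : α → ℝ≥0∞} (hZ : ∫⁻ a, Z a ∂ν ≠ ∞) {κ : ℝ≥0∞} (hκ : 0 < κ) (hκ' : κ ≠ ∞) :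
    ∃ δ : ℝ≥0∞, 0 < δ ∧ ∀ W : α → ℝ≥0∞, Measurable W → (∀ᵐ a ∂ν, W a ≤ 2) →
      ∫⁻ a, W a ∂ν ≤ δ → ∫⁻ a, W a * Z a ∂ν ≤ κ := by
  -- Absolute continuity of the integral of `Z`. The level `κ / 4` anticipates the bound `W ≤ 2` on
  -- the set where `W ≥ τ`.
  obtain ⟨δ₀, hδ₀, hs⟩ := exists_pos_setLIntegral_lt_of_measure_lt hZ (ε := κ / 4)
    (ENNReal.div_pos hκ.ne' (by simp)).ne'
  obtain ⟨δ₁, hδ₁0, hδ₁⟩ := exists_between (lt_min hδ₀ one_pos)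
  have hδ₁t : δ₁ ≠ ∞ := (hδ₁.trans_le (min_le_right _ _)).ne_top
  set I := ∫⁻ a, Z a ∂ν with hI
  obtain ⟨τ, hτ0, hτt, hτ⟩ : ∃ τ : ℝ≥0∞, 0 < τ ∧ τ ≠ ∞ ∧ τ * I ≤ κ / 2 := by
    refine ⟨κ / 2 / (I + 1), ENNReal.div_pos (ENNReal.half_pos hκ.ne').ne' (by simp [hZ]), ?_, ?_⟩
    · exact (ENNReal.div_lt_top (ENNReal.div_ne_top hκ' two_ne_zero) (by simp)).ne
    · calc κ / 2 / (I + 1) * I ≤ κ / 2 / (I + 1) * (I + 1) := by gcongr; exact le_self_add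
        _ = κ / 2 := ENNReal.div_mul_cancel (by simp) (by simp [hZ])
  -- Markov's inequality turns `∫ W ≤ τ δ₁` into `ν(W ≥ τ) ≤ δ₁ < δ₀`. Off this set `W < τ`, and `τ
  -- I ≤ κ / 2`.
  refine ⟨τ * δ₁, ENNReal.mul_pos hτ0.ne' hδ₁0.ne', fun W hW hW2 hWδ => ?_⟩
  have hms : MeasurableSet {a | τ ≤ W a} := measurableSet_le measurable_const hW
  have hμs : ν {a | τ ≤ W a} < δ₀ := by
    refine lt_of_le_of_lt ?_ (hδ₁.trans_le (min_le_left _ _))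
    refine (meas_ge_le_lintegral_div hW.aemeasurable hτ0.ne' hτt).trans ?_
    refine ENNReal.div_le_of_le_mul ?_
    rwa [mul_comm]
  have h1 : ∫⁻ a in {a | τ ≤ W a}, W a * Z a ∂ν ≤ κ / 2 := by
    calc ∫⁻ a in {a | τ ≤ W a}, W a * Z a ∂ν
        ≤ ∫⁻ a in {a | τ ≤ W a}, 2 * Z a ∂ν := by
          refine lintegral_mono_ae ?_
          filter_upwards [ae_restrict_of_ae hW2] with a ha
          gcongr
      _ = 2 * ∫⁻ a in {a | τ ≤ W a}, Z a ∂ν := lintegral_const_mul' _ _ (by simp)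
      _ ≤ 2 * (κ / 4) := by gcongr; exact (hs _ hμs).le
      _ = κ / 2 := by
        rw [div_eq_mul_inv, div_eq_mul_inv, mul_left_comm]
        congr 1
        rw [show (4 : ℝ≥0∞) = 2 * 2 by norm_num, ENNReal.mul_inv (by simp) (by simp), ← mul_assoc,
          ENNReal.mul_inv_cancel (by simp) (by simp), one_mul]
  have h2 : ∫⁻ a in {a | τ ≤ W a}ᶜ, W a * Z a ∂ν ≤ κ / 2 := by
    calc ∫⁻ a in {a | τ ≤ W a}ᶜ, W a * Z a ∂ν
        ≤ ∫⁻ a in {a | τ ≤ W a}ᶜ, τ * Z a ∂ν := by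
          refine lintegral_mono_ae ?_
          filter_upwards [ae_restrict_mem hms.compl] with a ha
          gcongr
          exact (not_le.1 (show ¬ τ ≤ W a from ha)).le
      _ = τ * ∫⁻ a in {a | τ ≤ W a}ᶜ, Z a ∂ν := lintegral_const_mul' _ _ hτt
      _ ≤ τ * I := by gcongr; exact setLIntegral_le_lintegral _ _
      _ ≤ κ / 2 := hτ
  rw [← lintegral_add_compl _ hms, ← ENNReal.add_halves κ]
  exact add_le_add h1 h2

theorem sq_add_le_two (x y : ℝ) : (x + y) ^ 2 ≤ 2 * (x ^ 2 + y ^ 2) := by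
  nlinarith [sq_nonneg (x - y)]

theorem sq_add_add_le_three (x y z : ℝ) : (x + y + z) ^ 2 ≤ 3 * (x ^ 2 + y ^ 2 + z ^ 2) := by
  nlinarith [sq_nonneg (x - y), sq_nonneg (y - z), sq_nonneg (x - z)]

theorem sq_inv_sub_inv_le {ε a a' : ℝ} (hε : 0 < ε) (ha : a ∈ Set.Icc ε 1)
    (ha' : a' ∈ Set.Icc ε 1) : (a⁻¹ - a'⁻¹) ^ 2 ≤ ε⁻¹ ^ 4 * (a - a') ^ 2 := by
  have h1 : a ≠ 0 := (hε.trans_le ha.1).ne'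
  have h2 : a' ≠ 0 := (hε.trans_le ha'.1).ne'
  have h : a⁻¹ - a'⁻¹ = (a * a')⁻¹ * (a' - a) := by field_simp
  have hb := abs_inv_mul_inv_le hε ha ha'
  have hb2 : (a * a')⁻¹ ^ 2 ≤ (ε⁻¹ ^ 2) ^ 2 := sq_le_sq' (abs_le.1 hb).1 (abs_le.1 hb).2
  calc (a⁻¹ - a'⁻¹) ^ 2 = (a * a')⁻¹ ^ 2 * (a - a') ^ 2 := by rw [h]; ring
    _ ≤ (ε⁻¹ ^ 2) ^ 2 * (a - a') ^ 2 := by gcongr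
    _ = ε⁻¹ ^ 4 * (a - a') ^ 2 := by ring

theorem sq_le_of_mem_Icc {ε x : ℝ} (hε : 0 < ε) (hx : x ∈ Set.Icc ε 1) :
    (x⁻¹) ^ 2 ≤ ε⁻¹ ^ 2 := by
  have h := abs_inv_le_of_mem hε hx
  exact sq_le_sq' (abs_le.1 h).1 (abs_le.1 h).2

/-- Telescoping separates the error of `n` from the errors of the weights, which multiply the
residual `y - n'` of the reference parameter only. The powers `ε⁻⁴` and `ε⁻⁶` that arise are all
enlarged to `ε⁻⁸`. -/
theorem sq_labelled_term_le {ε a a' r r' : ℝ} (hε : 0 < ε) (hε1 : ε ≤ 1) (ha : a ∈ Set.Icc ε 1)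
    (ha' : a' ∈ Set.Icc ε 1) (hr : r ∈ Set.Icc ε 1) (hr' : r' ∈ Set.Icc ε 1) (y n n' : ℝ) :
    ((a * r)⁻¹ * (y - n) - (a' * r')⁻¹ * (y - n')) ^ 2
      ≤ ε⁻¹ ^ 8 * (2 * (n - n') ^ 2
        + 4 * (((a - a') ^ 2 + (r - r') ^ 2) * (y - n') ^ 2)) := by
  have hk : 1 ≤ ε⁻¹ := (one_le_inv₀ hε).2 hε1
  have e1 : (a * r)⁻¹ * (y - n) - (a' * r')⁻¹ * (y - n')
      = -((a⁻¹ * r⁻¹) * (n - n')) + (a⁻¹ * (r⁻¹ - r'⁻¹) + r'⁻¹ * (a⁻¹ - a'⁻¹)) * (y - n') := by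
    rw [mul_inv, mul_inv]; ring
  have b1 : (a⁻¹ * r⁻¹) ^ 2 ≤ ε⁻¹ ^ 8 := by
    calc (a⁻¹ * r⁻¹) ^ 2 = (a⁻¹) ^ 2 * (r⁻¹) ^ 2 := by ring
      _ ≤ ε⁻¹ ^ 2 * ε⁻¹ ^ 2 := by
        gcongr ?_ * ?_
        · exact sq_le_of_mem_Icc hε ha
        · exact sq_le_of_mem_Icc hε hr
      _ = ε⁻¹ ^ 4 := by ring
      _ ≤ ε⁻¹ ^ 8 := pow_le_pow_right₀ hk (by norm_num)
  have b2 : (a⁻¹ * (r⁻¹ - r'⁻¹) + r'⁻¹ * (a⁻¹ - a'⁻¹)) ^ 2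
      ≤ 2 * (ε⁻¹ ^ 8 * ((a - a') ^ 2 + (r - r') ^ 2)) := by
    calc (a⁻¹ * (r⁻¹ - r'⁻¹) + r'⁻¹ * (a⁻¹ - a'⁻¹)) ^ 2
        ≤ 2 * ((a⁻¹ * (r⁻¹ - r'⁻¹)) ^ 2 + (r'⁻¹ * (a⁻¹ - a'⁻¹)) ^ 2) := sq_add_le_two _ _
      _ = 2 * ((a⁻¹) ^ 2 * (r⁻¹ - r'⁻¹) ^ 2 + (r'⁻¹) ^ 2 * (a⁻¹ - a'⁻¹) ^ 2) := by ring
      _ ≤ 2 * (ε⁻¹ ^ 2 * (ε⁻¹ ^ 4 * (r - r') ^ 2) + ε⁻¹ ^ 2 * (ε⁻¹ ^ 4 * (a - a') ^ 2)) := by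
        gcongr 2 * (?_ * ?_ + ?_ * ?_)
        · exact sq_le_of_mem_Icc hε ha
        · exact sq_inv_sub_inv_le hε hr hr'
        · exact sq_le_of_mem_Icc hε hr'
        · exact sq_inv_sub_inv_le hε ha ha'
      _ = 2 * (ε⁻¹ ^ 6 * ((a - a') ^ 2 + (r - r') ^ 2)) := by ring
      _ ≤ 2 * (ε⁻¹ ^ 8 * ((a - a') ^ 2 + (r - r') ^ 2)) := by
        gcongr 2 * (?_ * _)
        exact pow_le_pow_right₀ hk (by norm_num)
  rw [e1]
  refine (sq_add_le_two _ _).trans ?_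
  rw [neg_sq, mul_pow, mul_pow (_ + _)]
  have c1 := mul_le_mul_of_nonneg_right b1 (sq_nonneg (n - n'))
  have c2 := mul_le_mul_of_nonneg_right b2 (sq_nonneg (y - n'))
  linarith

theorem sq_arm_term_le {ε a a' : ℝ} (hε : 0 < ε) (hε1 : ε ≤ 1) (ha : a ∈ Set.Icc ε 1)
    (ha' : a' ∈ Set.Icc ε 1) (n n' m m' : ℝ) :
    (a⁻¹ * (n - m) - a'⁻¹ * (n' - m')) ^ 2
      ≤ ε⁻¹ ^ 8 * (3 * (n - n') ^ 2 + 3 * (m - m') ^ 2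
        + 3 * ((a - a') ^ 2 * (n' - m') ^ 2)) := by
  have hk : 1 ≤ ε⁻¹ := (one_le_inv₀ hε).2 hε1
  have e1 : a⁻¹ * (n - m) - a'⁻¹ * (n' - m')
      = a⁻¹ * (n - n') + (-(a⁻¹ * (m - m'))) + (a⁻¹ - a'⁻¹) * (n' - m') := by ring
  have b1 : (a⁻¹) ^ 2 ≤ ε⁻¹ ^ 8 :=
    (sq_le_of_mem_Icc hε ha).trans (pow_le_pow_right₀ hk (by norm_num))
  have b2 : (a⁻¹ - a'⁻¹) ^ 2 ≤ ε⁻¹ ^ 8 * (a - a') ^ 2 := by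
    refine (sq_inv_sub_inv_le hε ha ha').trans ?_
    gcongr ?_ * _
    exact pow_le_pow_right₀ hk (by norm_num)
  rw [e1]
  refine (sq_add_add_le_three _ _ _).trans ?_
  rw [neg_sq, mul_pow, mul_pow, mul_pow (_ - _)]
  have c1 := mul_le_mul_of_nonneg_right b1 (sq_nonneg (n - n'))
  have c2 := mul_le_mul_of_nonneg_right b1 (sq_nonneg (m - m'))
  have c3 := mul_le_mul_of_nonneg_right b2 (sq_nonneg (n' - m'))
  linarith

end Truncation

/-! ### Mean square continuity of the score in the nuisance parameters. -/

section Continuity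

variable {dx ds : ℕ} {P : Measure (Full dx ds)} [IsProbabilityMeasure P] {ε : ℝ}
  {η η' : Nuisance dx ds}

/-- The squared residuals of `η`. -/
def residualSq (η : Nuisance dx ds) (t : Bool) (d : Full dx ds) : ℝ :=
  (labelledSet dx ds t).indicator (fun d => (Y d - η.muS t (X d) (S d)) ^ 2) d
    + (η.muS t (X d) (S d) - η.mu t (X d)) ^ 2

/-- The squared errors of the propensity scores. -/
def propensityErrorSq (η η' : Nuisance dx ds) (t : Bool) (d : Full dx ds) : ℝ :=
  (η.arm t (X d) - η'.arm t (X d)) ^ 2 + (η.r t (X d) (S d) - η'.r t (X d) (S d)) ^ 2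

/-- The worst case is a labelled unit of the arm, where three terms are split. The constant `15 = 3
· (2 + 3)` is the coefficient of the squared `μ̃` error, collected from the labelled and the arm
term; all other coefficients are smaller. -/
theorem sq_armScore_sub_le (hε : 0 < ε) (hε1 : ε ≤ 1) (t : Bool) (d : Full dx ds)
    (ha : η.arm t (X d) ∈ Set.Icc ε 1) (ha' : η'.arm t (X d) ∈ Set.Icc ε 1)
    (hr : T d = t → η.r t (X d) (S d) ∈ Set.Icc ε 1)
    (hr' : T d = t → η'.r t (X d) (S d) ∈ Set.Icc ε 1) :
    (armScore η t d - armScore η' t d) ^ 2 ≤ 15 * ε⁻¹ ^ 8 *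
      ((η.mu t (X d) - η'.mu t (X d)) ^ 2 + (armSet dx ds t).indicator (fun d =>
        (η.muS t (X d) (S d) - η'.muS t (X d) (S d)) ^ 2
          + propensityErrorSq η η' t d * residualSq η' t d) d) := by
  have hk : 1 ≤ ε⁻¹ ^ 8 := one_le_pow₀ ((one_le_inv₀ hε).2 hε1)
  set m := η.mu t (X d)
  set m' := η'.mu t (X d)
  set n := η.muS t (X d) (S d)
  set n' := η'.muS t (X d) (S d)
  set a := η.arm t (X d)
  set a' := η'.arm t (X d)
  set r := η.r t (X d) (S d)
  set r' := η'.r t (X d) (S d)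
  have k0 := mul_nonneg (sub_nonneg.2 hk) (sq_nonneg (m - m'))
  have k1 : 0 ≤ ε⁻¹ ^ 8 * (m - m') ^ 2 := by positivity
  by_cases hT : T d = t
  · have hA : d ∈ armSet dx ds t := hT
    have t2 := sq_arm_term_le hε hε1 ha ha' n n' m m'
    have p1 : 0 ≤ ε⁻¹ ^ 8 * (n - n') ^ 2 := by positivity
    have p2 : 0 ≤ ε⁻¹ ^ 8 * ((a - a') ^ 2 * (n' - m') ^ 2) := by positivity
    have p3 : 0 ≤ ε⁻¹ ^ 8 * ((r - r') ^ 2 * (n' - m') ^ 2) := by positivity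
    by_cases hR : R d = true
    · have hL : d ∈ labelledSet dx ds t := ⟨hT, hR⟩
      have t1 := sq_labelled_term_le hε hε1 ha ha' (hr hT) (hr' hT) (Y d) n n'
      have p4 : 0 ≤ ε⁻¹ ^ 8 * (((a - a') ^ 2 + (r - r') ^ 2) * (Y d - n') ^ 2) := by positivity
      have e : armScore η t d - armScore η' t d = (m - m')
          + ((a * r)⁻¹ * (Y d - n) - (a' * r')⁻¹ * (Y d - n'))
          + (a⁻¹ * (n - m) - a'⁻¹ * (n' - m')) := by
        simp only [armScore, Set.indicator_of_mem hL, Set.indicator_of_mem hA]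
        ring
      rw [e, Set.indicator_of_mem hA, residualSq, Set.indicator_of_mem hL, propensityErrorSq]
      refine (sq_add_add_le_three _ _ _).trans ?_
      linarith
    · have hL : d ∉ labelledSet dx ds t := fun h => hR h.2
      have e : armScore η t d - armScore η' t d = (m - m')
          + (a⁻¹ * (n - m) - a'⁻¹ * (n' - m')) := by
        simp only [armScore, Set.indicator_of_notMem hL, Set.indicator_of_mem hA]
        ring
      rw [e, Set.indicator_of_mem hA, residualSq, Set.indicator_of_notMem hL, propensityErrorSq]
      refine (sq_add_le_two _ _).trans ?_
      linarith
  · have hA : d ∉ armSet dx ds t := hT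
    have hL : d ∉ labelledSet dx ds t := fun h => hT h.1
    have e : armScore η t d - armScore η' t d = m - m' := by
      simp only [armScore, Set.indicator_of_notMem hL, Set.indicator_of_notMem hA]
      ring
    rw [e, Set.indicator_of_notMem hA]
    linarith

theorem measurable_propensityErrorSq (hη : η.IsMeasurable) (hη' : η'.IsMeasurable) (t : Bool) :
    Measurable (propensityErrorSq η η' t) :=
  (((hη.comp_arm t).sub (hη'.comp_arm t)).pow_const 2).add
    (((hη.comp_r t).sub (hη'.comp_r t)).pow_const 2)

theorem integrable_residualSq (h : PropensityBounded P ε (etaStar P)) (hε : 0 < ε)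
    (hε1 : ε ≤ 1) (hY : MemLp Y 2 P) (t : Bool) :
    Integrable (residualSq (etaStar P) t) (P.restrict (armSet dx ds t)) := by
  have hn := memLp_muS_arm h hε hε1 t hY
  have hm := (memLp_mu h hε hε1 t hY).restrict (armSet dx ds t)
  exact (((hY.restrict _).sub hn).integrable_sq.indicator (measurableSet_labelledSet t)).add
    (hn.sub hm).integrable_sq

omit [IsProbabilityMeasure P] in
theorem lintegral_sq_armScore_sub_le (hε : 0 < ε) (hε1 : ε ≤ 1) (t : Bool)
    (hη : η.IsMeasurable) (hη' : η'.IsMeasurable) (hb : PropensityBounded P ε η)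
    (hb' : PropensityBounded P ε η') :
    ∫⁻ d, ENNReal.ofReal ((armScore η t d - armScore η' t d) ^ 2) ∂P
      ≤ ENNReal.ofReal (15 * ε⁻¹ ^ 8) *
        (eLpNorm (fun d => η.mu t (X d) - η'.mu t (X d)) 2 P ^ 2 + (distMuS P η η' ^ 2
          + ∫⁻ d in armSet dx ds t, ENNReal.ofReal (propensityErrorSq η η' t d)
            * ENNReal.ofReal (residualSq η' t d) ∂P)) := by
  have hrr : ∀ {ζ : Nuisance dx ds}, PropensityBounded P ε ζ →
      ∀ᵐ d ∂P, T d = t → ζ.r t (X d) (S d) ∈ Set.Icc ε 1 := fun h => by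
    filter_upwards [h.r] with d hd hT
    rwa [hT] at hd
  have hres : ∀ d, 0 ≤ residualSq η' t d := fun d =>
    add_nonneg (Set.indicator_nonneg (fun _ _ => sq_nonneg _) _) (sq_nonneg _)
  have hpe : ∀ d, 0 ≤ propensityErrorSq η η' t d := fun d => add_nonneg (sq_nonneg _) (sq_nonneg _)
  have hmn : Measurable fun d => ENNReal.ofReal
      ((η.muS t (X d) (S d) - η'.muS t (X d) (S d)) ^ 2) :=
    (((hη.comp_muS t).sub (hη'.comp_muS t)).pow_const 2).ennreal_ofReal
  have hmm : Measurable fun d => ENNReal.ofReal ((η.mu t (X d) - η'.mu t (X d)) ^ 2) :=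
    (((hη.comp_mu t).sub (hη'.comp_mu t)).pow_const 2).ennreal_ofReal
  calc ∫⁻ d, ENNReal.ofReal ((armScore η t d - armScore η' t d) ^ 2) ∂P
      ≤ ∫⁻ d, ENNReal.ofReal (15 * ε⁻¹ ^ 8) *
        (ENNReal.ofReal ((η.mu t (X d) - η'.mu t (X d)) ^ 2)
          + (armSet dx ds t).indicator (fun d =>
            ENNReal.ofReal ((η.muS t (X d) (S d) - η'.muS t (X d) (S d)) ^ 2)
            + ENNReal.ofReal (propensityErrorSq η η' t d)
              * ENNReal.ofReal (residualSq η' t d)) d) ∂P := by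
        refine lintegral_mono_ae ?_
        filter_upwards [hb.arm hε t, hb'.arm hε t, hrr hb, hrr hb'] with d h1 h2 h3 h4
        refine (ENNReal.ofReal_le_ofReal (sq_armScore_sub_le hε hε1 t d h1 h2 h3 h4)).trans ?_
        rw [ENNReal.ofReal_mul (by positivity)]
        gcongr
        refine ENNReal.ofReal_add_le.trans ?_
        gcongr
        by_cases hA : d ∈ armSet dx ds t
        · rw [Set.indicator_of_mem hA, Set.indicator_of_mem hA,
            ENNReal.ofReal_add (sq_nonneg _) (mul_nonneg (hpe d) (hres d)),
            ENNReal.ofReal_mul (hpe d)]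
        · rw [Set.indicator_of_notMem hA, Set.indicator_of_notMem hA, ENNReal.ofReal_zero]
    _ = ENNReal.ofReal (15 * ε⁻¹ ^ 8) *
        (∫⁻ d, ENNReal.ofReal ((η.mu t (X d) - η'.mu t (X d)) ^ 2) ∂P
          + (∫⁻ d in armSet dx ds t,
            ENNReal.ofReal ((η.muS t (X d) (S d) - η'.muS t (X d) (S d)) ^ 2) ∂P
            + ∫⁻ d in armSet dx ds t, ENNReal.ofReal (propensityErrorSq η η' t d)
              * ENNReal.ofReal (residualSq η' t d) ∂P)) := by
        rw [lintegral_const_mul' _ _ ENNReal.ofReal_ne_top, lintegral_add_left hmm,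
          lintegral_indicator (measurableSet_armSet t), lintegral_add_left hmn]
    _ ≤ _ := by
        rw [← eLpNorm_two_sq, ← eLpNorm_two_sq]
        gcongr
        exact eLpNorm_muS_arm_le η η' t

omit [IsProbabilityMeasure P] in
theorem setLIntegral_propensityErrorSq_le (t : Bool) (hη : η.IsMeasurable)
    (hη' : η'.IsMeasurable) :
    ∫⁻ d in armSet dx ds t, ENNReal.ofReal (propensityErrorSq η η' t d) ∂P
      ≤ distE P η η' ^ 2 + distR P η η' ^ 2 := by
  have hma : Measurable fun d => ENNReal.ofReal ((η.arm t (X d) - η'.arm t (X d)) ^ 2) :=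
    (((hη.comp_arm t).sub (hη'.comp_arm t)).pow_const 2).ennreal_ofReal
  simp only [propensityErrorSq, ENNReal.ofReal_add (sq_nonneg _) (sq_nonneg _)]
  rw [lintegral_add_left hma, ← eLpNorm_two_sq, ← eLpNorm_two_sq, ← eLpNorm_arm_sub η η' t]
  gcongr
  · exact Measure.restrict_le_self
  · exact eLpNorm_r_arm_le η η' t

/-- Errors of `μ` and `μ̃` contribute their squared norms. The propensity errors multiply squared
residuals that are only integrable; as these weights are bounded and small in mean,
`exists_lintegral_mul_le` applies. -/
theorem exists_armScore_continuity (h : PropensityBounded P ε (etaStar P)) (hε : 0 < ε)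
    (hε1 : ε ≤ 1) (hY : MemLp Y 2 P) (t : Bool) {κ : ℝ≥0∞} (hκ : 0 < κ) (hκ' : κ ≠ ∞) :
    ∃ c : ℝ≥0∞, 0 < c ∧ ∀ η : Nuisance dx ds, η.IsMeasurable → PropensityBounded P ε η →
      distE P η (etaStar P) ≤ c → distR P η (etaStar P) ≤ c → distMu P η (etaStar P) ≤ c →
      distMuS P η (etaStar P) ≤ c →
      ∫⁻ d, ENNReal.ofReal ((armScore η t d - armScore (etaStar P) t d) ^ 2) ∂P ≤ κ := by
  have hs : (etaStar P).IsMeasurable := etaStar_isMeasurable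
  set A : ℝ≥0∞ := ENNReal.ofReal (15 * ε⁻¹ ^ 8) with hA
  have hA0 : A ≠ 0 := by simp [hA]; positivity
  have hAt : A ≠ ∞ := ENNReal.ofReal_ne_top
  -- One third each for the errors of `μ`, of `μ̃` and of the propensities, after division by the
  -- constant `A`.
  set κ' : ℝ≥0∞ := κ / A / 3 with hκ'def
  have hκ0 : 0 < κ' := ENNReal.div_pos (ENNReal.div_pos hκ.ne' hAt).ne' (by simp)
  have hκt : κ' ≠ ∞ := ENNReal.div_ne_top (ENNReal.div_ne_top hκ' hA0) (by simp)
  have hκA : A * (κ' + (κ' + κ')) = κ := by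
    have h3 : κ' + (κ' + κ') = κ / A := by
      rw [hκ'def, ← add_assoc, ENNReal.add_thirds]
    rw [h3, ENNReal.mul_div_cancel hA0 hAt]
  have hZ : ∫⁻ d, ENNReal.ofReal (residualSq (etaStar P) t d) ∂P.restrict (armSet dx ds t) ≠ ∞ := by
    have := (integrable_residualSq h hε hε1 hY t).lintegral_lt_top
    exact this.ne
  obtain ⟨δ, hδ, hδW⟩ := exists_lintegral_mul_le hZ hκ0 hκt
  set B : ℝ≥0∞ := ENNReal.ofReal ε⁻¹ with hB
  -- The factor `B = ε⁻¹` is the price of controlling the error of `μ` under `P` from one arm; `c ^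
  -- 2 + c ^ 2` bounds the mean squared errors of the two propensities.
  obtain ⟨c, hc0, hc1, hc2⟩ : ∃ c : ℝ≥0∞, 0 < c ∧ (B * c) ^ 2 + c ^ 2 ≤ κ' ∧ c ^ 2 + c ^ 2 ≤ δ := by
    have hlim : Tendsto (fun c : ℝ≥0∞ => (B * c) ^ 2 + c ^ 2) (𝓝 0) (𝓝 0) := by
      have h1 : Continuous fun c : ℝ≥0∞ => (B * c) ^ 2 + c ^ 2 :=
        ((ENNReal.continuous_pow 2).comp (ENNReal.continuous_const_mul ENNReal.ofReal_ne_top)).add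
          (ENNReal.continuous_pow 2)
      simpa using h1.tendsto 0
    have hlim2 : Tendsto (fun c : ℝ≥0∞ => c ^ 2 + c ^ 2) (𝓝 0) (𝓝 0) := by
      have h1 : Continuous fun c : ℝ≥0∞ => c ^ 2 + c ^ 2 := 
        (ENNReal.continuous_pow 2).add (ENNReal.continuous_pow 2)
      simpa using h1.tendsto 0
    have hev := (hlim.eventually (ge_mem_nhds hκ0)).and (hlim2.eventually (ge_mem_nhds hδ))
    obtain ⟨b, hb0, hb⟩ := ENNReal.nhds_zero_basis.eventually_iff.1 hev
    obtain ⟨c, hc0, hcb⟩ := exists_between hb0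
    exact ⟨c, hc0, hb hcb⟩
  refine ⟨c, hc0, fun η hη hb he hr hmu hmuS => ?_⟩
  refine (lintegral_sq_armScore_sub_le hε hε1 t hη hs hb h).trans ?_
  rw [← hκA]
  have hm : eLpNorm (fun d => η.mu t (X d) - (etaStar P).mu t (X d)) 2 P ≤ B * c :=
    (eLpNorm_le_arm h hε hε1 t ((hη.mu t).sub (hs.mu t))).trans
      (mul_le_mul_right ((eLpNorm_mu_arm_le η (etaStar P) t).trans hmu) _)
  gcongr A * (?_ + (?_ + ?_))
  · exact (pow_le_pow_left' hm 2).trans (le_self_add.trans hc1)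
  · exact (pow_le_pow_left' hmuS 2).trans (le_add_self.trans hc1)
  · refine hδW _ (measurable_propensityErrorSq hη hs t).ennreal_ofReal ?_ ?_
    · filter_upwards [ae_restrict_of_ae (hb.arm hε t), ae_restrict_of_ae (h.arm hε t),
        hb.r_arm t, h.r_arm t] with d h1 h2 h3 h4
      -- All propensities lie in `[ε, 1]`, so each squared difference is at most `1`; together they
      -- respect the required bound `2`.
      have e1 : (η.arm t (X d) - (etaStar P).arm t (X d)) ^ 2 ≤ 1 := by
        rw [sq_le_one_iff_abs_le_one, abs_le]
        constructor <;> linarith [h1.1, h1.2, h2.1, h2.2]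
      have e2 : (η.r t (X d) (S d) - (etaStar P).r t (X d) (S d)) ^ 2 ≤ 1 := by
        rw [sq_le_one_iff_abs_le_one, abs_le]
        constructor <;> linarith [h3.1, h3.2, h4.1, h4.2]
      rw [← ENNReal.ofReal_ofNat]
      refine ENNReal.ofReal_le_ofReal ?_
      rw [propensityErrorSq]
      linarith
    · refine (setLIntegral_propensityErrorSq_le t hη hs).trans ?_
      exact (add_le_add (pow_le_pow_left' he 2) (pow_le_pow_left' hr 2)).trans hc2

/-- The score depends continuously, in mean square, on the nuisance parameters. -/
theorem exists_score_continuity (h : PropensityBounded P ε (etaStar P)) (hε : 0 < ε)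
    (hε1 : ε ≤ 1) (hY : MemLp Y 2 P) {κ : ℝ≥0∞} (hκ : 0 < κ) (hκ' : κ ≠ ∞) :
    ∃ c : ℝ≥0∞, 0 < c ∧ ∀ η : Nuisance dx ds, η.IsMeasurable → PropensityBounded P ε η →
      distE P η (etaStar P) ≤ c → distR P η (etaStar P) ≤ c → distMu P η (etaStar P) ≤ c →
      distMuS P η (etaStar P) ≤ c →
      ∫⁻ d, ENNReal.ofReal ((score η (observe d) - score (etaStar P) (observe d)) ^ 2) ∂P
        ≤ κ := by
  -- One halving for the two arms, another for the factor `2` in `(x + y)² ≤ 2 (x² + y²)`.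
  have hq : 0 < κ / 2 / 2 := ENNReal.half_pos (ENNReal.half_pos hκ.ne').ne'
  have hq' : κ / 2 / 2 ≠ ∞ := ENNReal.div_ne_top (ENNReal.div_ne_top hκ' (by simp)) (by simp)
  obtain ⟨c1, hc1, h1⟩ := exists_armScore_continuity h hε hε1 hY true hq hq'
  obtain ⟨c0, hc0, h0⟩ := exists_armScore_continuity h hε hε1 hY false hq hq'
  refine ⟨min c1 c0, lt_min hc1 hc0, fun η hη hb he hr hmu hmuS => ?_⟩
  have b1 := h1 η hη hb (he.trans (min_le_left _ _)) (hr.trans (min_le_left _ _))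
    (hmu.trans (min_le_left _ _)) (hmuS.trans (min_le_left _ _))
  have b0 := h0 η hη hb (he.trans (min_le_right _ _)) (hr.trans (min_le_right _ _))
    (hmu.trans (min_le_right _ _)) (hmuS.trans (min_le_right _ _))
  have hm : ∀ t, Measurable fun d =>
      ENNReal.ofReal ((armScore η t d - armScore (etaStar P) t d) ^ 2) := fun t =>
    (((measurable_armScore hη t).sub (measurable_armScore etaStar_isMeasurable t)).pow_const
      2).ennreal_ofReal
  calc ∫⁻ d, ENNReal.ofReal ((score η (observe d) - score (etaStar P) (observe d)) ^ 2) ∂P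
      ≤ ∫⁻ d, 2 * (ENNReal.ofReal ((armScore η true d - armScore (etaStar P) true d) ^ 2)
        + ENNReal.ofReal ((armScore η false d - armScore (etaStar P) false d) ^ 2)) ∂P := by
        refine lintegral_mono fun d => ?_
        rw [← ENNReal.ofReal_add (sq_nonneg _) (sq_nonneg _), ← ENNReal.ofReal_ofNat 2,
          ← ENNReal.ofReal_mul (by norm_num)]
        refine ENNReal.ofReal_le_ofReal ?_
        rw [score_observe, score_observe]
        have := sq_add_le_two (armScore η true d - armScore (etaStar P) true d)
          (-(armScore η false d - armScore (etaStar P) false d))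
        rw [neg_sq] at this
        refine le_trans (le_of_eq ?_) this
        ring
    _ = 2 * (∫⁻ d, ENNReal.ofReal ((armScore η true d - armScore (etaStar P) true d) ^ 2) ∂P
        + ∫⁻ d, ENNReal.ofReal ((armScore η false d - armScore (etaStar P) false d) ^ 2) ∂P) := by
        rw [lintegral_const_mul' _ _ (by simp), lintegral_add_left (hm true)]
    _ ≤ 2 * (κ / 2 / 2 + κ / 2 / 2) := by gcongr
    _ = κ := by rw [ENNReal.add_halves, ENNReal.mul_div_cancel (by simp) (by simp)]

/-- The score at the truth has a finite second moment. -/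
theorem memLp_score_etaStar (h : PropensityBounded P ε (etaStar P)) (hε : 0 < ε)
    (hε1 : ε ≤ 1) (hY : MemLp Y 2 P) :
    MemLp (fun d => score (etaStar P) (observe d)) 2 P := by
  have hs : (etaStar P).IsMeasurable := etaStar_isMeasurable
  have harm : ∀ t, MemLp (armScore (etaStar P) t) 2 P := by
    intro t
    have hm := memLp_mu h hε hε1 t hY
    have hn := memLp_muS_arm h hε hε1 t hY
    have hnL := hn.mono_measure
      (Measure.restrict_mono (μ := P) (labelledSet_subset (dx := dx) (ds := ds) t) le_rfl)
    refine (hm.add ((memLp_indicator_iff_restrict (measurableSet_labelledSet t)).2 ?_)).add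
      ((memLp_indicator_iff_restrict (measurableSet_armSet t)).2 ?_)
    · refine MemLp.of_le_mul (c := ε⁻¹ ^ 2) ((hY.restrict _).sub hnL)
        (((hs.comp_arm t).mul (hs.comp_r t)).inv.mul
          (measurable_Y.sub (hs.comp_muS t))).aestronglyMeasurable ?_
      filter_upwards [ae_restrict_of_ae (h.arm hε t), ae_labelled_of_arm (h.r_arm t)] with d h1 h2
      rw [norm_mul]
      gcongr
      · exact abs_inv_mul_inv_le hε h1 h2
      · exact le_rfl
    · refine MemLp.of_le_mul (c := ε⁻¹) (hn.sub (hm.restrict _))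
        ((hs.comp_arm t).inv.mul ((hs.comp_muS t).sub (hs.comp_mu t))).aestronglyMeasurable ?_
      filter_upwards [ae_restrict_of_ae (h.arm hε t)] with d h1
      rw [norm_mul]
      gcongr
      · exact abs_inv_le_of_mem hε h1
      · exact le_rfl
  simp only [score_observe]
  exact (harm true).sub (harm false)

end Continuity

end

end SurrogateATE

namespace SurrogateATE
noncomputable section

/-! ### From deterministic bounds off small events to stochastic orders. -/

section StochasticOrder

variable {Ω : Type*} [MeasurableSpace Ω] {μ : Measure Ω}

/-- `Z = o_p(1)` if off events of vanishing probability it is dominated by random variables of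
arbitrarily small mean. -/
theorem isLittleOP_of_lintegral_off {Z : ℕ → Ω → ℝ}
    (h : ∀ c : ℝ≥0∞, 0 < c → c ≠ ∞ → ∃ (A : ℕ → Set Ω) (Z' : ℕ → Ω → ℝ≥0∞),
      (∀ ε : ℝ≥0∞, 0 < ε → ∀ᶠ N in atTop, μ (A N) ≤ ε) ∧ (∀ N, AEMeasurable (Z' N) μ) ∧
      (∀ᶠ N in atTop, ∫⁻ ω, Z' N ω ∂μ ≤ c) ∧
      ∀ N, ∀ ω ∉ A N, ENNReal.ofReal |Z N ω| ≤ Z' N ω) : IsLittleOP μ Z := by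
  intro t ht ε hε
  have ht' : ENNReal.ofReal t ≠ 0 := by simpa using ht
  -- Chosen so that Markov's inequality at level `t` gives `ε / 2`; the minimum with `1` keeps `c`
  -- finite.
  set c : ℝ≥0∞ := ENNReal.ofReal t * (min ε 1 / 2) with hc
  have hε1 : min ε 1 ≠ ∞ := ((min_le_right _ _).trans_lt ENNReal.one_lt_top).ne
  have hε0 : 0 < min ε 1 := lt_min hε one_pos
  have hc0 : 0 < c := ENNReal.mul_pos ht' (ENNReal.half_pos hε0.ne').ne'
  have hct : c ≠ ∞ := ENNReal.mul_ne_top ENNReal.ofReal_ne_top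
    (ENNReal.div_ne_top hε1 two_ne_zero)
  obtain ⟨A, Z', hA, hm, hint, hle⟩ := h c hc0 hct
  filter_upwards [hA (min ε 1 / 2) (ENNReal.half_pos hε0.ne'), hint] with N h1 h2
  refine le_trans ?_ (min_le_left ε 1)
  refine measure_le_of_subset_union (B := A N) (C := {ω | ENNReal.ofReal t ≤ Z' N ω})
    (fun ω hω => ?_) h1 ?_
  · by_cases hωA : ω ∈ A N
    · exact Or.inl hωA
    · exact Or.inr ((ENNReal.ofReal_le_ofReal hω).trans (hle N ω hωA))
  · refine (meas_ge_le_lintegral_div (hm N) ht' ENNReal.ofReal_ne_top).trans ?_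
    rw [ENNReal.div_le_iff ht' ENNReal.ofReal_ne_top, mul_comm]
    exact h2

theorem IsLittleOP.of_sq {Z : ℕ → Ω → ℝ} (h : IsLittleOP μ fun N ω => Z N ω ^ 2) :
    IsLittleOP μ Z :=
  h.sqrt.of_le (Eventually.of_forall fun N => ae_of_all _ fun ω => by
    rw [Real.sqrt_sq_eq_abs, abs_abs])

theorem exists_ofReal_le {ε : ℝ≥0∞} (hε : 0 < ε) : ∃ δ : ℝ, 0 < δ ∧ ENNReal.ofReal δ ≤ ε := by
  have h1 : min ε 1 ≠ ∞ := ((min_le_right _ _).trans_lt ENNReal.one_lt_top).ne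
  refine ⟨(min ε 1).toReal, ENNReal.toReal_pos (lt_min hε one_pos).ne' h1, ?_⟩
  rw [ENNReal.ofReal_toReal h1]
  exact min_le_left _ _

theorem IsBigOp.isBoundedP {Z : ℕ → Ω → ℝ} {a : ℕ → ℝ}
    (h : IsBigOp μ (fun N ω => ENNReal.ofReal |Z N ω|) a) (ha : ∀ᶠ N in atTop, 0 < a N) :
    IsBoundedP μ fun N ω => (a N)⁻¹ * Z N ω := by
  intro ε hε
  obtain ⟨δ, hδ, hδε⟩ := exists_ofReal_le hε
  obtain ⟨M, hM, h⟩ := h δ hδ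
  -- `IsBigOp` bounds strict exceedances, `IsBoundedP` weak ones; enlarging `M` bridges the gap.
  refine ⟨M + 1, by positivity, ?_⟩
  filter_upwards [h, ha] with N h1 h2
  refine (measure_mono fun ω hω => ?_).trans (h1.trans hδε)
  simp only [Set.mem_ofPred_eq, abs_mul, abs_inv, abs_of_pos h2] at hω ⊢
  rw [inv_mul_eq_div, le_div_iff₀ h2] at hω
  have h3 : M * a N < |Z N ω| := by nlinarith
  exact (ENNReal.ofReal_lt_ofReal_iff (lt_of_le_of_lt (by positivity) h3)).2 h3

theorem IsBigOp.mul {Z W : ℕ → Ω → ℝ≥0∞} {a b : ℕ → ℝ} (hZ : IsBigOp μ Z a)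
    (hW : IsBigOp μ W b) (ha : ∀ N, 0 < a N) :
    IsBigOp μ (fun N ω => Z N ω * W N ω) fun N => a N * b N := by
  intro ε hε
  obtain ⟨M, hM, h⟩ := hZ (ε / 2) (half_pos hε)
  obtain ⟨M', hM', h'⟩ := hW (ε / 2) (half_pos hε)
  refine ⟨M * M', by positivity, ?_⟩
  filter_upwards [h, h'] with N h1 h2
  have h3 : ENNReal.ofReal (ε / 2) = ENNReal.ofReal ε / 2 := by
    rw [ENNReal.ofReal_div_of_pos two_pos]; simp
  refine measure_le_of_subset_union (fun ω hω => ?_) (h1.trans_eq h3) (h2.trans_eq h3)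
  by_contra hcon
  simp only [Set.mem_union, Set.mem_ofPred_eq, not_or, not_lt] at hcon hω
  refine absurd (mul_le_mul' hcon.1 hcon.2) (not_le.2 ?_)
  rw [← ENNReal.ofReal_mul (by have := ha N; positivity)]
  convert hω using 2
  ring

theorem IsBigOp.measure_lt_le {Z : ℕ → Ω → ℝ≥0∞} {a : ℕ → ℝ} (hZ : IsBigOp μ Z a)
    (ha : Tendsto a atTop (𝓝 0)) {c : ℝ≥0∞} (hc : 0 < c) {ε : ℝ≥0∞} (hε : 0 < ε) :
    ∀ᶠ N in atTop, μ {ω | c < Z N ω} ≤ ε := by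
  obtain ⟨δ, hδ, hδε⟩ := exists_ofReal_le hε
  obtain ⟨γ, hγ, hγc⟩ := exists_ofReal_le hc
  obtain ⟨M, hM, h⟩ := hZ δ hδ
  have hlim : Tendsto (fun N => M * a N) atTop (𝓝 0) := by simpa using ha.const_mul M
  filter_upwards [h, hlim.eventually (gt_mem_nhds hγ)] with N h1 h2
  refine (measure_mono fun ω hω => ?_).trans (h1.trans hδε)
  exact ((ENNReal.ofReal_le_ofReal h2.le).trans hγc).trans_lt hω

theorem IsBigOp.isLittleOP_mul {W : ℕ → Ω → ℝ≥0∞} {a : ℕ → ℝ} {c : ℕ → ℝ} (hW : IsBigOp μ W a)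
    (hca : Tendsto (fun N => c N * a N) atTop (𝓝 0)) (hc : ∀ N, 0 ≤ c N) :
    IsLittleOP μ fun N ω => c N * (W N ω).toReal := by
  intro t ht ε hε
  obtain ⟨δ, hδ, hδε⟩ := exists_ofReal_le hε
  obtain ⟨M, hM, h⟩ := hW δ hδ
  have hlim : Tendsto (fun N => M * (c N * a N)) atTop (𝓝 0) := by simpa using hca.const_mul M
  filter_upwards [h, hlim.eventually (gt_mem_nhds ht)] with N h1 h2
  refine (measure_mono fun ω hω => ?_).trans (h1.trans hδε)
  simp only [Set.mem_ofPred_eq] at hω ⊢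
  rw [abs_of_nonneg (mul_nonneg (hc N) ENNReal.toReal_nonneg)] at hω
  by_contra hcon
  rw [not_lt] at hcon
  have hpos : 0 < (W N ω).toReal := by
    by_contra h0
    have : (W N ω).toReal = 0 := le_antisymm (not_lt.1 h0) ENNReal.toReal_nonneg
    rw [this, mul_zero] at hω
    exact absurd ht (not_lt.2 hω)
  have h4 : 0 < M * a N := by
    by_contra h0
    rw [ENNReal.ofReal_of_nonpos (not_lt.1 h0)] at hcon
    rw [le_antisymm hcon (zero_le)] at hpos
    simp at hpos
  have h3 : (W N ω).toReal ≤ M * a N := ENNReal.toReal_le_of_le_ofReal h4.le hcon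
  nlinarith [mul_le_mul_of_nonneg_left h3 (hc N)]

end StochasticOrder

/-! ### Integrals under `P` and under the label laws. -/

section IntegralBound

variable {α : Type*} [MeasurableSpace α]

theorem sq_enorm_integral_le (Q : Measure α) [IsProbabilityMeasure Q] {f : α → ℝ}
    (hf : Measurable f) : ‖∫ a, f a ∂Q‖ₑ ^ 2 ≤ ∫⁻ a, ENNReal.ofReal (f a ^ 2) ∂Q := by
  rw [← eLpNorm_two_sq]
  gcongr
  refine (enorm_integral_le_lintegral_enorm f).trans ?_
  rw [← eLpNorm_one_eq_lintegral_enorm]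
  exact eLpNorm_le_eLpNorm_of_exponent_le one_le_two hf.aestronglyMeasurable

theorem integrable_of_lintegral_sq_ne_top (Q : Measure α) [IsProbabilityMeasure Q] {f : α → ℝ}
    (hf : Measurable f) (h : ∫⁻ a, ENNReal.ofReal (f a ^ 2) ∂Q ≠ ∞) : Integrable f Q := by
  refine MemLp.integrable (q := 2) one_le_two ⟨hf.aestronglyMeasurable, ?_⟩
  rw [← eLpNorm_two_sq] at h
  rw [lt_top_iff_ne_top]
  rintro h0
  rw [h0] at h
  simp at h

theorem integral_eq_sum_labelLaw (P : Measure α) [IsProbabilityMeasure P] {lab : α → Bool}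
    (hlab : Measurable lab) {f : α → ℝ} (hf : Integrable f P) :
    ∫ a, f a ∂P = ∑ b, P.real {a | lab a = b} * ∫ a, f a ∂labelLaw P lab b := by
  have h1 : ∀ b, ∫ a in {a | lab a = b}, f a ∂P
      = P.real {a | lab a = b} * ∫ a, f a ∂labelLaw P lab b := by
    intro b
    rw [restrict_label_eq, integral_smul_measure]
    rfl
  have hms : MeasurableSet {a | lab a = true} := hlab (measurableSet_singleton true)
  have hcompl : {a | lab a = true}ᶜ = {a | lab a = false} := by
    ext a
    simp
  rw [Fintype.sum_bool, ← h1, ← h1, ← hcompl, integral_add_compl hms hf]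

end IntegralBound

/-! ### Sums over folds that may depend on the labels. -/

section Folds

variable {dx ds K : ℕ} {Ω 𝒰 : Type*} [MeasurableSpace Ω] [MeasurableSpace 𝒰] {μ : Measure Ω}
  [IsProbabilityMeasure μ] {P : Measure (Full dx ds)} [IsProbabilityMeasure P]
  {D : ℕ → Ω → Full dx ds} {F : FoldRule K 𝒰} {U : ℕ → Ω → 𝒰}

/-- The random sample of the first `N` units. -/
abbrev sampleAt (D : ℕ → Ω → Full dx ds) (F : FoldRule K 𝒰) (U : ℕ → Ω → 𝒰) (N : ℕ) (ω : Ω) :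
    Sample dx ds K N :=
  drawSample F (fun i => D i ω) (U N ω) N

theorem Design.lintegral_sq_sum_le (h : Design μ P D F U) (N : ℕ) {g : Full dx ds → ℝ}
    (hg : Measurable g) {B : ℝ≥0∞} (hBtop : B ≠ ∞)
    (hB : ∫⁻ d, ENNReal.ofReal (g d ^ 2) ∂P ≤ B) :
    ∫⁻ ω, ENNReal.ofReal ((∑ i : Fin N, (g (D i ω) - ∫ d, g d ∂P)) ^ 2) ∂μ ≤ N * B := by
  have hm : Measurable fun x : Fin N → Full dx ds =>
      ENNReal.ofReal ((∑ i : Fin N, (g (x i) - ∫ d, g d ∂P)) ^ 2) :=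
    ((Finset.measurable_fun_sum _ fun i _ =>
      (hg.comp (measurable_pi_apply i)).sub_const _).pow_const 2).ennreal_ofReal
  have h1 := lintegral_sq_sum_sub_integral_le (fun _ : Fin N => P) Finset.univ (fun _ => g)
    (fun _ => hg) hBtop fun _ => hB
  rw [← h.map_units N, lintegral_map hm
    (measurable_pi_lambda _ fun i => h.measurable_unit i)] at h1
  simpa using h1

theorem natCast_mul_ofReal_inv_le (N : ℕ) : (N : ℝ≥0∞) * ENNReal.ofReal ((N : ℝ)⁻¹) ≤ 1 := by
  rcases Nat.eq_zero_or_pos N with rfl | hN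
  · simp
  · rw [← ENNReal.ofReal_natCast, ← ENNReal.ofReal_mul (by positivity),
      mul_inv_cancel₀ (by positivity)]
    simp

omit [IsProbabilityMeasure μ] in
/-- Rescaling a second moment bound that is linear in the sample size. -/
theorem lintegral_sq_inv_sqrt_mul_le {f : Ω → ℝ} {N : ℕ} {B : ℝ≥0∞}
    (h : ∫⁻ ω, ENNReal.ofReal (f ω ^ 2) ∂μ ≤ N * B) :
    ∫⁻ ω, ENNReal.ofReal (((√(N : ℝ))⁻¹ * f ω) ^ 2) ∂μ ≤ B := by
  have h1 : ∀ ω, ENNReal.ofReal (((√(N : ℝ))⁻¹ * f ω) ^ 2)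
      = ENNReal.ofReal ((N : ℝ)⁻¹) * ENNReal.ofReal (f ω ^ 2) := by
    intro ω
    rw [mul_pow, inv_pow, Real.sq_sqrt (Nat.cast_nonneg N), ENNReal.ofReal_mul (by positivity)]
  simp_rw [h1]
  rw [lintegral_const_mul' _ _ ENNReal.ofReal_ne_top]
  calc ENNReal.ofReal ((N : ℝ)⁻¹) * ∫⁻ ω, ENNReal.ofReal (f ω ^ 2) ∂μ
      ≤ ENNReal.ofReal ((N : ℝ)⁻¹) * (N * B) := by gcongr
    _ = (N * ENNReal.ofReal ((N : ℝ)⁻¹)) * B := by ring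
    _ ≤ 1 * B := by gcongr; exact natCast_mul_ofReal_inv_le N
    _ = B := one_mul B

/-- Two fluctuations of order `√N` add up: of the count in the fold around an even share, by design,
and of the total label count around its mean, by Chebyshev. -/
theorem Design.isBoundedP_foldLabelCount (h : Design μ P D F U) (k : Fin K) (b : Bool) :
    IsBoundedP μ fun N ω => (√(N : ℝ))⁻¹ * ((sampleAt D F U N ω).foldLabelCount k b
      - N * P.real {d | R d = b} / K) := by
  have h1 := (h.even k b).isBoundedP (by
    filter_upwards [eventually_gt_atTop 0] with N hN
    positivity)
  have hms : MeasurableSet {d : Full dx ds | R d = b} := measurable_R (measurableSet_singleton b)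
  have h2 : IsBoundedP μ fun N ω => (√(N : ℝ))⁻¹ * ∑ i : Fin N,
      ({d : Full dx ds | R d = b}.indicator 1 (D i ω)
        - ∫ d, {d : Full dx ds | R d = b}.indicator (1 : Full dx ds → ℝ) d ∂P) := by
    refine isBoundedP_of_lintegral_sq (B := 1) ENNReal.one_ne_top (fun N => ?_)
      (Eventually.of_forall fun N => lintegral_sq_inv_sqrt_mul_le
        (h.lintegral_sq_sum_le N (measurable_one.indicator hms) ENNReal.one_ne_top ?_))
    · refine (Measurable.const_mul ?_ _).aemeasurable
      exact Finset.measurable_fun_sum _ fun i _ =>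
        ((measurable_one.indicator hms).comp (h.measurable_unit i)).sub_const _
    · calc ∫⁻ d, ENNReal.ofReal ({d : Full dx ds | R d = b}.indicator (1 : Full dx ds → ℝ) d ^ 2) ∂P
          ≤ ∫⁻ _, 1 ∂P := by
            refine lintegral_mono fun d => ?_
            by_cases hd : R d = b <;> simp [Set.indicator, hd]
        _ = 1 := by simp
  refine (h1.add (h2.mul (isBoundedP_const (K : ℝ)⁻¹))).of_le
    (Eventually.of_forall fun N => ae_of_all _ fun ω => le_of_eq ?_)
  congr 1
  have h3 : ∫ d, {d : Full dx ds | R d = b}.indicator (1 : Full dx ds → ℝ) d ∂P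
      = P.real {d | R d = b} := integral_indicator_one hms
  have h4 : ((sampleAt D F U N ω).labelCount b : ℝ)
      = ∑ i : Fin N, {d : Full dx ds | R d = b}.indicator (1 : Full dx ds → ℝ) (D i ω) := by
    simp only [Sample.labelCount, Finset.card_filter, Set.indicator, Set.mem_ofPred_eq,
      Pi.one_apply, Nat.cast_sum, Nat.cast_ite, Nat.cast_one, Nat.cast_zero]
    rfl
  rw [h3, Finset.sum_sub_distrib, ← h4]
  simp only [Finset.sum_const, Finset.card_univ, Fintype.card_fin, nsmul_eq_mul]
  ring

theorem Sample.sum_foldLabelCount {N : ℕ} (s : Sample dx ds K N) (k : Fin K) :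
    ∑ b, s.foldLabelCount k b = (s.foldSet k).card :=
  (Finset.card_eq_sum_card_fiberwise fun _ _ => Finset.mem_coe.2 (Finset.mem_univ _)).symm

theorem Sample.sum_foldSet_label {N : ℕ} (s : Sample dx ds K N) (k : Fin K) (m : Bool → ℝ) :
    ∑ i ∈ s.foldSet k, m (R (s.unit i)) = ∑ b, s.foldLabelCount k b * m b := by
  rw [← Finset.sum_fiberwise (s.foldSet k) fun i => R (s.unit i)]
  refine Finset.sum_congr rfl fun b _ => ?_
  rw [Finset.sum_congr rfl (g := fun _ => m b) fun i hi => by rw [(Finset.mem_filter.1 hi).2]]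
  simp [Sample.foldLabelCount]

/-- Centering at label-conditional means `m_b` gives an `O_p(√N)` sum. The rest is `∑_b n_{k,b}
m_b`, also `O_p(√N)`, because `∑_b P(R = b) m_b = ∫ f = 0` lets the counts be centered for free. -/
theorem Design.isLittleOP_foldMean_of_fixed (h : Design μ P D F U) (k : Fin K)
    {f : Full dx ds → ℝ} (hf : Measurable f) (hf2 : ∫⁻ d, ENNReal.ofReal (f d ^ 2) ∂P ≠ ∞)
    (hf0 : ∫ d, f d ∂P = 0) :
    IsLittleOP μ fun N ω => (N : ℝ)⁻¹ * ∑ i ∈ (sampleAt D F U N ω).foldSet k, f (D i ω) := by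
  obtain ⟨M, hM, hle⟩ := exists_labelLaw_le P (R : Full dx ds → Bool)
  set B : ℝ≥0∞ := M * ∫⁻ d, ENNReal.ofReal (f d ^ 2) ∂P with hBdef
  have hB : ∀ b, ∫⁻ d, ENNReal.ofReal (f d ^ 2) ∂labelLaw P R b ≤ B := fun b =>
    (lintegral_mono' (hle b) le_rfl).trans_eq (by rw [lintegral_smul_measure, smul_eq_mul])
  have hBt : B ≠ ∞ := ENNReal.mul_ne_top hM hf2
  set m : Bool → ℝ := fun b => ∫ d, f d ∂labelLaw P R b with hm
  have hZ : IsBoundedP μ fun N ω => (√(N : ℝ))⁻¹ *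
      ∑ i ∈ (sampleAt D F U N ω).foldSet k, (f (D i ω) - m (R (D i ω))) := by
    refine isBoundedP_of_lintegral_sq hBt (fun N => (Measurable.const_mul ?_ _).aemeasurable)
      (Eventually.of_forall fun N => lintegral_sq_inv_sqrt_mul_le
        (h.lintegral_sq_foldSum_le N k (fun _ _ => f) (fun _ => hf.comp measurable_snd) hBt
          fun _ _ => hB))
    refine h.measurable_statistic N (G := fun s : Sample dx ds K N =>
      ∑ i ∈ s.foldSet k, (f (s.unit i) - m (R (s.unit i)))) fun a => ?_
    set J : Finset (Fin N) := Finset.univ.filter fun i => a i = k with hJ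
    change Measurable fun x : Fin N → Full dx ds => ∑ i ∈ J, (f (x i) - m (R (x i)))
    have hmR : Measurable fun d : Full dx ds => m (R d) :=
      (Measurable.of_discrete (f := m)).comp measurable_R
    exact Finset.measurable_fun_sum _ fun i _ =>
      (hf.sub hmR).comp (measurable_pi_apply (X := fun _ => Full dx ds) i)
  have hlim : IsLittleOP μ fun N _ => (√(N : ℝ))⁻¹ :=
    isLittleOP_of_tendsto (tendsto_inv_atTop_zero.comp
      (Real.tendsto_sqrt_atTop.comp tendsto_natCast_atTop_atTop))
  have h0 : ∑ b, P.real {d | R d = b} * m b = 0 := by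
    rw [← hf0]
    exact (integral_eq_sum_labelLaw P measurable_R
      (integrable_of_lintegral_sq_ne_top P hf hf2)).symm
  have hC : IsBoundedP μ fun N ω => ∑ b, ((√(N : ℝ))⁻¹ *
      ((sampleAt D F U N ω).foldLabelCount k b - N * P.real {d | R d = b} / K)) * m b :=
    IsBoundedP.sum _ fun b _ => (h.isBoundedP_foldLabelCount k b).mul (isBoundedP_const (m b))
  refine (hlim.mul_isBoundedP (hZ.add hC)).congr fun N ω => ?_
  have hs : (N : ℝ)⁻¹ = (√(N : ℝ))⁻¹ * (√(N : ℝ))⁻¹ := by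
    rw [← mul_inv, Real.mul_self_sqrt (Nat.cast_nonneg N)]
  have h1 := (sampleAt D F U N ω).sum_foldSet_label k m
  have h2 : ∑ b, (((sampleAt D F U N ω).foldLabelCount k b : ℝ)
      - N * P.real {d | R d = b} / K) * m b
      = ∑ i ∈ (sampleAt D F U N ω).foldSet k, m (R (D i ω)) := by
    refine Eq.trans ?_ h1.symm
    have h3 : ∀ b : Bool, N * P.real {d : Full dx ds | R d = b} / K * m b
        = N / K * (P.real {d : Full dx ds | R d = b} * m b) := fun b => by ring
    simp_rw [sub_mul, Finset.sum_sub_distrib, h3, ← Finset.mul_sum, h0]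
    simp
  simp_rw [mul_assoc, ← Finset.mul_sum]
  rw [h2, Finset.sum_sub_distrib, hs]
  ring

/-- The `L²(P)` norm, given the training data of the `k`-th fold, of a function computed from
these data vanishes in probability. -/
def VanishingL2 (μ : Measure Ω) (P : Measure (Full dx ds)) (D : ℕ → Ω → Full dx ds)
    (F : FoldRule K 𝒰) (U : ℕ → Ω → 𝒰) (k : Fin K)
    (g : (N : ℕ) → (J : Finset (Fin N)) → (J → Obs dx ds) → Full dx ds → ℝ) : Prop :=
  ∀ κ : ℝ≥0∞, 0 < κ → ∀ ε : ℝ≥0∞, 0 < ε → ∀ᶠ N in atTop,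
    μ {ω | κ < ∫⁻ d, ENNReal.ofReal (g N _ ((sampleAt D F U N ω).train k) d ^ 2) ∂P} ≤ ε

open Classical in
/-- The function computed from the training data, replaced by zero if its `L²(P)` norm is
large. -/
def truncate (P : Measure (Full dx ds)) (c : ℝ≥0∞) {N : ℕ} {J : Finset (Fin N)}
    (g : (J → Obs dx ds) → Full dx ds → ℝ) (w : J → Obs dx ds) (d : Full dx ds) : ℝ :=
  if ∫⁻ d', ENNReal.ofReal (g w d' ^ 2) ∂P ≤ c then g w d else 0

theorem measurable_truncate (c : ℝ≥0∞) {N : ℕ} {J : Finset (Fin N)}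
    {g : (J → Obs dx ds) → Full dx ds → ℝ}
    (hg : Measurable fun p : (J → Obs dx ds) × Full dx ds => g p.1 p.2) :
    Measurable fun p : (J → Obs dx ds) × Full dx ds => truncate P c g p.1 p.2 := by
  have h1 : Measurable fun w => ∫⁻ d', ENNReal.ofReal (g w d' ^ 2) ∂P :=
    Measurable.lintegral_prod_right' (f := fun p => ENNReal.ofReal (g p.1 p.2 ^ 2))
      (hg.pow_const 2).ennreal_ofReal
  exact Measurable.ite (measurableSet_le (h1.comp measurable_fst) measurable_const) hg
    measurable_const

theorem lintegral_sq_truncate_le (c : ℝ≥0∞) {N : ℕ} {J : Finset (Fin N)}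
    (g : (J → Obs dx ds) → Full dx ds → ℝ) (w : J → Obs dx ds) :
    ∫⁻ d, ENNReal.ofReal (truncate P c g w d ^ 2) ∂P ≤ c := by
  unfold truncate
  split_ifs with h
  · exact h
  · simp

omit [IsProbabilityMeasure P] in
theorem truncate_eq {c : ℝ≥0∞} {N : ℕ} {J : Finset (Fin N)}
    {g : (J → Obs dx ds) → Full dx ds → ℝ} {w : J → Obs dx ds}
    (h : ¬ c < ∫⁻ d', ENNReal.ofReal (g w d' ^ 2) ∂P) : truncate P c g w = g w := by
  ext d
  exact if_pos (not_lt.1 h)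

variable {g : (N : ℕ) → (J : Finset (Fin N)) → (J → Obs dx ds) → Full dx ds → ℝ}

/-- Truncation level for which the second moments given the labels are at most `c`. -/
theorem exists_truncation_level (P : Measure (Full dx ds)) [IsProbabilityMeasure P] {c : ℝ≥0∞}
    (hc : 0 < c) : ∃ κ : ℝ≥0∞, 0 < κ ∧ ∀ {N : ℕ} (J : Finset (Fin N))
      (g : (J → Obs dx ds) → Full dx ds → ℝ) (w : J → Obs dx ds) (b : Bool),
      ∫⁻ d, ENNReal.ofReal (truncate P κ g w d ^ 2) ∂labelLaw P R b ≤ c := by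
  obtain ⟨M, hM, hle⟩ := exists_labelLaw_le P (R : Full dx ds → Bool)
  have hM1 : M + 1 ≠ ∞ := by simp [hM]
  refine ⟨c / (M + 1), ENNReal.div_pos hc.ne' hM1, fun J g w b => ?_⟩
  calc ∫⁻ d, ENNReal.ofReal (truncate P (c / (M + 1)) g w d ^ 2) ∂labelLaw P R b
      ≤ M * ∫⁻ d, ENNReal.ofReal (truncate P (c / (M + 1)) g w d ^ 2) ∂P :=
        (lintegral_mono' (hle b) le_rfl).trans_eq (by rw [lintegral_smul_measure, smul_eq_mul])
    _ ≤ (M + 1) * (c / (M + 1)) := by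
        gcongr
        · exact le_self_add
        · exact lintegral_sq_truncate_le _ _ _
    _ = c := ENNReal.mul_div_cancel (by simp) hM1

/-- After truncation the second moments given the labels are small for every realization of the
training data, so the first moment bound applies. The truncation is inactive off an event of
vanishing probability. -/
theorem Design.isLittleOP_foldMean_sq (h : Design μ P D F U) (k : Fin K)
    (hg : ∀ N (J : Finset (Fin N)), Measurable fun p : (J → Obs dx ds) × Full dx ds =>
      g N J p.1 p.2) (hv : VanishingL2 μ P D F U k g) :
    IsLittleOP μ fun N ω => (N : ℝ)⁻¹ * ∑ i ∈ (sampleAt D F U N ω).foldSet k,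
      g N _ ((sampleAt D F U N ω).train k) (D i ω) ^ 2 := by
  refine isLittleOP_of_lintegral_off fun c hc hct => ?_
  obtain ⟨κ, hκ, hB⟩ := exists_truncation_level P hc
  let tr : (N : ℕ) → (J : Finset (Fin N)) → (J → Obs dx ds) → Full dx ds → ℝ :=
    fun N J => truncate P κ (g N J)
  have htr : ∀ N (J : Finset (Fin N)), Measurable fun p : (J → Obs dx ds) × Full dx ds =>
      tr N J p.1 p.2 := fun N J => measurable_truncate κ (hg N J)
  refine ⟨fun N => {ω | κ < ∫⁻ d, ENNReal.ofReal
      (g N _ ((sampleAt D F U N ω).train k) d ^ 2) ∂P},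
    fun N ω => ENNReal.ofReal ((N : ℝ)⁻¹) * ∑ i ∈ (sampleAt D F U N ω).foldSet k,
      ENNReal.ofReal (tr N _ ((sampleAt D F U N ω).train k) (D i ω) ^ 2),
    hv κ hκ, fun N => (Measurable.const_mul ?_ _).aemeasurable, Eventually.of_forall fun N => ?_,
    fun N ω hω => ?_⟩
  · refine h.measurable_statistic N (G := fun s : Sample dx ds K N =>
      ∑ i ∈ s.foldSet k, ENNReal.ofReal (tr N _ (s.train k) (s.unit i) ^ 2)) fun a => ?_
    set J : Finset (Fin N) := Finset.univ.filter fun i => a i = k with hJ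
    change Measurable fun x : Fin N → Full dx ds =>
      ∑ i ∈ J, ENNReal.ofReal (tr N Jᶜ (fun i => observe (x i)) (x i) ^ 2)
    refine Finset.measurable_fun_sum _ fun i _ => (Measurable.pow_const ?_ 2).ennreal_ofReal
    exact (htr N _).comp ((measurable_observe_restrict _).prodMk (measurable_pi_apply i))
  · rw [lintegral_const_mul' _ _ ENNReal.ofReal_ne_top]
    calc ENNReal.ofReal ((N : ℝ)⁻¹) * _ ≤ ENNReal.ofReal ((N : ℝ)⁻¹) * (N * c) := by
          gcongr
          exact h.lintegral_foldSum_le N k (fun J w d => ENNReal.ofReal (tr N J w d ^ 2))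
            (fun J => ((htr N J).pow_const 2).ennreal_ofReal) fun J w b => hB J (g N J) w b
      _ = (N * ENNReal.ofReal ((N : ℝ)⁻¹)) * c := by ring
      _ ≤ 1 * c := by gcongr; exact natCast_mul_ofReal_inv_le N
      _ = c := one_mul c
  · have h1 : tr N _ ((sampleAt D F U N ω).train k) = g N _ ((sampleAt D F U N ω).train k) :=
      truncate_eq hω
    beta_reduce
    rw [h1, abs_of_nonneg (by positivity), ENNReal.ofReal_mul (by positivity),
      ENNReal.ofReal_sum_of_nonneg fun _ _ => sq_nonneg _]

/-- As for mean squares, but with the conditional variance: centering makes the squared sum grow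
like `N` times the small second moment, which the factor `1 / √N` balances. -/
theorem Design.isLittleOP_centered_foldSum (h : Design μ P D F U) (k : Fin K)
    (hg : ∀ N (J : Finset (Fin N)), Measurable fun p : (J → Obs dx ds) × Full dx ds =>
      g N J p.1 p.2) (hv : VanishingL2 μ P D F U k g) :
    IsLittleOP μ fun N ω => (√(N : ℝ))⁻¹ * ∑ i ∈ (sampleAt D F U N ω).foldSet k,
      (g N _ ((sampleAt D F U N ω).train k) (D i ω)
        - ∫ d, g N _ ((sampleAt D F U N ω).train k) d ∂labelLaw P R (R (D i ω))) := by
  refine IsLittleOP.of_sq (isLittleOP_of_lintegral_off fun c hc hct => ?_)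
  obtain ⟨κ, hκ, hB⟩ := exists_truncation_level P hc
  let tr : (N : ℕ) → (J : Finset (Fin N)) → (J → Obs dx ds) → Full dx ds → ℝ :=
    fun N J => truncate P κ (g N J)
  have htr : ∀ N (J : Finset (Fin N)), Measurable fun p : (J → Obs dx ds) × Full dx ds =>
      tr N J p.1 p.2 := fun N J => measurable_truncate κ (hg N J)
  refine ⟨fun N => {ω | κ < ∫⁻ d, ENNReal.ofReal
      (g N _ ((sampleAt D F U N ω).train k) d ^ 2) ∂P},
    fun N ω => ENNReal.ofReal (((√(N : ℝ))⁻¹ * ∑ i ∈ (sampleAt D F U N ω).foldSet k,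
      (tr N _ ((sampleAt D F U N ω).train k) (D i ω)
        - ∫ d, tr N _ ((sampleAt D F U N ω).train k) d ∂labelLaw P R (R (D i ω)))) ^ 2),
    hv κ hκ, fun N => (((Measurable.const_mul ?_ _).pow_const 2).ennreal_ofReal).aemeasurable,
    Eventually.of_forall fun N => lintegral_sq_inv_sqrt_mul_le
        (h.lintegral_sq_foldSum_le N k (tr N) (htr N) hct fun J w b => hB J (g N J) w b),
    fun N ω hω => ?_⟩
  · refine h.measurable_statistic N (G := fun s : Sample dx ds K N =>
      ∑ i ∈ s.foldSet k, (tr N _ (s.train k) (s.unit i)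
        - ∫ d, tr N _ (s.train k) d ∂labelLaw P R (R (s.unit i)))) fun a => ?_
    have hint : ∀ (J : Finset (Fin N)) b, Measurable fun w => ∫ d, tr N J w d ∂labelLaw P R b :=
      fun J b => ((htr N J).stronglyMeasurable.integral_prod_right').measurable
    have hint' : ∀ J : Finset (Fin N), Measurable fun p : Bool × (J → Obs dx ds) =>
        ∫ d, tr N J p.2 d ∂labelLaw P R p.1 := fun J =>
      measurable_from_prod_countable_right fun b => hint J b
    set J : Finset (Fin N) := Finset.univ.filter fun i => a i = k with hJ
    change Measurable fun x : Fin N → Full dx ds =>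
      ∑ i ∈ J, (tr N Jᶜ (fun i => observe (x i)) (x i)
        - ∫ d, tr N Jᶜ (fun i => observe (x i)) d ∂labelLaw P R (R (x i)))
    refine Finset.measurable_fun_sum _ fun i _ => Measurable.sub ?_ ?_
    · exact (htr N _).comp ((measurable_observe_restrict _).prodMk (measurable_pi_apply i))
    · exact (hint' _).comp ((measurable_R.comp (measurable_pi_apply i)).prodMk
        (measurable_observe_restrict _))
  · have h1 : tr N _ ((sampleAt D F U N ω).train k) = g N _ ((sampleAt D F U N ω).train k) :=
      truncate_eq hω
    beta_reduce
    rw [h1, abs_of_nonneg (sq_nonneg _)]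

omit [MeasurableSpace 𝒰] in
theorem isLittleOP_integral_labelLaw (k : Fin K)
    (hg : ∀ N (J : Finset (Fin N)), Measurable fun p : (J → Obs dx ds) × Full dx ds =>
      g N J p.1 p.2) (hv : VanishingL2 μ P D F U k g) (b : Bool) :
    IsLittleOP μ fun N ω => ∫ d, g N _ ((sampleAt D F U N ω).train k) d ∂labelLaw P R b := by
  refine IsLittleOP.of_sq (isLittleOP_of_lintegral_off fun c hc hct => ?_)
  obtain ⟨κ, hκ, hB⟩ := exists_truncation_level P hc
  refine ⟨fun N => {ω | κ < ∫⁻ d, ENNReal.ofReal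
      (g N _ ((sampleAt D F U N ω).train k) d ^ 2) ∂P}, fun _ _ => c,
    hv κ hκ, fun N => aemeasurable_const, Eventually.of_forall fun N => by simp,
    fun N ω hω => ?_⟩
  have h1 := hB _ (g N _) ((sampleAt D F U N ω).train k) b
  rw [truncate_eq hω] at h1
  refine le_trans ?_ h1
  refine le_trans (le_of_eq ?_) (sq_enorm_integral_le (labelLaw P R b)
    ((hg N _).comp measurable_prodMk_left))
  rw [abs_of_nonneg (sq_nonneg _), ← sq_abs, ENNReal.ofReal_pow (abs_nonneg _),
    ← Real.norm_eq_abs, ofReal_norm]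

/-- Cross-fitted sums are `o_p(√N)` if the function computed from the training data vanishes in
`L²(P)` and its `P`-mean is `o_p(N^{-1/2})`. -/
theorem Design.isLittleOP_foldSum (h : Design μ P D F U) (k : Fin K)
    (hg : ∀ N (J : Finset (Fin N)), Measurable fun p : (J → Obs dx ds) × Full dx ds =>
      g N J p.1 p.2) (hv : VanishingL2 μ P D F U k g)
    (hbias : IsLittleOP μ fun N ω =>
      √(N : ℝ) * ∫ d, g N _ ((sampleAt D F U N ω).train k) d ∂P) :
    IsLittleOP μ fun N ω => (√(N : ℝ))⁻¹ * ∑ i ∈ (sampleAt D F U N ω).foldSet k,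
      g N _ ((sampleAt D F U N ω).train k) (D i ω) := by
  -- The cost of label-dependent folds: count deviations of order `√N` against label-conditional
  -- means that vanish in probability.
  have hC : IsLittleOP μ fun N ω => ∑ b, ((√(N : ℝ))⁻¹ *
      ((sampleAt D F U N ω).foldLabelCount k b - N * P.real {d | R d = b} / K)) *
      ∫ d, g N _ ((sampleAt D F U N ω).train k) d ∂labelLaw P R b :=
    IsLittleOP.sum _ fun b _ => (h.isBoundedP_foldLabelCount k b).mul_isLittleOP
      (isLittleOP_integral_labelLaw k hg hv b)
  refine (((h.isLittleOP_centered_foldSum k hg hv).add hC).add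
    (hbias.const_mul (K : ℝ)⁻¹)).of_eq_off (hv 1 one_pos) (Eventually.of_forall fun N ω hω => ?_)
  refine le_of_eq (congrArg abs ?_)
  set w := (sampleAt D F U N ω).train k with hw
  have hgw : Measurable (g N _ w) := (hg N _).comp measurable_prodMk_left
  have hint : Integrable (g N _ w) P := integrable_of_lintegral_sq_ne_top P hgw
    (ne_top_of_le_ne_top ENNReal.one_ne_top (not_lt.1 hω))
  have h0 := integral_eq_sum_labelLaw P measurable_R hint
  set m : Bool → ℝ := fun b => ∫ d, g N _ w d ∂labelLaw P R b with hm
  have h1 := (sampleAt D F U N ω).sum_foldSet_label k m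
  -- The total expectation formula collects the centering of the counts into `N / K` times the
  -- `P`-mean, the term that the bias hypothesis controls.
  have h2 : ∑ b, (((sampleAt D F U N ω).foldLabelCount k b : ℝ)
      - N * P.real {d | R d = b} / K) * m b
      = ∑ i ∈ (sampleAt D F U N ω).foldSet k, m (R (D i ω)) - N / K * ∫ d, g N _ w d ∂P := by
    rw [h0]
    refine Eq.trans ?_ (congrArg (fun z => z - _) h1.symm)
    have h3 : ∀ b : Bool, N * P.real {d : Full dx ds | R d = b} / K * m b
        = N / K * (P.real {d : Full dx ds | R d = b} * m b) := fun b => by ring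
    simp_rw [sub_mul, Finset.sum_sub_distrib, h3, ← Finset.mul_sum]
    rfl
  simp_rw [mul_assoc, ← Finset.mul_sum]
  rw [h2, Finset.sum_sub_distrib]
  have hs : (√(N : ℝ))⁻¹ * N = √(N : ℝ) := by
    rw [inv_mul_eq_div, Real.div_sqrt]
  have h4 : (√(N : ℝ))⁻¹ * (∑ i ∈ (sampleAt D F U N ω).foldSet k, m (R (D i ω))
      - N / K * ∫ d, g N _ w d ∂P)
      = (√(N : ℝ))⁻¹ * ∑ i ∈ (sampleAt D F U N ω).foldSet k, m (R (D i ω))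
        - ((√(N : ℝ))⁻¹ * N) * (K : ℝ)⁻¹ * ∫ d, g N _ w d ∂P := by ring
  rw [h4, hs]
  ring

end Folds

end
end SurrogateATE

namespace SurrogateATE
noncomputable section

/-! ### Exact expansions of the two estimators. -/

section Algebra

variable {dx ds K N : ℕ} (s : Sample dx ds K N)

/-- The size of the `k`-th fold relative to an even share. -/
def Sample.foldShare (k : Fin K) : ℝ := K * (s.foldSet k).card / N

/-- The deviation of the score at the estimated nuisance parameters from `f + δ`. -/
def Sample.scoreError (L : Learner dx ds) (f : Full dx ds → ℝ) (δ : ℝ) (k : Fin K)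
    (d : Full dx ds) : ℝ :=
  score (s.etaHat L k) (observe d) - (f d + δ)

theorem Sample.sum_foldSet (f : Fin N → ℝ) : ∑ k, ∑ i ∈ s.foldSet k, f i = ∑ i, f i :=
  Finset.sum_fiberwise Finset.univ s.fold f

variable (L : Learner dx ds) (f : Full dx ds → ℝ) (δ : ℝ)

/-- Averages over a fold divide by the fold size; in terms of `N` this is the random factor
`(foldShare)⁻¹`. Nonempty folds are needed for the constant `δ` to be averaged to itself. -/
theorem Sample.deltaHat_sub_eq (hK : 0 < K) (hN : 0 < N) (hs : ∀ k, 0 < (s.foldSet k).card) :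
    s.deltaHat L - δ = ∑ k, (s.foldShare k)⁻¹ * ((N : ℝ)⁻¹ * ∑ i ∈ s.foldSet k, f (s.unit i)
      + (N : ℝ)⁻¹ * ∑ i ∈ s.foldSet k, s.scoreError L f δ k (s.unit i)) := by
  have hK' : (K : ℝ) ≠ 0 := by positivity
  have hN' : (N : ℝ) ≠ 0 := by positivity
  have h1 : δ = ∑ _k : Fin K, δ / K := by
    simp; field_simp
  rw [Sample.deltaHat, Finset.sum_div]
  conv_lhs => rw [h1]
  rw [← Finset.sum_sub_distrib]
  refine Finset.sum_congr rfl fun k _ => ?_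
  have hc : ((s.foldSet k).card : ℝ) ≠ 0 := by have := hs k; positivity
  have h2 : ∑ i ∈ s.foldSet k, score (s.etaHat L k) (observe (s.unit i))
      = ∑ i ∈ s.foldSet k, f (s.unit i) + (s.foldSet k).card * δ
        + ∑ i ∈ s.foldSet k, s.scoreError L f δ k (s.unit i) := by
    simp only [Sample.scoreError, Finset.sum_sub_distrib, Finset.sum_add_distrib,
      Finset.sum_const, nsmul_eq_mul]
    ring
  rw [Sample.foldMean, h2, Sample.foldShare]
  field_simp
  ring

/-- Linear expansion of the cross-fitted estimator. -/
theorem Sample.sqrt_mul_deltaHat_sub_eq (hK : 0 < K) (hN : 0 < N)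
    (hs : ∀ k, 0 < (s.foldSet k).card) :
    √(N : ℝ) * (s.deltaHat L - δ) - (√(N : ℝ))⁻¹ * ∑ i, f (s.unit i)
      = ∑ k, ((s.foldShare k)⁻¹ * ((√(N : ℝ))⁻¹ *
          ∑ i ∈ s.foldSet k, s.scoreError L f δ k (s.unit i))
        - √(N : ℝ) * (s.foldShare k - 1) * (s.foldShare k)⁻¹ *
          ((N : ℝ)⁻¹ * ∑ i ∈ s.foldSet k, f (s.unit i))) := by
  have hN' : (N : ℝ) ≠ 0 := by positivity
  have hr : √(N : ℝ) ≠ 0 := by positivity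
  -- Fold by fold, the identity `c⁻¹ - 1 = -(c - 1) c⁻¹` for the share `c` isolates the effect of
  -- unequal fold sizes.
  rw [s.deltaHat_sub_eq L f δ hK hN hs, ← s.sum_foldSet, Finset.mul_sum, Finset.mul_sum,
    ← Finset.sum_sub_distrib]
  refine Finset.sum_congr rfl fun k _ => ?_
  have hc : s.foldShare k ≠ 0 := by
    have := hs k
    unfold Sample.foldShare
    positivity
  have hsq : (√(N : ℝ))⁻¹ = √(N : ℝ) * (N : ℝ)⁻¹ := by
    rw [← div_eq_mul_inv, Real.sqrt_div_self]
  rw [hsq]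
  field_simp
  ring

/-- Expansion of the cross-fitted variance estimator. -/
theorem Sample.VHat_sub_eq (hK : 0 < K) (hN : 0 < N) (hs : ∀ k, 0 < (s.foldSet k).card) :
    s.VHat L - (N : ℝ)⁻¹ * ∑ i, f (s.unit i) ^ 2
      = ∑ k, ((s.foldShare k)⁻¹ * (2 * ((N : ℝ)⁻¹ * ∑ i ∈ s.foldSet k, f (s.unit i) *
          (s.scoreError L f δ k (s.unit i) - (s.deltaHat L - δ)))
          + (N : ℝ)⁻¹ * ∑ i ∈ s.foldSet k,
            (s.scoreError L f δ k (s.unit i) - (s.deltaHat L - δ)) ^ 2)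
        - (s.foldShare k - 1) * (s.foldShare k)⁻¹ *
          ((N : ℝ)⁻¹ * ∑ i ∈ s.foldSet k, f (s.unit i) ^ 2)) := by
  have hK' : (K : ℝ) ≠ 0 := by positivity
  have hN' : (N : ℝ) ≠ 0 := by positivity
  rw [← s.sum_foldSet, Sample.VHat, Finset.mul_sum, Finset.sum_div, ← Finset.sum_sub_distrib]
  refine Finset.sum_congr rfl fun k _ => ?_
  have hc : ((s.foldSet k).card : ℝ) ≠ 0 := by have := hs k; positivity
  have h2 : ∑ i ∈ s.foldSet k, psi (s.deltaHat L) (s.etaHat L k) (observe (s.unit i)) ^ 2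
      = ∑ i ∈ s.foldSet k, f (s.unit i) ^ 2 + (2 * ∑ i ∈ s.foldSet k, f (s.unit i) *
          (s.scoreError L f δ k (s.unit i) - (s.deltaHat L - δ))
        + ∑ i ∈ s.foldSet k, (s.scoreError L f δ k (s.unit i) - (s.deltaHat L - δ)) ^ 2) := by
    rw [Finset.mul_sum, ← Finset.sum_add_distrib, ← Finset.sum_add_distrib]
    refine Finset.sum_congr rfl fun i _ => ?_
    simp only [Sample.scoreError, psi]
    ring
  rw [Sample.foldMean, h2, Sample.foldShare]
  field_simp
  ring

theorem Sample.sq_cross_le (k : Fin K) (u v : Fin N → ℝ) :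
    ((N : ℝ)⁻¹ * ∑ i ∈ s.foldSet k, u i * v i) ^ 2
      ≤ ((N : ℝ)⁻¹ * ∑ i ∈ s.foldSet k, u i ^ 2) * ((N : ℝ)⁻¹ * ∑ i ∈ s.foldSet k, v i ^ 2) := by
  have := Finset.sum_mul_sq_le_sq_mul_sq (s.foldSet k) u v
  calc ((N : ℝ)⁻¹ * ∑ i ∈ s.foldSet k, u i * v i) ^ 2
      = (N : ℝ)⁻¹ ^ 2 * (∑ i ∈ s.foldSet k, u i * v i) ^ 2 := by ring
    _ ≤ (N : ℝ)⁻¹ ^ 2 * ((∑ i ∈ s.foldSet k, u i ^ 2) * ∑ i ∈ s.foldSet k, v i ^ 2) := by gcongr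
    _ = _ := by ring

theorem Sample.mean_sq_sub_le (k : Fin K) (u : Fin N → ℝ) (c : ℝ) :
    (N : ℝ)⁻¹ * ∑ i ∈ s.foldSet k, (u i - c) ^ 2
      ≤ 2 * ((N : ℝ)⁻¹ * ∑ i ∈ s.foldSet k, u i ^ 2) + 2 * c ^ 2 := by
  have h1 : ∑ i ∈ s.foldSet k, (u i - c) ^ 2 ≤ ∑ i ∈ s.foldSet k, (2 * u i ^ 2 + 2 * c ^ 2) :=
    Finset.sum_le_sum fun i _ => by nlinarith [sq_nonneg (u i + c)]
  have h2 : (N : ℝ)⁻¹ * ((s.foldSet k).card : ℝ) ≤ 1 := by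
    rw [inv_mul_eq_div]
    refine div_le_one_of_le₀ ?_ (Nat.cast_nonneg N)
    exact_mod_cast (Finset.card_le_univ _).trans_eq (Fintype.card_fin N)
  calc (N : ℝ)⁻¹ * ∑ i ∈ s.foldSet k, (u i - c) ^ 2
      ≤ (N : ℝ)⁻¹ * ∑ i ∈ s.foldSet k, (2 * u i ^ 2 + 2 * c ^ 2) := by gcongr
    _ = 2 * ((N : ℝ)⁻¹ * ∑ i ∈ s.foldSet k, u i ^ 2)
        + (N : ℝ)⁻¹ * ((s.foldSet k).card : ℝ) * (2 * c ^ 2) := by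
        rw [Finset.sum_add_distrib, ← Finset.mul_sum, Finset.sum_const, nsmul_eq_mul]
        ring
    _ ≤ _ := by
        exact add_le_add le_rfl (mul_le_of_le_one_left (by positivity) h2)

end Algebra

/-! ### Asymptotic linearity, consistency of the variance estimator, central limit theorem. -/

section Asymptotics

variable {dx ds K : ℕ} {Ω 𝒰 : Type*} [MeasurableSpace Ω] [MeasurableSpace 𝒰] {μ : Measure Ω}
  [IsProbabilityMeasure μ] {P : Measure (Full dx ds)} [IsProbabilityMeasure P]
  {D : ℕ → Ω → Full dx ds} {F : FoldRule K 𝒰} {U : ℕ → Ω → 𝒰}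

/-- The label probabilities sum to one, so `foldShare - 1` is `K / N` times the sum over both labels
of the centered counts. -/
theorem Design.isBoundedP_foldShare (h : Design μ P D F U) (hK : 0 < K) (k : Fin K) :
    IsBoundedP μ fun N ω => √(N : ℝ) * ((sampleAt D F U N ω).foldShare k - 1) := by
  have h1 : IsBoundedP μ fun N ω => (K : ℝ) * ∑ b, (√(N : ℝ))⁻¹ *
      ((sampleAt D F U N ω).foldLabelCount k b - N * P.real {d | R d = b} / K) :=
    (isBoundedP_const (K : ℝ)).mul (IsBoundedP.sum _ fun b _ => h.isBoundedP_foldLabelCount k b)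
  refine h1.of_le ?_
  filter_upwards [eventually_gt_atTop 0] with N hN
  refine ae_of_all _ fun ω => le_of_eq (congrArg abs ?_)
  have hK' : (K : ℝ) ≠ 0 := by positivity
  have hN' : (N : ℝ) ≠ 0 := by positivity
  have h2 : ∑ b, P.real {d : Full dx ds | R d = b} = 1 := by
    have := integral_eq_sum_labelLaw P (lab := (R : Full dx ds → Bool)) measurable_R
      (integrable_const (1 : ℝ))
    simpa using this.symm
  have h3 : ((sampleAt D F U N ω).foldSet k).card
      = ∑ b, ((sampleAt D F U N ω).foldLabelCount k b : ℝ) := by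
    rw [← Sample.sum_foldLabelCount, Nat.cast_sum]
  have hsq : (√(N : ℝ))⁻¹ = √(N : ℝ) * (N : ℝ)⁻¹ := by
    rw [← div_eq_mul_inv, Real.sqrt_div_self]
  rw [← Finset.mul_sum, Finset.sum_sub_distrib, ← Finset.sum_div, ← Finset.mul_sum, h2, ← h3,
    Sample.foldShare, hsq]
  field_simp

omit [IsProbabilityMeasure μ] in
theorem isLittleOP_of_sqrt_mul {Z : ℕ → Ω → ℝ} (h : IsBoundedP μ fun N ω => √(N : ℝ) * Z N ω) :
    IsLittleOP μ Z := by
  have hlim : IsLittleOP μ fun N _ => (√(N : ℝ))⁻¹ :=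
    isLittleOP_of_tendsto (tendsto_inv_atTop_zero.comp
      (Real.tendsto_sqrt_atTop.comp tendsto_natCast_atTop_atTop))
  refine (hlim.mul_isBoundedP h).of_le ?_
  filter_upwards [eventually_gt_atTop 0] with N hN
  refine ae_of_all _ fun ω => le_of_eq (congrArg abs ?_)
  rw [inv_mul_cancel_left₀ (by positivity)]

/-- With probability tending to one all folds are nonempty. -/
theorem Design.measure_exists_empty_fold_le (h : Design μ P D F U) (hK : 0 < K) {ε : ℝ≥0∞}
    (hε : 0 < ε) :
    ∀ᶠ N in atTop, μ {ω | ∃ k, ((sampleAt D F U N ω).foldSet k).card = 0} ≤ ε := by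
  have h1 : IsLittleOP μ fun N ω => ∑ k, |(sampleAt D F U N ω).foldShare k - 1| :=
    IsLittleOP.sum _ fun k _ => (isLittleOP_of_sqrt_mul (h.isBoundedP_foldShare hK k)).of_le
      (Eventually.of_forall fun N => ae_of_all _ fun ω => by rw [abs_abs])
  filter_upwards [h1 1 one_pos ε hε] with N hN
  refine (measure_mono fun ω hω => ?_).trans hN
  obtain ⟨k, hk⟩ := hω
  -- An empty fold has share zero and hence deviates from `1` by exactly `1`.
  have h2 : |(sampleAt D F U N ω).foldShare k - 1| = 1 := by simp [Sample.foldShare, hk]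
  exact (h2.symm.le.trans (Finset.single_le_sum
    (f := fun k => |(sampleAt D F U N ω).foldShare k - 1|) (fun _ _ => abs_nonneg _)
    (Finset.mem_univ k))).trans (le_abs_self _)

theorem Design.isBoundedP_inv_foldShare (h : Design μ P D F U) (hK : 0 < K) (k : Fin K) :
    IsBoundedP μ fun N ω => ((sampleAt D F U N ω).foldShare k)⁻¹ :=
  IsLittleOP.isBoundedP_inv one_pos (isLittleOP_of_sqrt_mul (h.isBoundedP_foldShare hK k))

variable {L : Learner dx ds} {f : Full dx ds → ℝ} {δ : ℝ}

/-- The cross-fitted estimator is asymptotically linear with influence function `f`. -/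
theorem Design.isLittleOP_deltaHat (h : Design μ P D F U) (hK : 0 < K) (hf : Measurable f)
    (hf2 : ∫⁻ d, ENNReal.ofReal (f d ^ 2) ∂P ≠ ∞) (hf0 : ∫ d, f d ∂P = 0)
    (hΔ : ∀ k, IsLittleOP μ fun N ω => (√(N : ℝ))⁻¹ * ∑ i ∈ (sampleAt D F U N ω).foldSet k,
      (sampleAt D F U N ω).scoreError L f δ k (D i ω)) :
    IsLittleOP μ fun N ω => √(N : ℝ) * ((sampleAt D F U N ω).deltaHat L - δ)
      - (√(N : ℝ))⁻¹ * ∑ i : Fin N, f (D i ω) := by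
  have h1 : IsLittleOP μ fun N ω => ∑ k, (((sampleAt D F U N ω).foldShare k)⁻¹ *
      ((√(N : ℝ))⁻¹ * ∑ i ∈ (sampleAt D F U N ω).foldSet k,
        (sampleAt D F U N ω).scoreError L f δ k (D i ω))
      - √(N : ℝ) * ((sampleAt D F U N ω).foldShare k - 1) *
        ((sampleAt D F U N ω).foldShare k)⁻¹ *
        ((N : ℝ)⁻¹ * ∑ i ∈ (sampleAt D F U N ω).foldSet k, f (D i ω))) :=
    -- Fold sizes off by `O_p(√N)` multiply fold means of the centered `f`, which are `o_p(1)`; they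
    -- do not matter to first order.
    IsLittleOP.sum _ fun k _ => ((h.isBoundedP_inv_foldShare hK k).mul_isLittleOP (hΔ k)).sub
      (((h.isBoundedP_foldShare hK k).mul (h.isBoundedP_inv_foldShare hK k)).mul_isLittleOP
        (h.isLittleOP_foldMean_of_fixed k hf hf2 hf0))
  refine h1.of_eq_off (fun ε hε => h.measure_exists_empty_fold_le hK hε) ?_
  filter_upwards [eventually_gt_atTop 0] with N hN ω hω
  refine le_of_eq (congrArg abs ?_)
  refine (sampleAt D F U N ω).sqrt_mul_deltaHat_sub_eq L f δ hK hN fun k => ?_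
  rw [Nat.pos_iff_ne_zero]
  exact fun h0 => hω ⟨k, h0⟩

omit [IsProbabilityMeasure P] in
theorem Design.tendstoInMeasure_mean (h : Design μ P D F U) {f : Full dx ds → ℝ}
    (hf : Measurable f) (hfi : Integrable f P) :
    TendstoInMeasure μ (fun (N : ℕ) ω => (N : ℝ)⁻¹ * ∑ i : Fin N, f (D i ω)) atTop
      fun _ => ∫ d, f d ∂P := by
  have hm : ∀ i, Measurable fun ω => f (D i ω) := fun i => hf.comp (h.measurable_unit i)
  have hident : ∀ i, IdentDistrib (D i) (D 0) μ μ := fun i =>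
    ⟨(h.measurable_unit i).aemeasurable, (h.measurable_unit 0).aemeasurable, by
      rw [h.law i, h.law 0]⟩
  have hint : Integrable (fun ω => f (D 0 ω)) μ := by
    rw [← h.law 0] at hfi
    exact hfi.comp_measurable (h.measurable_unit 0)
  have hmean : ∫ ω, f (D 0 ω) ∂μ = ∫ d, f d ∂P := by
    rw [← h.law 0, integral_map (h.measurable_unit 0).aemeasurable hf.aestronglyMeasurable]
  have hlaw := strong_law_ae_real (fun i ω => f (D i ω)) hint
    (fun i j hij => (h.indep.indepFun hij).comp hf hf) fun i => (hident i).comp hf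
  refine tendstoInMeasure_of_tendsto_ae
    (fun N => ((Finset.measurable_fun_sum _ fun (i : Fin N) _ => hm i).const_mul _).aestronglyMeasurable) ?_
  filter_upwards [hlaw] with ω hω
  rw [hmean] at hω
  refine hω.congr fun N => ?_
  rw [inv_mul_eq_div, Finset.sum_range]

/-- Consistency of the cross-fitted variance estimator. -/
theorem Design.isLittleOP_VHat (h : Design μ P D F U) (hK : 0 < K) (hf : Measurable f)
    (hf2 : Integrable (fun d => f d ^ 2) P)
    (hδ : IsLittleOP μ fun N ω => (sampleAt D F U N ω).deltaHat L - δ)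
    (hΔ : ∀ k, IsLittleOP μ fun (N : ℕ) ω => (N : ℝ)⁻¹ * ∑ i ∈ (sampleAt D F U N ω).foldSet k,
      (sampleAt D F U N ω).scoreError L f δ k (D i ω) ^ 2) :
    IsLittleOP μ fun N ω => (sampleAt D F U N ω).VHat L - ∫ d, f d ^ 2 ∂P := by
  have hmean := IsLittleOP.of_tendstoInMeasure (h.tendstoInMeasure_mean (hf.pow_const 2) hf2)
  have hmeanB : IsBoundedP μ fun (N : ℕ) ω => (N : ℝ)⁻¹ * ∑ i : Fin N, f (D i ω) ^ 2 := by
    refine (hmean.isBoundedP.add (isBoundedP_const (∫ d, f d ^ 2 ∂P))).of_le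
      (Eventually.of_forall fun N => ae_of_all _ fun ω => le_of_eq (congrArg abs ?_))
    ring
  -- A sum of squares over one fold is at most the sum over the whole sample.
  have hA : ∀ k, IsBoundedP μ fun (N : ℕ) ω => (N : ℝ)⁻¹ *
      ∑ i ∈ (sampleAt D F U N ω).foldSet k, f (D i ω) ^ 2 := by
    refine fun k => hmeanB.of_le (Eventually.of_forall fun N => ae_of_all _ fun ω => ?_)
    rw [abs_of_nonneg (by positivity), abs_of_nonneg (by positivity)]
    gcongr
    exact Finset.subset_univ _
  have hB : ∀ k, IsLittleOP μ fun (N : ℕ) ω => (N : ℝ)⁻¹ * ∑ i ∈ (sampleAt D F U N ω).foldSet k,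
      ((sampleAt D F U N ω).scoreError L f δ k (D i ω)
        - ((sampleAt D F U N ω).deltaHat L - δ)) ^ 2 := by
    intro k
    refine (((hΔ k).const_mul 2).add ((hδ.mul_isBoundedP hδ.isBoundedP).const_mul 2)).of_le
      (Eventually.of_forall fun N => ae_of_all _ fun ω => ?_)
    rw [abs_of_nonneg (by positivity), ← pow_two]
    exact ((sampleAt D F U N ω).mean_sq_sub_le k
      (fun i => (sampleAt D F U N ω).scoreError L f δ k (D i ω)) _).trans (le_abs_self _)
  -- By Cauchy–Schwarz the squared cross term is at most a bounded mean square times a vanishing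
  -- one.
  have hC : ∀ k, IsLittleOP μ fun (N : ℕ) ω => (N : ℝ)⁻¹ * ∑ i ∈ (sampleAt D F U N ω).foldSet k,
      f (D i ω) * ((sampleAt D F U N ω).scoreError L f δ k (D i ω)
        - ((sampleAt D F U N ω).deltaHat L - δ)) := by
    intro k
    refine IsLittleOP.of_sq (((hA k).mul_isLittleOP (hB k)).of_le
      (Eventually.of_forall fun N => ae_of_all _ fun ω => ?_))
    rw [abs_of_nonneg (sq_nonneg _)]
    exact ((sampleAt D F U N ω).sq_cross_le k (fun i => f (D i ω)) _).trans (le_abs_self _)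
  have h1 : IsLittleOP μ fun N ω => ∑ k, (((sampleAt D F U N ω).foldShare k)⁻¹ *
      (2 * ((N : ℝ)⁻¹ * ∑ i ∈ (sampleAt D F U N ω).foldSet k, f (D i ω) *
          ((sampleAt D F U N ω).scoreError L f δ k (D i ω)
            - ((sampleAt D F U N ω).deltaHat L - δ)))
        + (N : ℝ)⁻¹ * ∑ i ∈ (sampleAt D F U N ω).foldSet k,
          ((sampleAt D F U N ω).scoreError L f δ k (D i ω)
            - ((sampleAt D F U N ω).deltaHat L - δ)) ^ 2)
      - ((sampleAt D F U N ω).foldShare k - 1) * ((sampleAt D F U N ω).foldShare k)⁻¹ *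
        ((N : ℝ)⁻¹ * ∑ i ∈ (sampleAt D F U N ω).foldSet k, f (D i ω) ^ 2)) :=
    IsLittleOP.sum _ fun k _ =>
      ((h.isBoundedP_inv_foldShare hK k).mul_isLittleOP (((hC k).const_mul 2).add (hB k))).sub
      (((isLittleOP_of_sqrt_mul (h.isBoundedP_foldShare hK k)).mul_isBoundedP
        (h.isBoundedP_inv_foldShare hK k)).mul_isBoundedP (hA k))
  refine (h1.add hmean).of_eq_off (fun ε hε => h.measure_exists_empty_fold_le hK hε) ?_
  filter_upwards [eventually_gt_atTop 0] with N hN ω hω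
  refine le_of_eq (congrArg abs ?_)
  have h2 := (sampleAt D F U N ω).VHat_sub_eq L f δ hK hN fun k => by
    rw [Nat.pos_iff_ne_zero]
    exact fun h0 => hω ⟨k, h0⟩
  refine Eq.trans ?_ (congrArg (fun z => z + _) h2)
  change _ = (sampleAt D F U N ω).VHat L - (N : ℝ)⁻¹ * ∑ i : Fin N, f (D i ω) ^ 2
    + ((N : ℝ)⁻¹ * ∑ i : Fin N, f (D i ω) ^ 2 - ∫ d, f d ^ 2 ∂P)
  ring

omit [IsProbabilityMeasure P] in
/-- Central limit theorem for the influence function. -/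
theorem Design.tendstoInDistribution_sum (h : Design μ P D F U) (hf : Measurable f)
    (hf2 : MemLp f 2 P) (hf0 : ∫ d, f d ∂P = 0) :
    TendstoInDistribution (fun (N : ℕ) ω => (√(N : ℝ))⁻¹ * ∑ i : Fin N, f (D i ω)) atTop id
      (fun _ => μ) (gaussianReal 0 (∫ d, f d ^ 2 ∂P).toNNReal) := by
  have hm : ∀ i, Measurable fun ω => f (D i ω) := fun i => hf.comp (h.measurable_unit i)
  have hident : ∀ i, IdentDistrib (D i) (D 0) μ μ := fun i =>
    ⟨(h.measurable_unit i).aemeasurable, (h.measurable_unit 0).aemeasurable, by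
      rw [h.law i, h.law 0]⟩
  have hmp : MeasurePreserving (D 0) μ P := ⟨h.measurable_unit 0, h.law 0⟩
  have hmean : ∫ ω, f (D 0 ω) ∂μ = 0 := by
    rw [← hf0, ← h.law 0, integral_map (h.measurable_unit 0).aemeasurable hf.aestronglyMeasurable]
  have hvar : Var[fun ω => f (D 0 ω); μ] = ∫ d, f d ^ 2 ∂P := by
    rw [variance_of_integral_eq_zero (hm 0).aemeasurable hmean, ← h.law 0,
      integral_map (h.measurable_unit 0).aemeasurable (hf.pow_const 2).aestronglyMeasurable]
  have hclt := tendstoInDistribution_inv_sqrt_mul_sum_sub (P := μ)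
    (P' := gaussianReal 0 (∫ d, f d ^ 2 ∂P).toNNReal) (X := fun i ω => f (D i ω)) (Y := id)
    (by rw [hvar]; exact HasLaw.id) (hf2.comp_measurePreserving hmp)
    (h.indep.comp (fun _ => f) fun _ => hf) fun i => (hident i).comp hf
  rw [hmean] at hclt
  simpa [Finset.sum_range] using hclt

end Asymptotics

end
end SurrogateATE

namespace SurrogateATE
noncomputable section

/-! ### Measurability of the estimators. -/

section Learners

variable {dx ds K : ℕ} {L : Learner dx ds}

theorem LearnerMeasurable.isMeasurable (hL : LearnerMeasurable L) (N : ℕ) (J : Finset (Fin N))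
    (w : J → Obs dx ds) : (L N J w).IsMeasurable where
  e := (hL.e N J).comp measurable_prodMk_left
  r t := (hL.r N J t).comp measurable_prodMk_left
  mu t := (hL.mu N J t).comp measurable_prodMk_left
  muS t := (hL.muS N J t).comp measurable_prodMk_left

theorem LearnerMeasurable.score (hL : LearnerMeasurable L) (N : ℕ) (J : Finset (Fin N)) :
    Measurable fun p : (J → Obs dx ds) × Full dx ds => score (L N J p.1) (observe p.2) := by
  have hX : Measurable fun p : (J → Obs dx ds) × Full dx ds => (p.1, X p.2) :=
    measurable_fst.prodMk (measurable_X.comp measurable_snd)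
  have hXS : Measurable fun p : (J → Obs dx ds) × Full dx ds => (p.1, X p.2, S p.2) :=
    measurable_fst.prodMk ((measurable_X.prodMk measurable_S).comp measurable_snd)
  have he := (hL.e N J).comp hX
  have hr := fun t => (hL.r N J t).comp hXS
  have hmu := fun t => (hL.mu N J t).comp hX
  have hmuS := fun t => (hL.muS N J t).comp hXS
  have hY : Measurable fun p : (J → Obs dx ds) × Full dx ds => (observe p.2).2.2.2.1 :=
    (measurable_fst.comp (measurable_snd.comp (measurable_snd.comp measurable_snd))).comp
      (measurable_observe.comp measurable_snd)
  have hind : Measurable ind := Measurable.of_discrete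
  have hT : Measurable fun p : (J → Obs dx ds) × Full dx ds => ind (T p.2) :=
    hind.comp (measurable_T.comp measurable_snd)
  have hR : Measurable fun p : (J → Obs dx ds) × Full dx ds => ind (R p.2) :=
    hind.comp (measurable_R.comp measurable_snd)
  exact (((((hmu true).sub (hmu false)).add
    (((hT.mul hR).div (he.mul (hr true))).mul (hY.sub (hmuS true)))).sub
    ((((hT.const_sub 1).mul hR).div ((he.const_sub 1).mul (hr false))).mul
      (hY.sub (hmuS false)))).add ((hT.div he).mul ((hmuS true).sub (hmu true)))).sub
    (((hT.const_sub 1).div (he.const_sub 1)).mul ((hmuS false).sub (hmu false)))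

theorem LearnerMeasurable.measurable_score_unit (hL : LearnerMeasurable L) {N : ℕ}
    (J : Finset (Fin N)) (i : Fin N) :
    Measurable fun x : Fin N → Full dx ds =>
      SurrogateATE.score (L N J fun j => observe (x j)) (observe (x i)) :=
  (hL.score N J).comp ((measurable_observe_restrict J).prodMk (measurable_pi_apply i))

theorem LearnerMeasurable.deltaHat (hL : LearnerMeasurable L) {N : ℕ} (a : Fin N → Fin K) :
    Measurable fun x : Fin N → Full dx ds => (⟨x, a⟩ : Sample dx ds K N).deltaHat L := by
  have h : ∀ k, Measurable fun x : Fin N → Full dx ds =>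
      (⟨x, a⟩ : Sample dx ds K N).foldMean k
        (SurrogateATE.score ((⟨x, a⟩ : Sample dx ds K N).etaHat L k)) := by
    intro k
    set J : Finset (Fin N) := Finset.univ.filter fun i => a i = k with hJ
    change Measurable fun x : Fin N → Full dx ds =>
      (∑ i ∈ J, SurrogateATE.score (L N Jᶜ fun j => observe (x j)) (observe (x i))) / (J.card : ℝ)
    exact (Finset.measurable_fun_sum _ fun i _ => hL.measurable_score_unit Jᶜ i).div_const _
  exact (Finset.measurable_fun_sum Finset.univ fun k _ => h k).div_const _

theorem LearnerMeasurable.VHat (hL : LearnerMeasurable L) {N : ℕ} (a : Fin N → Fin K) :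
    Measurable fun x : Fin N → Full dx ds => (⟨x, a⟩ : Sample dx ds K N).VHat L := by
  have h : ∀ k, Measurable fun x : Fin N → Full dx ds =>
      (⟨x, a⟩ : Sample dx ds K N).foldMean k fun w =>
        psi ((⟨x, a⟩ : Sample dx ds K N).deltaHat L) ((⟨x, a⟩ : Sample dx ds K N).etaHat L k) w
          ^ 2 := by
    intro k
    set J : Finset (Fin N) := Finset.univ.filter fun i => a i = k with hJ
    change Measurable fun x : Fin N → Full dx ds =>
      (∑ i ∈ J, (SurrogateATE.score (L N Jᶜ fun j => observe (x j)) (observe (x i))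
        - (⟨x, a⟩ : Sample dx ds K N).deltaHat L) ^ 2) / (J.card : ℝ)
    exact (Finset.measurable_fun_sum _ fun i _ =>
      ((hL.measurable_score_unit Jᶜ i).sub (hL.deltaHat a)).pow_const 2).div_const _
  exact (Finset.measurable_fun_sum Finset.univ fun k _ => h k).div_const _

end Learners

/-! ### Replacing the limit by the truth; square integrability of the outcome. -/

section Population

variable {dx ds : ℕ} {P : Measure (Full dx ds)}

theorem AgreeAE.dist_eq {η₀ η₁ : Nuisance dx ds} (h : AgreeAE P η₀ η₁) (η : Nuisance dx ds) :
    distE P η η₀ = distE P η η₁ ∧ distR P η η₀ = distR P η η₁ ∧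
      distMu P η η₀ = distMu P η η₁ ∧ distMuS P η η₀ = distMuS P η η₁ := by
  refine ⟨eLpNorm_congr_ae ?_, eLpNorm_congr_ae ?_, eLpNorm_congr_ae ?_, eLpNorm_congr_ae ?_⟩
  · filter_upwards [h.e] with d hd using by rw [hd]
  · filter_upwards [h.r] with d hd using by rw [hd]
  · filter_upwards [h.mu] with d hd using by rw [hd]
  · filter_upwards [h.muS] with d hd using by rw [hd]

theorem MomentCondition.memLp_Y [IsProbabilityMeasure P] {C q : ℝ} (h : MomentCondition P C q)
    (hq : 2 < q) : MemLp Y 2 P := by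
  have h1 : ∀ t, MemLp (Ypot t : Full dx ds → ℝ) 2 P := fun t => by
    have : MemLp (Ypot t : Full dx ds → ℝ) (ENNReal.ofReal q) P :=
      ⟨(measurable_Ypot t).aestronglyMeasurable, (h.normY t).trans_lt ENNReal.ofReal_lt_top⟩
    refine this.mono_exponent ?_
    rw [← ENNReal.ofReal_ofNat 2]
    exact ENNReal.ofReal_le_ofReal hq.le
  refine ((h1 true).norm.add (h1 false).norm).of_le measurable_Y.aestronglyMeasurable
    (ae_of_all _ fun d => ?_)
  have h2 : ‖Y d‖ ≤ ‖Ypot true d‖ + ‖Ypot false d‖ := by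
    rcases hT : T d with _ | _ <;> simp only [Y, hT]
    · exact le_add_of_nonneg_left (norm_nonneg _)
    · exact le_add_of_nonneg_right (norm_nonneg _)
  exact h2.trans (le_abs_self _)

end Population

theorem tendsto_sqrt_mul_of_isLittleO {a : ℕ → ℝ}
    (h : a =o[atTop] fun N : ℕ => (N : ℝ) ^ (-(1 / 2) : ℝ)) :
    Tendsto (fun N : ℕ => √(N : ℝ) * a N) atTop (𝓝 0) := by
  refine h.tendsto_div_nhds_zero.congr fun N => ?_
  rw [Real.rpow_neg (Nat.cast_nonneg N), ← Real.sqrt_eq_rpow, div_inv_eq_mul, mul_comm]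

theorem mem_waldInterval_iff {N : ℕ} (hN : 0 < N) (δ δ' V α : ℝ) :
    δ ∈ waldInterval N δ' V α ↔ |√(N : ℝ) * (δ' - δ)| < stdNormalQuantile (1 - α / 2) * √V := by
  have hN' : 0 < √(N : ℝ) := by positivity
  have h1 : stdNormalQuantile (1 - α / 2) * √V
      = √(N : ℝ) * (stdNormalQuantile (1 - α / 2) * √(V / N)) := by
    rw [Real.sqrt_div' V (Nat.cast_nonneg N)]
    field_simp
  rw [h1, abs_mul, abs_of_pos hN', mul_lt_mul_iff_right₀ hN', abs_lt, waldInterval, Set.mem_Ioo]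
  constructor <;> rintro ⟨h2, h3⟩ <;> constructor <;> linarith

/-! ### Inference from vanishing nuisance errors and vanishing bias. -/

section Inference

variable {dx ds K : ℕ} {Ω 𝒰 : Type*} [MeasurableSpace Ω] [MeasurableSpace 𝒰] {μ : Measure Ω}
  [IsProbabilityMeasure μ] {P : Measure (Full dx ds)} [IsProbabilityMeasure P]
  {D : ℕ → Ω → Full dx ds} {F : FoldRule K 𝒰} {U : ℕ → Ω → 𝒰} {L : Learner dx ds} {ε : ℝ}

/-- The nuisance estimates of the `k`-th fold are within `c` of the truth, and their propensity
scores satisfy the overlap bounds. -/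
structure CloseNuisance (P : Measure (Full dx ds)) [IsProbabilityMeasure P] (ε : ℝ) (c : ℝ≥0∞)
    (η : Nuisance dx ds) : Prop where
  bounded : PropensityBounded P ε η
  e : distE P η (etaStar P) ≤ c
  r : distR P η (etaStar P) ≤ c
  mu : distMu P η (etaStar P) ≤ c
  muS : distMuS P η (etaStar P) ≤ c

-- Each of the four errors is `O_p` of a null sequence, hence below `c` up to probability `γ / 4`;
-- the propensity bounds fail on a null set only.
omit [MeasurableSpace 𝒰] [IsProbabilityMeasure μ] in
theorem measure_not_closeNuisance_le {k : Fin K} {ρe ρr ρmu ρmuS : ℕ → ℝ}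
    (he : IsBigOp μ (fun N ω => distE P ((sampleAt D F U N ω).etaHat L k) (etaStar P)) ρe)
    (hr : IsBigOp μ (fun N ω => distR P ((sampleAt D F U N ω).etaHat L k) (etaStar P)) ρr)
    (hmu : IsBigOp μ (fun N ω => distMu P ((sampleAt D F U N ω).etaHat L k) (etaStar P)) ρmu)
    (hmuS : IsBigOp μ (fun N ω => distMuS P ((sampleAt D F U N ω).etaHat L k) (etaStar P)) ρmuS)
    (hbound : ∀ N, ∀ᵐ ω ∂μ, PropensityBounded P ε ((sampleAt D F U N ω).etaHat L k))
    (hρe : Tendsto ρe atTop (𝓝 0)) (hρr : Tendsto ρr atTop (𝓝 0))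
    (hρmu : Tendsto ρmu atTop (𝓝 0)) (hρmuS : Tendsto ρmuS atTop (𝓝 0))
    {c : ℝ≥0∞} (hc : 0 < c) {γ : ℝ≥0∞} (hγ : 0 < γ) :
    ∀ᶠ N in atTop, μ {ω | ¬ CloseNuisance P ε c ((sampleAt D F U N ω).etaHat L k)} ≤ γ := by
  have hγ' : 0 < γ / 2 / 2 := ENNReal.half_pos (ENNReal.half_pos hγ.ne').ne'
  filter_upwards [he.measure_lt_le hρe hc hγ', hr.measure_lt_le hρr hc hγ',
    hmu.measure_lt_le hρmu hc hγ', hmuS.measure_lt_le hρmuS hc hγ'] with N h1 h2 h3 h4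
  refine (measure_mono_ae ?_).trans (measure_le_of_subset_union subset_rfl
    (measure_le_of_subset_union subset_rfl h1 h2) (measure_le_of_subset_union subset_rfl h3 h4))
  filter_upwards [hbound N] with ω hω hcl
  by_contra hcon
  have h5 := fun h6 => hcon (Or.inl (Or.inl h6))
  have h6 := fun h6 => hcon (Or.inl (Or.inr h6))
  have h7 := fun h6 => hcon (Or.inr (Or.inl h6))
  have h8 := fun h6 => hcon (Or.inr (Or.inr h6))
  exact hcl ⟨hω, not_lt.1 h5, not_lt.1 h6, not_lt.1 h7, not_lt.1 h8⟩

/-- The difference between the scores at the estimated and at the true nuisance parameters. -/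
def scoreDiff (P : Measure (Full dx ds)) [IsProbabilityMeasure P] (L : Learner dx ds) (N : ℕ)
    (J : Finset (Fin N)) (w : J → Obs dx ds) (d : Full dx ds) : ℝ :=
  score (L N J w) (observe d) - score (etaStar P) (observe d)

omit [MeasurableSpace 𝒰] [IsProbabilityMeasure μ] in
theorem vanishingL2_scoreDiff (h : PropensityBounded P ε (etaStar P)) (hε : 0 < ε) (hε1 : ε ≤ 1)
    (hY : MemLp Y 2 P) (hL : LearnerMeasurable L) {k : Fin K}
    (hclose : ∀ c : ℝ≥0∞, 0 < c → ∀ γ : ℝ≥0∞, 0 < γ → ∀ᶠ N in atTop,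
      μ {ω | ¬ CloseNuisance P ε c ((sampleAt D F U N ω).etaHat L k)} ≤ γ) :
    VanishingL2 μ P D F U k (scoreDiff P L) := by
  intro κ hκ γ hγ
  -- The minimum with `1` makes the target level finite, as the continuity statement requires.
  obtain ⟨c, hc, hcont⟩ := exists_score_continuity h hε hε1 hY (lt_min hκ one_pos)
    ((min_le_right κ 1).trans_lt ENNReal.one_lt_top).ne
  filter_upwards [hclose c hc γ hγ] with N hN
  refine (measure_mono fun ω hω hcl => ?_).trans hN
  exact absurd ((hcont _ (hL.isMeasurable N _ _) hcl.bounded hcl.e hcl.r hcl.mu hcl.muS).trans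
    (min_le_left _ _)) (not_le.2 hω)

-- The deterministic bias bound is applied to the realized estimates. Off an event of vanishing
-- probability the distances are at most `1`, hence finite, so passing to real numbers loses
-- nothing.
omit [MeasurableSpace 𝒰] [IsProbabilityMeasure μ] in
theorem isLittleOP_bias (hu : Unconfounded P) (h : PropensityBounded P ε (etaStar P)) (hε : 0 < ε)
    (hε1 : ε ≤ 1) (hY : MemLp Y 2 P) (hL : LearnerMeasurable L) {k : Fin K} {a b : ℕ → ℝ}
    (hclose : ∀ c : ℝ≥0∞, 0 < c → ∀ γ : ℝ≥0∞, 0 < γ → ∀ᶠ N in atTop,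
      μ {ω | ¬ CloseNuisance P ε c ((sampleAt D F U N ω).etaHat L k)} ≤ γ)
    (ha : IsBigOp μ (fun N ω => distE P ((sampleAt D F U N ω).etaHat L k) (etaStar P)
      * distMu P ((sampleAt D F U N ω).etaHat L k) (etaStar P)) a)
    (hb : IsBigOp μ (fun N ω => distR P ((sampleAt D F U N ω).etaHat L k) (etaStar P)
      * distMuS P ((sampleAt D F U N ω).etaHat L k) (etaStar P)) b)
    (ha0 : Tendsto (fun N : ℕ => √(N : ℝ) * a N) atTop (𝓝 0))
    (hb0 : Tendsto (fun N : ℕ => √(N : ℝ) * b N) atTop (𝓝 0)) :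
    IsLittleOP μ fun (N : ℕ) ω =>
      √(N : ℝ) * ∫ d, scoreDiff P L N _ ((sampleAt D F U N ω).train k) d ∂P := by
  have hsum := ((ha.isLittleOP_mul ha0 fun N => Real.sqrt_nonneg _).add
    (hb.isLittleOP_mul hb0 fun N => Real.sqrt_nonneg _)).const_mul (2 * ε⁻¹ ^ 2)
  refine hsum.of_eq_off (hclose 1 one_pos) (Eventually.of_forall fun N ω hω => ?_)
  have hcl : CloseNuisance P ε 1 ((sampleAt D F U N ω).etaHat L k) := not_not.1 hω
  have hfin : ∀ {x : ℝ≥0∞}, x ≤ 1 → x ≠ ∞ := fun hx => (hx.trans_lt ENNReal.one_lt_top).ne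
  obtain ⟨hint, hle⟩ := enorm_integral_score_sub_le hu h hε hε1 hY (hL.isMeasurable N _ _)
    hcl.bounded (hfin hcl.mu) (hfin hcl.muS)
  have hstar : Integrable (fun d => score (etaStar P) (observe d)) P :=
    (memLp_score_etaStar h hε hε1 hY).integrable one_le_two
  have h1 : ∫ d, scoreDiff P L N _ ((sampleAt D F U N ω).train k) d ∂P
      = ∫ d, score ((sampleAt D F U N ω).etaHat L k) (observe d) ∂P - deltaStar P := by
    rw [← integral_score_etaStar hu h hε hε1 hY]
    exact integral_sub hint hstar
  set η := (sampleAt D F U N ω).etaHat L k with hη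
  have hA := ENNReal.mul_ne_top (hfin hcl.e) (hfin hcl.mu)
  have hB := ENNReal.mul_ne_top (hfin hcl.r) (hfin hcl.muS)
  have h2 : |∫ d, score η (observe d) ∂P - deltaStar P| ≤ 2 * ε⁻¹ ^ 2 *
      ((distE P η (etaStar P) * distMu P η (etaStar P)).toReal
        + (distR P η (etaStar P) * distMuS P η (etaStar P)).toReal) := by
    have h3 := ENNReal.toReal_mono (ENNReal.mul_ne_top (by finiteness)
      (ENNReal.add_ne_top.2 ⟨hA, hB⟩)) hle
    rwa [toReal_enorm, Real.norm_eq_abs, ENNReal.toReal_mul, ENNReal.toReal_mul,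
      ENNReal.toReal_ofReal (by positivity), ENNReal.toReal_add hA hB] at h3
  rw [h1, abs_mul, abs_of_nonneg (Real.sqrt_nonneg _)]
  refine le_trans ?_ (le_abs_self _)
  refine (mul_le_mul_of_nonneg_left h2 (Real.sqrt_nonneg _)).trans_eq ?_
  ring

/-- The cross-fitted variance estimator is consistent, and the Wald interval has asymptotically
the nominal coverage. -/
theorem consistency_and_coverage (hK : 0 < K) (hdesign : Design μ P D F U)
    (hL : LearnerMeasurable L) (hu : Unconfounded P) (h : PropensityBounded P ε (etaStar P))
    (hε : 0 < ε) (hε1 : ε ≤ 1) (hY : MemLp Y 2 P)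
    (hclose : ∀ k, ∀ c : ℝ≥0∞, 0 < c → ∀ γ : ℝ≥0∞, 0 < γ → ∀ᶠ N in atTop,
      μ {ω | ¬ CloseNuisance P ε c ((sampleAt D F U N ω).etaHat L k)} ≤ γ)
    (hbias : ∀ k, IsLittleOP μ fun (N : ℕ) ω =>
      √(N : ℝ) * ∫ d, scoreDiff P L N _ ((sampleAt D F U N ω).train k) d ∂P) :
    TendstoInMeasure μ (fun N ω => (sampleAt D F U N ω).VHat L) atTop (fun _ => VStar P) ∧
    (0 < VStar P → ∀ α ∈ Set.Ioo (0 : ℝ) 1,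
      Tendsto (fun N => μ.real {ω | deltaStar P ∈ waldInterval N
          ((sampleAt D F U N ω).deltaHat L) ((sampleAt D F U N ω).VHat L) α})
        atTop (𝓝 (1 - α))) := by
  set f : Full dx ds → ℝ := fun d => psi (deltaStar P) (etaStar P) (observe d) with hf
  have hfm : Measurable f := by
    have := (measurable_armScore (etaStar_isMeasurable (P := P)) true).sub
      (measurable_armScore (etaStar_isMeasurable (P := P)) false)
    refine Measurable.sub_const ?_ _
    simp only [score_observe]
    exact this
  have hfL : MemLp f 2 P := (memLp_score_etaStar h hε hε1 hY).sub (memLp_const _)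
  have hf0 : ∫ d, f d ∂P = 0 := by
    simp only [hf, psi]
    rw [integral_sub ((memLp_score_etaStar h hε hε1 hY).integrable one_le_two)
      (integrable_const _), integral_score_etaStar hu h hε hε1 hY]
    simp
  have hf2 : ∫⁻ d, ENNReal.ofReal (f d ^ 2) ∂P ≠ ∞ := by
    rw [← eLpNorm_two_sq]
    exact ENNReal.pow_ne_top hfL.2.ne
  have hg : ∀ N (J : Finset (Fin N)), Measurable fun p : (J → Obs dx ds) × Full dx ds =>
      scoreDiff P L N J p.1 p.2 := by
    intro N J
    refine (hL.score N J).sub (Measurable.comp (g := fun d => score (etaStar P) (observe d)) ?_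
      measurable_snd)
    simpa [hf, psi] using hfm.add_const (deltaStar P)
  have herr : ∀ N ω k d, (sampleAt D F U N ω).scoreError L f (deltaStar P) k d
      = scoreDiff P L N _ ((sampleAt D F U N ω).train k) d := by
    intro N ω k d
    simp only [Sample.scoreError, hf, psi, sub_add_cancel]
    rfl
  have hv := fun k => vanishingL2_scoreDiff h hε hε1 hY hL (hclose k)
  have hE := hdesign.isLittleOP_deltaHat (L := L) (δ := deltaStar P) hK hfm hf2 hf0 fun k => by
    simp only [herr]
    exact hdesign.isLittleOP_foldSum k hg (hv k) (hbias k)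
  have hG := hdesign.tendstoInDistribution_sum hfm hfL hf0
  have hδm : ∀ N, Measurable fun ω => (sampleAt D F U N ω).deltaHat L := fun N =>
    hdesign.measurable_statistic N (G := fun s : Sample dx ds K N => s.deltaHat L) hL.deltaHat
  have hVm : ∀ N, Measurable fun ω => (sampleAt D F U N ω).VHat L := fun N =>
    hdesign.measurable_statistic N (G := fun s : Sample dx ds K N => s.VHat L) hL.VHat
  have hGm : ∀ N : ℕ, Measurable fun ω => (√(N : ℝ))⁻¹ * ∑ i : Fin N, f (D i ω) := fun N =>
    (Finset.measurable_fun_sum _ fun (i : Fin N) _ =>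
      hfm.comp (hdesign.measurable_unit i)).const_mul _
  have hδ : IsLittleOP μ fun N ω => (sampleAt D F U N ω).deltaHat L - deltaStar P := by
    have hfix : IsBoundedP μ fun (N : ℕ) ω => (√(N : ℝ))⁻¹ * ∑ i : Fin N, f (D i ω) := by
      refine isBoundedP_of_lintegral_sq hf2 (fun N => (hGm N).aemeasurable)
        (Eventually.of_forall fun N => lintegral_sq_inv_sqrt_mul_le ?_)
      simpa [hf0] using hdesign.lintegral_sq_sum_le N hfm hf2 le_rfl
    refine isLittleOP_of_sqrt_mul ((hE.isBoundedP.add hfix).of_le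
      -- The remainder plus the normalized sum is `√N (δ̂ - δ*)` itself, which is therefore bounded
      -- in probability.
      (Eventually.of_forall fun N => ae_of_all _ fun ω => ?_))
    rw [sub_add_cancel]
  have hV : TendstoInMeasure μ (fun N ω => (sampleAt D F U N ω).VHat L) atTop
      (fun _ => VStar P) :=
    (hdesign.isLittleOP_VHat hK hfm hfL.integrable_sq hδ fun k => by
      simp only [herr]
      exact hdesign.isLittleOP_foldMean_sq k hg (hv k)).tendstoInMeasure
  refine ⟨hV, fun hpos α hα => ?_⟩
  -- The Gaussian part is the normalized sum of `f`, and the negligible part is the remainder of the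
  -- linear expansion.
  refine (tendsto_measure_studentized_lt hpos hG hE
    (fun N => ((((hδm N).sub_const _).const_mul _).sub (hGm N)).aemeasurable) hV
    (fun N => (hVm N).aemeasurable) hα).congr' ?_
  filter_upwards [eventually_gt_atTop 0] with N hN
  simp only [mem_waldInterval_iff hN, add_sub_cancel]

end Inference

end
end SurrogateATE

/-! ### Assembly of the theorem from its assumptions. -/

theorem theorem5 {dx ds K : ℕ} (hK : 0 < K)
    {Ω 𝒰 : Type*} [MeasurableSpace Ω] [MeasurableSpace 𝒰]
    (μ : Measure Ω) [IsProbabilityMeasure μ]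
    (P : Measure (SurrogateATE.Full dx ds)) [IsProbabilityMeasure P]
    (D : ℕ → Ω → SurrogateATE.Full dx ds)
    (F : SurrogateATE.FoldRule K 𝒰) (U : ℕ → Ω → 𝒰)
    (L : SurrogateATE.Learner dx ds)
    (hdesign : SurrogateATE.Design μ P D F U)
    (hL : SurrogateATE.LearnerMeasurable L)
    -- unconfoundedness, strict overlap, moment condition
    (ε C q : ℝ) (hε : ε ∈ Set.Ioo (0 : ℝ) (1 / 2)) (hC : 0 < C) (hq : 2 < q)
    (hunconf : SurrogateATE.Unconfounded P)
    (hoverlap : SurrogateATE.StrictOverlap P ε)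
    (hmoment : SurrogateATE.MomentCondition P C q)
    -- convergence of the nuisance estimators to a limit `η₀`, at given rates
    (η₀ : SurrogateATE.Nuisance dx ds)
    (ρe ρr ρmu ρmuS : ℕ → ℝ)
    (hρpos : ∀ N, 0 < ρe N ∧ 0 < ρr N ∧ 0 < ρmu N ∧ 0 < ρmuS N)
    (hconve : ∀ k : Fin K, SurrogateATE.IsBigOp μ (fun N ω => SurrogateATE.distE P
      ((SurrogateATE.drawSample F (fun i => D i ω) (U N ω) N).etaHat L k) η₀) ρe)
    (hconvr : ∀ k : Fin K, SurrogateATE.IsBigOp μ (fun N ω => SurrogateATE.distR P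
      ((SurrogateATE.drawSample F (fun i => D i ω) (U N ω) N).etaHat L k) η₀) ρr)
    (hconvmu : ∀ k : Fin K, SurrogateATE.IsBigOp μ (fun N ω => SurrogateATE.distMu P
      ((SurrogateATE.drawSample F (fun i => D i ω) (U N ω) N).etaHat L k) η₀) ρmu)
    (hconvmuS : ∀ k : Fin K, SurrogateATE.IsBigOp μ (fun N ω => SurrogateATE.distMuS P
      ((SurrogateATE.drawSample F (fun i => D i ω) (U N ω) N).etaHat L k) η₀) ρmuS)
    (hbound : ∀ (N : ℕ) (k : Fin K), ∀ᵐ ω ∂μ, SurrogateATE.PropensityBounded P ε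
      ((SurrogateATE.drawSample F (fun i => D i ω) (U N ω) N).etaHat L k))
    (hbound₀ : SurrogateATE.PropensityBounded P ε η₀)
    -- rate conditions
    (hρe : Tendsto ρe atTop (𝓝 0)) (hρr : Tendsto ρr atTop (𝓝 0))
    (hρmu : Tendsto ρmu atTop (𝓝 0)) (hρmuS : Tendsto ρmuS atTop (𝓝 0))
    (hρr_muS : (fun N => ρr N * ρmuS N) =o[atTop] fun N : ℕ => (N : ℝ) ^ (-(1 / 2) : ℝ))
    (hρe_muS : (fun N => ρe N * ρmuS N) =o[atTop] fun N : ℕ => (N : ℝ) ^ (-(1 / 2) : ℝ))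
    (hρe_mu : (fun N => ρe N * ρmu N) =o[atTop] fun N : ℕ => (N : ℝ) ^ (-(1 / 2) : ℝ))
    -- all nuisance components are correctly specified
    (hcorrect : SurrogateATE.AgreeAE P η₀ (SurrogateATE.etaStar P)) :
    TendstoInMeasure μ
      (fun N ω => (SurrogateATE.drawSample F (fun i => D i ω) (U N ω) N).VHat L)
      atTop (fun _ => SurrogateATE.VStar P) ∧
    (0 < SurrogateATE.VStar P → ∀ α ∈ Set.Ioo (0 : ℝ) 1,
      Tendsto
        (fun N => μ.real {ω | SurrogateATE.deltaStar P ∈ SurrogateATE.waldInterval N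
          ((SurrogateATE.drawSample F (fun i => D i ω) (U N ω) N).deltaHat L)
          ((SurrogateATE.drawSample F (fun i => D i ω) (U N ω) N).VHat L) α})
        atTop (𝓝 (1 - α))) := by
  have hε0 : 0 < ε := hε.1
  have hε1 : ε ≤ 1 := by linarith [hε.2]
  -- Correct specification turns distances to the limit `η₀` into distances to the truth.
  have hdist := hcorrect.dist_eq
  have he := fun k => by simpa only [(hdist _).1] using hconve k
  have hr := fun k => by simpa only [(hdist _).2.1] using hconvr k
  have hmu := fun k => by simpa only [(hdist _).2.2.1] using hconvmu k
  have hmuS := fun k => by simpa only [(hdist _).2.2.2] using hconvmuS k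
  have hP := hoverlap.propensityBounded
  have hY := hmoment.memLp_Y hq
  have hclose := fun k c (hc : 0 < c) γ (hγ : 0 < γ) =>
    SurrogateATE.measure_not_closeNuisance_le (he k) (hr k) (hmu k) (hmuS k)
      (fun N => hbound N k) hρe hρr hρmu hρmuS hc hγ
  exact SurrogateATE.consistency_and_coverage hK hdesign hL hunconf hP hε0 hε1 hY hclose fun k =>
    SurrogateATE.isLittleOP_bias hunconf hP hε0 hε1 hY hL (hclose k)
      ((he k).mul (hmu k) fun N => (hρpos N).1) ((hr k).mul (hmuS k) fun N => (hρpos N).2.1)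
      (SurrogateATE.tendsto_sqrt_mul_of_isLittleO hρe_mu) (SurrogateATE.tendsto_sqrt_mul_of_isLittleO hρr_muS)
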